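/- Let $g$, $\omega=\frac i2\sum_j dz_j\wedge d\bar z_j$ and $\Omega=dz_1\wedge dz_2\wedge dz_3$ be the standard metric, Kähler form and holomorphic volume form on $\mathbb C^3$, let $\mathcal S^5$ be the unit sphere, and write $x\times y=(\bar x_2\bar y_3-\bar x_3\bar y_2,\ \bar x_3\bar y_1-\bar x_1\bar y_3,\ \bar x_1\bar y_2-\bar x_2\bar y_1)$. Let $\Sigma$ be a Riemann surface diffeomorphic to $T^2$, and call $(s,t)$ oriented conformal coordinates on $\Sigma$ if $s+it$ is a local holomorphic coordinate. Let $N_0=\{r\phi(\sigma):\sigma\in\Sigma,\ r\in\mathbb R\}$ be an r-oriented two-sided special Lagrangian cone over $\Sigma$, that is, $\phi:\Sigma\to\mathcal S^5$ is a real analytic immersion such that in all oriented conformal coordinates $$\omega\Bigl(\phi,\frac{\partial\phi}{\partial s}\Bigr)\equiv0\quad\text{and}\quad \frac{\partial\phi}{\partial t}\equiv\phi\times\frac{\partial\phi}{\partial s}.$$ Then there are a lattice $\Lambda\subset\mathbb C$ and a surjective holomorphic map $p:\mathbb C\to\Sigma$ with $p(z)=p(z')$ if and only if $z-z'\in\Lambda$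 (so $\Sigma\cong\mathbb C/\Lambda$) such that the following holds. Write $z=s+it$ for the coordinate on $\mathbb C$. For $u,v\in\mathbb R$ there is a well-defined smooth map $\psi_{u,v}:\Sigma\to\mathbb C^3$, with $g(\phi,\psi_{u,v})\equiv0$, given by $$\psi_{u,v}(p(s+it))=u\,\frac{\partial(\phi\circ p)}{\partial s}+v\,\frac{\partial(\phi\circ p)}{\partial t}.$$ Let $N_{u,v}$ be the r-oriented ruled 3-fold $\Sigma\times\mathbb R$ with the (possibly singular) immersion $\iota_{u,v}(\sigma,r)=r\phi(\sigma)+\psi_{u,v}(\sigma)$ into $\mathbb C^3$, whose ruling lines are the images of $\{\sigma\}\times\mathbb R$, oriented by $\phi(\sigma)$. Then: (a) For all $u,v$, the map $\iota_{u,v}$ is an immersion on a dense subset of $\Sigma\times\mathbb R$, and wherever it is an immersion $N_{u,v}$ is special Lagrangian with phase $1$: its tangent spaces, oriented by $(\partial_r,\partial_s,\partial_t)$, are calibrated by $\mathrm{Re}\,\Omega$. (b) For all $u,v$, the asymptotic cone of $N_{u,v}$, that is, the set of all vectors parallel to some ruling line, is $N_0$. (c) For all $u,v$, the image of $N_{u,v}$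 is closed and $N_{u,v}$ is asymptotic to $N_0$ with order $O(r^{-1})$: there are $R>0$, a compact $K\subset\Sigma\times\mathbb R$ outside which $\iota_{u,v}$ is an immersion, and a diffeomorphism $\Phi:\{(\sigma,r):|r|>R\}\to(\Sigma\times\mathbb R)\setminus K$ such that $h(\sigma,r)=\iota_{u,v}(\Phi(\sigma,r))-r\phi(\sigma)$ satisfies, for every $k\ge0$, $$|\nabla^kh|=O(|r|^{-1-k})\quad\text{as }|r|\to\infty,$$ uniformly on $\Sigma$, where $\nabla$ and $|\cdot|$ are the Levi-Civita connection and the norm of the cone metric, the metric induced by $(\sigma,r)\mapsto r\phi(\sigma)$. (d) The $N_{u,v}$ are distinct as r-oriented ruled 3-folds: if $(u,v)\ne(u',v')$ then the sets of oriented ruling lines of $N_{u,v}$ and $N_{u',v'}$ are different. -/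

import Mathlib

open scoped Manifold ContDiff ComplexConjugate

noncomputable section

/-! ### The flat Calabi-Yau structure of complex 3-space -/

/-- `ℂ³` with its Hermitian norm; its real inner product `inner ℝ` is the metric `g`. -/
abbrev C3 : Type := EuclideanSpace ℂ (Fin 3)

/-- The Kähler form `ω = (i/2) ∑ dz_j ∧ dz̄_j`, that is `ω(x, y) = Im ∑ conj(x_j) y_j`. -/
def kahlerForm (x y : C3) : ℝ := (∑ j : Fin 3, conj (x j) * y j).im

/-- The holomorphic volume form `Ω = dz₁ ∧ dz₂ ∧ dz₃`. -/
def holVolForm (v : Fin 3 → C3) : ℂ := Matrix.det (Matrix.of fun i j => v i j)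

/-- The anti-bilinear cross product on `ℂ³`. -/
def crossC3 (x y : C3) : C3 :=
  !₂[conj (x 1) * conj (y 2) - conj (x 2) * conj (y 1),
     conj (x 2) * conj (y 0) - conj (x 0) * conj (y 2),
     conj (x 0) * conj (y 1) - conj (x 1) * conj (y 0)]

/-- The oriented 3-plane with oriented basis `v` is calibrated by `Re Ω`: the restriction of `Re Ω`
to the plane is its volume form. Both forms are multiples of each other, so it is enough to evaluate
them on `v`; the volume form takes the value `√(det ⟨v_i, v_j⟩)` there. -/
def IsCalibratedFrame (v : Fin 3 → C3) : Prop :=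
  (holVolForm v).re = Real.sqrt (Matrix.det (Matrix.gram ℝ v))

/-! ### Riemann surfaces and special Lagrangian cones over them -/

/-- The partial derivative `∂f/∂s` in the coordinate `z = s + it`. -/
def partialS (f : ℂ → C3) (z : ℂ) : C3 := fderiv ℝ f z 1

/-- The partial derivative `∂f/∂t` in the coordinate `z = s + it`. -/
def partialT (f : ℂ → C3) (z : ℂ) : C3 := fderiv ℝ f z Complex.I

section Surface

variable (S : Type*) [TopologicalSpace S] [ChartedSpace ℂ S]

/-- `S` is diffeomorphic to the 2-torus. -/
def IsTorus : Prop :=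
  Nonempty (Diffeomorph 𝓘(ℝ, ℂ) ((𝓡 1).prod (𝓡 1)) S (Circle × Circle) ∞)

variable {S}

/-- All holomorphic coordinates `z = s + it` on open subsets of the Riemann surface `S`; the pairs
`(s, t)` are the oriented conformal coordinates on `S`. -/
def holCoords : Set (OpenPartialHomeomorph S ℂ) := IsManifold.maximalAtlas 𝓘(ℂ) ω S

/-- `φ : S → S⁵` defines the r-oriented two-sided special Lagrangian cone
`{r φ(σ) : σ ∈ S, r ∈ ℝ}` over the Riemann surface `S`: it is a real analytic immersion into the
unit sphere with `ω(φ, ∂φ/∂s) = 0` and `∂φ/∂t = φ × ∂φ/∂s` in all oriented conformal coordinates. -/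
structure IsSLCone (φ : S → C3) : Prop where
  analytic : ContMDiff 𝓘(ℝ, ℂ) 𝓘(ℝ, C3) ω φ
  norm_eq_one : ∀ σ, ‖φ σ‖ = 1
  immersion : ∀ σ, Function.Injective (mfderiv 𝓘(ℝ, ℂ) 𝓘(ℝ, C3) φ σ)
  legendrian : ∀ e ∈ holCoords (S := S), ∀ z ∈ e.target,
    kahlerForm (φ (e.symm z)) (partialS (φ ∘ e.symm) z) = 0
  special : ∀ e ∈ holCoords (S := S), ∀ z ∈ e.target,
    partialT (φ ∘ e.symm) z = crossC3 (φ (e.symm z)) (partialS (φ ∘ e.symm) z)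

/-- The map `(σ, r) ↦ r φ(σ)` parametrizing a two-sided cone. -/
def conePoint (φ : S → C3) (q : S × ℝ) : C3 := q.2 • φ q.1

/-- The cone itself, as a subset of `ℂ³`. -/
def coneSet (φ : S → C3) : Set C3 := Set.range (conePoint φ)

/-- A lattice uniformization of the Riemann surface `S`: a holomorphic map `p` from `ℂ` onto `S`
which identifies `S` with the quotient of `ℂ` by the lattice `ℤ a + ℤ b`. -/
structure IsLatticeUniformization (a b : ℂ) (p : ℂ → S) : Prop where
  linearIndependent : LinearIndependent ℝ ![a, b]
  holomorphic : MDifferentiable 𝓘(ℂ) 𝓘(ℂ) p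
  surjective : Function.Surjective p
  eq_iff : ∀ z w : ℂ, p z = p w ↔ ∃ m n : ℤ, z - w = m * a + n * b

end Surface

/-! ### Ruled submanifolds -/

/-- An r-oriented ruled (possibly singular, immersed) 3-fold in `ℂ³` with base `S`. The line over
`σ` is oriented by its unit direction `φ σ`, and `ψ σ` is the point of the line orthogonal to `φ σ`.
As a manifold it is `S × ℝ`, mapped to `ℂ³` by `(σ, r) ↦ r φ(σ) + ψ(σ)`. -/
structure RuledFold (S : Type*) [TopologicalSpace S] [ChartedSpace ℂ S] where
  φ : S → C3
  ψ : S → C3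
  smooth_φ : ContMDiff 𝓘(ℝ, ℂ) 𝓘(ℝ, C3) ∞ φ
  smooth_ψ : ContMDiff 𝓘(ℝ, ℂ) 𝓘(ℝ, C3) ∞ ψ
  norm_φ : ∀ σ, ‖φ σ‖ = 1
  orthogonal : ∀ σ, inner ℝ (φ σ) (ψ σ) = 0

namespace RuledFold

variable {S : Type*} [TopologicalSpace S] [ChartedSpace ℂ S] (N : RuledFold S)

/-- The (possibly singular) immersion of `S × ℝ`. -/
def point (q : S × ℝ) : C3 := q.2 • N.φ q.1 + N.ψ q.1

/-- The ruling line over `σ`. -/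
def line (σ : S) : AffineSubspace ℝ C3 := AffineSubspace.mk' (N.ψ σ) (Submodule.span ℝ {N.φ σ})

/-- The image of the 3-fold in `ℂ³`. -/
def carrier : Set C3 := Set.range N.point

/-- The asymptotic cone: all vectors parallel to some ruling line. -/
def asymptoticCone : Set C3 := {x | ∃ σ, x ∈ (N.line σ).direction}

/-- The family of oriented ruling lines. An oriented line in `ℂ³` is determined by, and determines,
the pair of its unit direction and its point orthogonal to that direction. -/
def orientedLines : Set (C3 × C3) := Set.range fun σ => (N.φ σ, N.ψ σ)

/-- The 3-fold is nonsingular at a point of `S × ℝ`: there the parametrization is an immersion. -/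
def NonsingularAt (q : S × ℝ) : Prop :=
  Function.Injective (mfderiv (𝓘(ℝ, ℂ).prod 𝓘(ℝ, ℝ)) 𝓘(ℝ, C3) N.point q)

/-- The 3-fold is special Lagrangian (with phase 1): it is nonsingular on a dense subset, and
wherever it is nonsingular its tangent spaces, oriented by `(∂/∂r, ∂/∂s, ∂/∂t)` for oriented
conformal coordinates `(s, t)` on `S`, are calibrated by `Re Ω`. -/
def IsSpecialLagrangian : Prop :=
  Dense {q | N.NonsingularAt q} ∧
  ∀ e ∈ holCoords (S := S), ∀ z ∈ e.target, ∀ r : ℝ, N.NonsingularAt (e.symm z, r) →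
    IsCalibratedFrame
      ![N.φ (e.symm z),
        partialS (fun z' => N.point (e.symm z', r)) z,
        partialT (fun z' => N.point (e.symm z', r)) z]

end RuledFold

/-! ### Covariant derivatives on immersed submanifolds, in coordinates -/

section Covariant

variable {F G : Type*} [NormedAddCommGroup F] [InnerProductSpace ℝ F]
  [NormedAddCommGroup G] [NormedSpace ℝ G]

/-- The Christoffel term `Γ_x(v, w)` of the Levi-Civita connection of the metric induced by an
immersion `ι` (in coordinates): the vector which `dι_x` maps to the part of `D²ι_x(v, w)` tangent to
the submanifold. -/
def christoffel (ι : ℂ × ℝ → F) (x v w : ℂ × ℝ) : ℂ × ℝ :=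
  Function.invFun (fderiv ℝ ι x)
    ((LinearMap.range (fderiv ℝ ι x).toLinearMap).starProjection
      (fderiv ℝ (fun y => fderiv ℝ ι y w) x v))

/-- The iterated covariant derivative `(∇ᵏ h)_x(v₁, …, v_k)` of a vector-valued function `h` for the
Levi-Civita connection of the metric induced by the immersion `ι`. -/
def covDeriv (ι : ℂ × ℝ → F) (h : ℂ × ℝ → G) : (k : ℕ) → ℂ × ℝ → (Fin k → ℂ × ℝ) → G
  | 0, x, _ => h x
  | k + 1, x, v =>
      fderiv ℝ (fun y => covDeriv ι h k y (Fin.tail v)) x (v 0)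
        - ∑ j : Fin k, covDeriv ι h k x
            (Function.update (Fin.tail v) j (christoffel ι x (v 0) (Fin.tail v j)))

/-- `|∇ᵏ h| ≤ B` at the point `x`, the norm being that of the metric induced by `ι`. -/
def CovDerivBound (ι : ℂ × ℝ → F) (h : ℂ × ℝ → G) (k : ℕ) (x : ℂ × ℝ) (B : ℝ) : Prop :=
  ∀ v : Fin k → ℂ × ℝ, ‖covDeriv ι h k x v‖ ≤ B * ∏ i, ‖fderiv ℝ ι x (v i)‖

end Covariant

/-- The ruled 3-fold `N` is asymptotic with order `O(r^α)` to the two-sided cone given by `φ`.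
The cone minus the closed ball of radius `R` is the manifold `{(σ, r) : |r| > R}`, immersed by
`(σ, r) ↦ r φ(σ)`, and `Φ` is a diffeomorphism from it onto the complement in `N` of the compact set
`K`, outside which `N` is nonsingular. With `h(x) = Φ(x) - x`, both points being taken in `ℂ³`, the
covariant derivatives `∇ᵏ h` for the cone metric satisfy `|∇ᵏ h| = O(r^(α - k))` for all `k ≥ 0`.
The norm `|∇ᵏ h|` does not depend on the coordinates in which it is calculated. -/
def AsymptoticToCone {S : Type*} [TopologicalSpace S] [ChartedSpace ℂ S]
    (N : RuledFold S) (φ : S → C3) (α : ℝ) : Prop :=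
  α < 1 ∧ IsClosed N.carrier ∧
  ∃ (R : ℝ) (K : Set (S × ℝ)) (Φ : OpenPartialHomeomorph (S × ℝ) (S × ℝ)),
    0 < R ∧ IsCompact K ∧ (∀ q ∉ K, N.NonsingularAt q) ∧
    Φ.source = {q | R < |q.2|} ∧ Φ.target = Kᶜ ∧
    ContMDiffOn (𝓘(ℝ, ℂ).prod 𝓘(ℝ, ℝ)) (𝓘(ℝ, ℂ).prod 𝓘(ℝ, ℝ)) ∞ Φ Φ.source ∧
    ContMDiffOn (𝓘(ℝ, ℂ).prod 𝓘(ℝ, ℝ)) (𝓘(ℝ, ℂ).prod 𝓘(ℝ, ℝ)) ∞ Φ.symm Φ.target ∧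
    ∀ k : ℕ, ∃ C ρ : ℝ, R ≤ ρ ∧ ∀ σ : S, ∃ e ∈ holCoords (S := S), σ ∈ e.source ∧
      ∀ r : ℝ, ρ < |r| →
        CovDerivBound (fun x => conePoint φ (e.symm x.1, x.2))
          (fun x => N.point (Φ (e.symm x.1, x.2)) - conePoint φ (e.symm x.1, x.2))
          k (e σ, r) (C * |r| ^ (α - k))

end

open MeasureTheory

/-! ### Algebra of the cross product -/

/-! The flat coordinate on the torus comes from the cone itself. In a conformal coordinate, `f_t = f
× f_s` gives the harmonic map equation `f_ss + f_tt = -2|f_s|² f`. This makes the cubic form `⟨f_z̄,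
f_zz⟩` holomorphic, up to a constant factor, so it defines a cubic differential on the torus
(`IsSLMap.differentiableAt_cubicForm`).

A section of a power of the canonical bundle of a torus has no zeros or vanishes identically
(`eq_zero_of_exists_zero`). The proof is by areas: after composition with a regularized radial
projection, a zero would contribute a fixed positive area, while the Jacobian of a doubly periodic
function has total integral zero and nearly nonnegative density. If the cubic differential vanished
identically, the complex line spanned by `f_z` would be constant, which the `f`-component of the
derivative of `f_z` excludes (`IsSLTorus.frameCubic_ne_zero`). So the cubic differential has a
smooth cube root on the plane, a closed one-form, and its primitive `F` is the flat coordinate. Its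
periods are translations up to cube roots of unity. After tripling they are genuine translations, so
`F` is a proper local homeomorphism and hence bijective; a nontrivial multiplier would then produce
a fixed point of a fixed-point-free translation (`IsSLTorus.exists_uniformization`).

In the flat coordinate the equations are invariant under translation, so `ψ = df(w)` solves the
linearized equation. The tangent space of `r f + ψ` is therefore spanned by `f`, `A` and `f × A + g
f` for real `g`, with `⟨f, A⟩` real, and such a frame is calibrated (`isCalibratedFrame_of_eq`).
Moreover `f × A` is affine in `r` with slope `f_t ≠ 0`, so each ruling line has at most one singular
point.

For the asymptotics, the point with parameters `(z - w/r, r)` differs from `r f(z)` by `r` times a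
second order Taylor remainder in `1/r`, that is by `r⁻¹ Q(z, r⁻¹)` with `Q` smooth up to `r⁻¹ = 0`.
Homogeneity of the cone metric makes each covariant derivative cost one more factor `r⁻¹`
(`IsSLMap.covDeriv_coneMap`).

If two deformations have the same oriented lines, Baire's theorem turns the correspondence between
base points into a map `g` on some open set with `f ∘ g = f`. It is affine with derivative `w'/w`,
the identity extends by analyticity, and for `w ≠ w'` differentiation at the fixed point of the
affine map is a contradiction (`IsSLMap.eq_of_forall_exists`). -/

theorem inner_C3 (x y : C3) :
    inner ℂ x y = conj (x 0) * y 0 + conj (x 1) * y 1 + conj (x 2) * y 2 := by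
  simp [PiLp.inner_apply, Fin.sum_univ_three, mul_comm]

theorem kahlerForm_eq (x y : C3) : kahlerForm x y = (inner ℂ x y : ℂ).im := by
  simp [kahlerForm, inner_C3, Fin.sum_univ_three]

theorem real_inner_C3 (x y : C3) : inner ℝ x y = (inner ℂ x y : ℂ).re := by
  simp [PiLp.inner_apply, Fin.sum_univ_three]

theorem crossC3_add_left (x x' y : C3) : crossC3 (x + x') y = crossC3 x y + crossC3 x' y := by
  ext i; fin_cases i <;> simp [crossC3] <;> ring

theorem crossC3_add_right (x y y' : C3) : crossC3 x (y + y') = crossC3 x y + crossC3 x y' := by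
  ext i; fin_cases i <;> simp [crossC3] <;> ring

theorem crossC3_real_smul_left (c : ℝ) (x y : C3) : crossC3 (c • x) y = c • crossC3 x y := by
  ext i; fin_cases i <;> simp [crossC3] <;> ring

theorem crossC3_real_smul_right (c : ℝ) (x y : C3) : crossC3 x (c • y) = c • crossC3 x y := by
  ext i; fin_cases i <;> simp [crossC3] <;> ring

@[simp] theorem crossC3_self (x : C3) : crossC3 x x = 0 := by
  ext i; fin_cases i <;> simp [crossC3] <;> ring

theorem crossC3_swap (x y : C3) : crossC3 y x = -crossC3 x y := by
  ext i; fin_cases i <;> simp [crossC3] <;> ring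

theorem inner_crossC3_left (x y : C3) : inner ℂ x (crossC3 x y) = (0 : ℂ) := by
  simp [inner_C3, crossC3]; ring

theorem inner_crossC3_right (x y : C3) : inner ℂ y (crossC3 x y) = (0 : ℂ) := by
  simp [inner_C3, crossC3]; ring

theorem crossC3_crossC3_left (x y : C3) :
    crossC3 x (crossC3 x y) = (inner ℂ x y : ℂ) • x - (inner ℂ x x : ℂ) • y := by
  ext i; rw [inner_C3, inner_C3]; fin_cases i <;> simp [crossC3] <;> ring

theorem crossC3_crossC3_right (x y : C3) :
    crossC3 y (crossC3 x y) = (inner ℂ y y : ℂ) • x - (inner ℂ y x : ℂ) • y := by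
  ext i; rw [inner_C3, inner_C3]; fin_cases i <;> simp [crossC3] <;> ring

theorem inner_crossC3_crossC3 (x y z : C3) :
    (inner ℂ (crossC3 x y) (crossC3 x z) : ℂ) =
      inner ℂ x x * inner ℂ z y - inner ℂ z x * inner ℂ x y := by
  rw [inner_C3, inner_C3, inner_C3, inner_C3, inner_C3]; simp [crossC3]; ring

/-- The cross product as a continuous real bilinear map. -/
noncomputable def crossL : C3 →L[ℝ] C3 →L[ℝ] C3 :=
  (LinearMap.mk₂ ℝ crossC3 crossC3_add_left crossC3_real_smul_left crossC3_add_right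
    crossC3_real_smul_right).toContinuousBilinearMap

@[simp] theorem crossL_apply (x y : C3) : crossL x y = crossC3 x y := rfl

theorem fderiv_crossC3_apply {E : Type*} [NormedAddCommGroup E] [NormedSpace ℝ E] {a b : E → C3}
    {x : E} (ha : DifferentiableAt ℝ a x) (hb : DifferentiableAt ℝ b x) (v : E) :
    fderiv ℝ (fun y => crossC3 (a y) (b y)) x v =
      crossC3 (a x) (fderiv ℝ b x v) + crossC3 (fderiv ℝ a x v) (b x) := by
  have := crossL.hasFDerivAt_of_bilinear ha.hasFDerivAt hb.hasFDerivAt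
  simp only [crossL_apply] at this
  rw [this.fderiv]
  simp [ContinuousLinearMap.precompR, ContinuousLinearMap.precompL]

theorem ContDiff.crossC3 {E : Type*} [NormedAddCommGroup E] [NormedSpace ℝ E] {a b : E → C3}
    {n : ℕ∞ω} (ha : ContDiff ℝ n a) (hb : ContDiff ℝ n b) :
    ContDiff ℝ n (fun y => crossC3 (a y) (b y)) :=
  crossL.isBoundedBilinearMap.contDiff.comp (ha.prodMk hb)

/-! ### Smoothness and symmetry of directional derivatives -/

section Deriv
variable {E F : Type*} [NormedAddCommGroup E] [NormedSpace ℝ E] [NormedAddCommGroup F]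
  [NormedSpace ℝ F]

theorem ContDiffOn.fderiv_apply_const {f : E → F} {V : Set E} (hf : ContDiffOn ℝ ∞ f V)
    (hV : IsOpen V) (v : E) : ContDiffOn ℝ ∞ (fun y => fderiv ℝ f y v) V :=
  (hf.fderiv_of_isOpen hV (m := ∞) (by simp)).clm_apply contDiffOn_const

theorem ContDiff.fderiv_apply_const {f : E → F} (hf : ContDiff ℝ ∞ f)
    (v : E) : ContDiff ℝ ∞ (fun y => fderiv ℝ f y v) :=
  (hf.fderiv_right (m := ∞) (by simp)).clm_apply contDiff_const

theorem ContDiffOn.differentiableAt_of_isOpen {f : E → F} {V : Set E} (hf : ContDiffOn ℝ ∞ f V)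
    (hV : IsOpen V) {x : E} (hx : x ∈ V) : DifferentiableAt ℝ f x :=
  (hf.contDiffAt (hV.mem_nhds hx)).differentiableAt (by simp)

theorem fderiv_fderiv_apply_const {f : E → F} {V : Set E} (hf : ContDiffOn ℝ ∞ f V)
    (hV : IsOpen V) {x : E} (hx : x ∈ V) (v w : E) :
    fderiv ℝ (fun y => fderiv ℝ f y v) x w = fderiv ℝ (fderiv ℝ f) x w v := by
  have : DifferentiableAt ℝ (fderiv ℝ f) x :=
    (hf.fderiv_of_isOpen hV (m := ∞) (by simp)).differentiableAt_of_isOpen hV hx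
  rw [fderiv_clm_apply this (by fun_prop)]
  simp

theorem fderiv_fderiv_comm {f : E → F} {V : Set E} (hf : ContDiffOn ℝ ∞ f V)
    (hV : IsOpen V) {x : E} (hx : x ∈ V) (v w : E) :
    fderiv ℝ (fun y => fderiv ℝ f y v) x w = fderiv ℝ (fun y => fderiv ℝ f y w) x v := by
  rw [fderiv_fderiv_apply_const hf hV hx, fderiv_fderiv_apply_const hf hV hx]
  have h2 : ((2 : ℕ∞) : ℕ∞ω) ≤ ((⊤ : ℕ∞) : ℕ∞ω) := WithTop.coe_le_coe.mpr le_top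
  have : IsSymmSndFDerivAt ℝ f x := (hf.contDiffAt (hV.mem_nhds hx)).isSymmSndFDerivAt
    (by rw [minSmoothness_of_isRCLikeNormedField]; exact h2)
  exact this w v

theorem ContDiffOn.fderiv_congr_of_isOpen {f g : E → F} {V : Set E} (hV : IsOpen V)
    (h : Set.EqOn f g V) {x : E} (hx : x ∈ V) : fderiv ℝ f x = fderiv ℝ g x :=
  Filter.EventuallyEq.fderiv_eq (Filter.eventuallyEq_of_mem (hV.mem_nhds hx) h)

end Deriv

theorem fderiv_complex_apply {F : Type*} [NormedAddCommGroup F] [NormedSpace ℝ F]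
    (T : ℂ →L[ℝ] F) (v : ℂ) : T v = v.re • T 1 + v.im • T Complex.I := by
  conv_lhs => rw [show v = v.re • (1 : ℂ) + v.im • Complex.I by
    simp [Complex.re_add_im]]
  rw [map_add, map_smul, map_smul]

/-! ### Special Legendrian immersions of plane domains -/

/-- A special Legendrian immersion of an open subset of the plane in conformal coordinates. -/
structure IsSLMap (f : ℂ → C3) (V : Set ℂ) : Prop where
  isOpen : IsOpen V
  smooth : ContDiffOn ℝ ∞ f V
  norm_eq_one : ∀ z ∈ V, ‖f z‖ = 1
  legendrian : ∀ z ∈ V, kahlerForm (f z) (partialS f z) = 0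
  special : ∀ z ∈ V, partialT f z = crossC3 (f z) (partialS f z)
  injective : ∀ z ∈ V, Function.Injective (fderiv ℝ f z)

namespace IsSLMap

variable {f : ℂ → C3} {V : Set ℂ} (hf : IsSLMap f V) {z : ℂ} (hz : z ∈ V)
include hf

theorem smooth_partialS : ContDiffOn ℝ ∞ (partialS f) V :=
  hf.smooth.fderiv_apply_const hf.isOpen 1

theorem smooth_partialT : ContDiffOn ℝ ∞ (partialT f) V :=
  hf.smooth.fderiv_apply_const hf.isOpen Complex.I

include hz

theorem differentiableAt : DifferentiableAt ℝ f z :=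
  hf.smooth.differentiableAt_of_isOpen hf.isOpen hz

theorem differentiableAt_partialS : DifferentiableAt ℝ (partialS f) z :=
  hf.smooth_partialS.differentiableAt_of_isOpen hf.isOpen hz

theorem differentiableAt_partialT : DifferentiableAt ℝ (partialT f) z :=
  hf.smooth_partialT.differentiableAt_of_isOpen hf.isOpen hz

theorem inner_self : (inner ℂ (f z) (f z) : ℂ) = 1 := by
  rw [inner_self_eq_norm_sq_to_K, hf.norm_eq_one z hz]; simp

/-- The real part vanishes because `‖f‖ = 1`, the imaginary part by the Legendrian condition. -/
theorem inner_partialS : (inner ℂ (f z) (partialS f z) : ℂ) = 0 := by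
  have h1 : fderiv ℝ (fun y => (inner ℂ (f y) (f y) : ℂ)) z 1 = 0 := by
    rw [ContDiffOn.fderiv_congr_of_isOpen (g := fun _ => (1 : ℂ)) hf.isOpen
      (fun y hy => hf.inner_self hy) hz]
    simp
  rw [fderiv_inner_apply ℂ (hf.differentiableAt hz) (hf.differentiableAt hz)] at h1
  have h2 := hf.legendrian z hz
  rw [kahlerForm_eq] at h2
  rw [← inner_conj_symm] at h1
  apply Complex.ext
  · have := congrArg Complex.re h1
    rw [Complex.add_re, Complex.conj_re, Complex.zero_re] at this
    rw [← inner_conj_symm, Complex.conj_re, Complex.zero_re]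
    change (inner ℂ (fderiv ℝ f z 1) (f z) : ℂ).re = 0
    linarith
  · exact h2

theorem inner_partialT : (inner ℂ (f z) (partialT f z) : ℂ) = 0 := by
  rw [hf.special z hz, inner_crossC3_left]

theorem inner_fderiv (v : ℂ) : (inner ℂ (f z) (fderiv ℝ f z v) : ℂ) = 0 := by
  rw [fderiv_complex_apply]
  have h1 := hf.inner_partialS hz
  have h2 := hf.inner_partialT hz
  rw [partialS] at h1
  rw [partialT] at h2
  simp [inner_smul_right_eq_smul, h1, h2]

theorem inner_partialS_partialT : (inner ℂ (partialS f z) (partialT f z) : ℂ) = 0 := by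
  rw [hf.special z hz, inner_crossC3_right]

theorem inner_partialT_partialS : (inner ℂ (partialT f z) (partialS f z) : ℂ) = 0 := by
  rw [← inner_conj_symm, hf.inner_partialS_partialT hz, map_zero]

theorem inner_partialT_partialT :
    (inner ℂ (partialT f z) (partialT f z) : ℂ) = inner ℂ (partialS f z) (partialS f z) := by
  rw [hf.special z hz, inner_crossC3_crossC3, hf.inner_self hz, hf.inner_partialS hz]
  ring

theorem cross_partialT : crossC3 (f z) (partialT f z) = -partialS f z := by
  rw [hf.special z hz, crossC3_crossC3_left, hf.inner_self hz, hf.inner_partialS hz]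
  simp

theorem cross_partialS_partialT :
    crossC3 (partialS f z) (partialT f z) = (inner ℂ (partialS f z) (partialS f z) : ℂ) • f z := by
  rw [hf.special z hz, crossC3_crossC3_right, ← inner_conj_symm (partialS f z) (f z),
    hf.inner_partialS hz]
  simp [-inner_self_eq_norm_sq_to_K]

/-- The operator `f ×` is thus the complex structure of the tangent plane, seen in the ambient
space. All detection of holomorphic coordinate changes rests on this. -/
theorem cross_fderiv (v : ℂ) :
    crossC3 (f z) (fderiv ℝ f z v) = fderiv ℝ f z (Complex.I * v) := by
  have h1 := hf.cross_partialT hz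
  have h2 := hf.special z hz
  rw [partialS] at h1 h2
  rw [partialT] at h1 h2
  rw [fderiv_complex_apply _ v, fderiv_complex_apply _ (Complex.I * v), crossC3_add_right,
    crossC3_real_smul_right, crossC3_real_smul_right, h1, ← h2]
  simp [add_comm]

theorem partialS_ne_zero : partialS f z ≠ 0 := by
  intro h
  have := hf.injective z hz (a₁ := 1) (a₂ := 0) (by simpa [partialS] using h)
  exact one_ne_zero this

theorem inner_fderiv_fderiv (v w : ℂ) : (inner ℂ (fderiv ℝ f z v) (fderiv ℝ f z w) : ℂ) =
    (inner ℂ (partialS f z) (partialS f z) : ℂ) * (v.re * w.re + v.im * w.im : ℝ) := by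
  have h1 := hf.inner_partialS_partialT hz
  have h2 := hf.inner_partialT_partialS hz
  have h3 := hf.inner_partialT_partialT hz
  rw [fderiv_complex_apply _ v, fderiv_complex_apply _ w]
  change inner ℂ (v.re • partialS f z + v.im • partialT f z)
    (w.re • partialS f z + w.im • partialT f z) = _
  simp [inner_add_left, inner_smul_right_eq_smul, inner_smul_left_eq_smul, h1, h2, h3,
    -inner_self_eq_norm_sq_to_K]
  ring

/-! #### Second derivatives -/

theorem partialS_partialT :
    partialS (partialT f) z = crossC3 (f z) (partialS (partialS f) z) := by
  have : fderiv ℝ (partialT f) z = fderiv ℝ (fun y => crossC3 (f y) (partialS f y)) z :=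
    ContDiffOn.fderiv_congr_of_isOpen hf.isOpen (fun y hy => hf.special y hy) hz
  rw [partialS, this, fderiv_crossC3_apply (hf.differentiableAt hz)
    (hf.differentiableAt_partialS hz)]
  change _ + crossC3 (partialS f z) (partialS f z) = _
  simp [partialS]

theorem partialT_partialS : partialT (partialS f) z = partialS (partialT f) z :=
  fderiv_fderiv_comm hf.smooth hf.isOpen hz _ _

theorem inner_partialS_partialS : (inner ℂ (f z) (partialS (partialS f) z) : ℂ) =
    -inner ℂ (partialS f z) (partialS f z) := by
  have h1 : fderiv ℝ (fun y => (inner ℂ (f y) (partialS f y) : ℂ)) z 1 = 0 := by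
    rw [ContDiffOn.fderiv_congr_of_isOpen (g := fun _ => (0 : ℂ)) hf.isOpen
      (fun y hy => hf.inner_partialS hy) hz]
    simp
  rw [fderiv_inner_apply ℂ (hf.differentiableAt hz) (hf.differentiableAt_partialS hz)] at h1
  exact eq_neg_of_add_eq_zero_left h1

theorem inner_partialS_partialT' : (inner ℂ (f z) (partialS (partialT f) z) : ℂ) = 0 := by
  rw [hf.partialS_partialT hz, inner_crossC3_left]

/-- The harmonic map equation: differentiate `f_t = f × f_s` in `t` and expand the double cross
product. -/
theorem partialT_partialT : partialT (partialT f) z = -partialS (partialS f) z -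
    (2 * inner ℂ (partialS f z) (partialS f z) : ℂ) • f z := by
  have : fderiv ℝ (partialT f) z = fderiv ℝ (fun y => crossC3 (f y) (partialS f y)) z :=
    ContDiffOn.fderiv_congr_of_isOpen hf.isOpen (fun y hy => hf.special y hy) hz
  rw [partialT, this, fderiv_crossC3_apply (hf.differentiableAt hz)
    (hf.differentiableAt_partialS hz)]
  change crossC3 (f z) (partialT (partialS f) z) + crossC3 (partialT f z) (partialS f z) = _
  rw [hf.partialT_partialS hz, hf.partialS_partialT hz, crossC3_swap (partialS f z),
    hf.cross_partialS_partialT hz, crossC3_crossC3_left, hf.inner_self hz,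
    hf.inner_partialS_partialS hz]
  module

end IsSLMap

/-! ### The cubic differential of a special Legendrian map -/

theorem eq_zero_of_inner_crossC3 {x y X : C3} (hx : (inner ℂ x x : ℂ) = 1)
    (hy : y ≠ 0) (hxy : (inner ℂ x y : ℂ) = 0) (h1 : (inner ℂ x X : ℂ) = 0)
    (h2 : (inner ℂ y X : ℂ) = 0) (h3 : (inner ℂ (crossC3 x y) X : ℂ) = 0) : X = 0 := by
  -- For `W = y × X` one has `x × W = 0` and `W ⊥ x`, so `x × (x × W) = ⟨x, W⟩ x - W` gives `W = 0`.
  -- The same identity with `y` twice then kills `X`.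
  have hW : crossC3 y X = 0 := by
    have e1 : crossC3 x (crossC3 y X) = (inner ℂ x X : ℂ) • y - (inner ℂ x y : ℂ) • X := by
      rw [inner_C3, inner_C3]; ext i; fin_cases i <;> simp [crossC3] <;> ring
    have e2 : (inner ℂ x (crossC3 y X) : ℂ) = conj (inner ℂ (crossC3 x y) X : ℂ) := by
      rw [inner_C3, inner_C3]; simp [crossC3]; ring
    have e3 := crossC3_crossC3_left x (crossC3 y X)
    rw [h1, hxy, zero_smul, zero_smul, sub_zero] at e1
    rw [e1, e2, h3, hx, map_zero, zero_smul, one_smul, zero_sub] at e3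
    have e5 : crossC3 x (0 : C3) = 0 := by ext i; fin_cases i <;> simp [crossC3]
    simpa [e5] using e3.symm
  have e4 := crossC3_crossC3_left y X
  rw [hW, h2] at e4
  have : (inner ℂ y y : ℂ) • X = 0 := by
    have e5 : crossC3 y (0 : C3) = 0 := by ext i; fin_cases i <;> simp [crossC3]
    rw [e5, zero_smul, zero_sub] at e4
    exact neg_eq_zero.mp e4.symm
  exact (smul_eq_zero.mp this).resolve_left (inner_self_ne_zero.mpr hy)

theorem differentiableAt_complex_of_real {f : ℂ → ℂ} {z : ℂ} (hf : DifferentiableAt ℝ f z)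
    (h : fderiv ℝ f z Complex.I = Complex.I * fderiv ℝ f z 1) : DifferentiableAt ℂ f z :=
  differentiableAt_complex_iff_differentiableAt_real.mpr ⟨hf, by simpa using h⟩

/-- `2 ∂f/∂z`. -/
noncomputable def partialZ (f : ℂ → C3) (z : ℂ) : C3 := partialS f z - Complex.I • partialT f z

/-- `2 ∂f/∂z̄`. -/
noncomputable def partialZbar (f : ℂ → C3) (z : ℂ) : C3 :=
  partialS f z + Complex.I • partialT f z

/-- The coefficient of the cubic differential of a special Legendrian immersion. -/
noncomputable def cubicForm (f : ℂ → C3) (z : ℂ) : ℂ :=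
  inner ℂ (partialZbar f z) (partialS (partialZ f) z)

/-- The square of the conformal factor of the induced metric. -/
noncomputable def metricFactor (f : ℂ → C3) (z : ℂ) : ℂ := inner ℂ (partialS f z) (partialS f z)

namespace IsSLMap

variable {f : ℂ → C3} {V : Set ℂ} (hf : IsSLMap f V) {z : ℂ} (hz : z ∈ V)
include hf

/-- By `cross_fderiv` the equation for `f ∘ g` reads `df(g_t) = df(i g_s)`. Injectivity of `df`
yields the Cauchy–Riemann equation for `g`. -/
theorem special_comp {g : ℂ → ℂ} (hz : g z ∈ V) (hg : DifferentiableAt ℝ g z)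
    (h : partialT (f ∘ g) z = crossC3 (f (g z)) (partialS (f ∘ g) z)) :
    DifferentiableAt ℂ g z := by
  apply differentiableAt_complex_of_real hg
  rw [partialT, partialS, fderiv_comp _ (hf.differentiableAt hz) hg] at h
  apply hf.injective _ hz
  simpa [hf.cross_fderiv hz] using h

theorem smooth_partialZ : ContDiffOn ℝ ∞ (partialZ f) V :=
  hf.smooth_partialS.sub (hf.smooth_partialT.const_smul Complex.I)

theorem smooth_partialZbar : ContDiffOn ℝ ∞ (partialZbar f) V :=
  hf.smooth_partialS.add (hf.smooth_partialT.const_smul Complex.I)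

theorem smooth_cubicForm : ContDiffOn ℝ ∞ (cubicForm f) V :=
  hf.smooth_partialZbar.inner ℂ (hf.smooth_partialZ.fderiv_apply_const hf.isOpen 1)

theorem smooth_metricFactor : ContDiffOn ℝ ∞ (metricFactor f) V :=
  hf.smooth_partialS.inner ℂ hf.smooth_partialS

include hz

theorem differentiableAt_partialZ : DifferentiableAt ℝ (partialZ f) z :=
  hf.smooth_partialZ.differentiableAt_of_isOpen hf.isOpen hz

theorem differentiableAt_partialZbar : DifferentiableAt ℝ (partialZbar f) z :=
  hf.smooth_partialZbar.differentiableAt_of_isOpen hf.isOpen hz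

theorem differentiableAt_metricFactor : DifferentiableAt ℝ (metricFactor f) z :=
  hf.smooth_metricFactor.differentiableAt_of_isOpen hf.isOpen hz

theorem metricFactor_ne_zero : metricFactor f z ≠ 0 :=
  inner_self_ne_zero.mpr (hf.partialS_ne_zero hz)

theorem partialS_partialZ : partialS (partialZ f) z =
    partialS (partialS f) z - Complex.I • partialS (partialT f) z := by
  have h1 := hf.differentiableAt_partialS hz
  have h2 := hf.differentiableAt_partialT hz
  change fderiv ℝ (fun y => partialS f y - Complex.I • partialT f y) z 1 = _
  rw [fderiv_fun_sub h1 (by fun_prop), fderiv_fun_const_smul h2]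
  rfl

/-- With `P = partialZ f` and `ρ = metricFactor f` this says `∂P/∂z̄ = -ρ f`, the complex form of
the harmonic map equation. -/
theorem partialT_partialZ : partialT (partialZ f) z =
    Complex.I • partialS (partialZ f) z + (2 * Complex.I * metricFactor f z) • f z := by
  have h1 := hf.differentiableAt_partialS hz
  have h2 := hf.differentiableAt_partialT hz
  rw [hf.partialS_partialZ hz]
  change fderiv ℝ (fun y => partialS f y - Complex.I • partialT f y) z _ = _
  rw [fderiv_fun_sub h1 (by fun_prop), fderiv_fun_const_smul h2]
  change partialT (partialS f) z - Complex.I • partialT (partialT f) z = _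
  rw [hf.partialT_partialS hz, hf.partialT_partialT hz, metricFactor, smul_sub, smul_sub, smul_smul,
    smul_smul, Complex.I_mul_I]
  module

theorem partialS_partialZbar : partialS (partialZbar f) z =
    partialS (partialS f) z + Complex.I • partialS (partialT f) z := by
  have h1 := hf.differentiableAt_partialS hz
  have h2 := hf.differentiableAt_partialT hz
  change fderiv ℝ (fun y => partialS f y + Complex.I • partialT f y) z 1 = _
  rw [fderiv_fun_add h1 (by fun_prop), fderiv_fun_const_smul h2]
  rfl

theorem partialT_partialZbar : partialT (partialZbar f) z =
    -Complex.I • partialS (partialZbar f) z - (2 * Complex.I * metricFactor f z) • f z := by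
  have h1 := hf.differentiableAt_partialS hz
  have h2 := hf.differentiableAt_partialT hz
  rw [hf.partialS_partialZbar hz]
  change fderiv ℝ (fun y => partialS f y + Complex.I • partialT f y) z _ = _
  rw [fderiv_fun_add h1 (by fun_prop), fderiv_fun_const_smul h2]
  change partialT (partialS f) z + Complex.I • partialT (partialT f) z = _
  rw [hf.partialT_partialS hz, hf.partialT_partialT hz, metricFactor, smul_sub, smul_add, smul_smul,
    smul_smul, neg_mul, Complex.I_mul_I]
  module

theorem inner_partialZ : (inner ℂ (f z) (partialZ f z) : ℂ) = 0 := by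
  simp [partialZ, hf.inner_partialS hz, hf.inner_partialT hz]

theorem inner_partialZbar_partialZ : (inner ℂ (partialZbar f z) (partialZ f z) : ℂ) = 0 := by
  simp only [partialZ, partialZbar, inner_sub_right, inner_smul_right, inner_add_left,
    inner_smul_left, hf.inner_partialS_partialT hz, hf.inner_partialT_partialS hz,
    hf.inner_partialT_partialT hz]
  have hI : Complex.I * conj Complex.I = 1 := by simp
  linear_combination -(inner ℂ (partialS f z) (partialS f z) : ℂ) * hI

theorem inner_partialZ_partialZ :
    (inner ℂ (partialZ f z) (partialZ f z) : ℂ) = 2 * metricFactor f z := by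
  simp only [partialZ, inner_sub_right, inner_smul_right, inner_sub_left, metricFactor,
    inner_smul_left, hf.inner_partialS_partialT hz, hf.inner_partialT_partialS hz,
    hf.inner_partialT_partialT hz]
  have hI : Complex.I * conj Complex.I = 1 := by simp
  linear_combination (inner ℂ (partialS f z) (partialS f z) : ℂ) * hI

theorem inner_partialS_partialZ : (inner ℂ (f z) (partialS (partialZ f) z) : ℂ) =
    -metricFactor f z := by
  rw [hf.partialS_partialZ hz, inner_sub_right, inner_smul_right, hf.inner_partialS_partialS hz,
    hf.inner_partialS_partialT' hz]
  simp [metricFactor]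

theorem inner_partialZbar : (inner ℂ (partialZbar f z) (f z) : ℂ) = 0 := by
  rw [← inner_conj_symm]
  simp [partialZbar, inner_add_right, inner_smul_right, hf.inner_partialS hz, hf.inner_partialT hz]

theorem inner_partialZbar_partialS :
    (inner ℂ (partialZbar f z) (partialS f z) : ℂ) = metricFactor f z := by
  simp only [partialZbar, inner_add_left, inner_smul_left, hf.inner_partialT_partialS hz,
    metricFactor, mul_zero, add_zero]

/-- Two error terms `±2iρ²` arise in the Cauchy–Riemann equation and cancel. One is the
`f_s`-component of the `t`-derivative of `P_s`, the other the `f`-component of the `t`-derivative of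
`partialZbar f`, paired with `⟨f, P_s⟩ = -ρ`. -/
theorem differentiableAt_cubicForm : DifferentiableAt ℂ (cubicForm f) z := by
  apply differentiableAt_complex_of_real
    (hf.smooth_cubicForm.differentiableAt_of_isOpen hf.isOpen hz)
  have hPs : ContDiffOn ℝ ∞ (partialS (partialZ f)) V :=
    hf.smooth_partialZ.fderiv_apply_const hf.isOpen 1
  have hPsd := hPs.differentiableAt_of_isOpen hf.isOpen hz
  have hM := hf.differentiableAt_partialZbar hz
  have hρ := hf.differentiableAt_metricFactor hz
  have key : ∀ v, fderiv ℝ (cubicForm f) z v =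
      inner ℂ (partialZbar f z) (fderiv ℝ (partialS (partialZ f)) z v) +
      inner ℂ (fderiv ℝ (partialZbar f) z v) (partialS (partialZ f) z) :=
    fun v => fderiv_inner_apply ℂ hM hPsd v
  have e1 : fderiv ℝ (partialS (partialZ f)) z Complex.I =
      Complex.I • fderiv ℝ (partialS (partialZ f)) z 1 +
        ((2 * Complex.I * metricFactor f z) • partialS f z +
        (2 * Complex.I * fderiv ℝ (metricFactor f) z 1) • f z) := by
    have c1 : fderiv ℝ (partialS (partialZ f)) z Complex.I =
        fderiv ℝ (partialT (partialZ f)) z 1 :=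
      fderiv_fderiv_comm hf.smooth_partialZ hf.isOpen hz _ _
    rw [c1, ContDiffOn.fderiv_congr_of_isOpen hf.isOpen
      (fun y hy => hf.partialT_partialZ hy) hz]
    have hfd := hf.differentiableAt hz
    rw [fderiv_fun_add (by fun_prop) (by fun_prop), fderiv_fun_const_smul hPsd,
      fderiv_fun_smul (by fun_prop) hfd, fderiv_const_mul hρ]
    simp [partialS]
  have e2 : fderiv ℝ (partialZbar f) z Complex.I = _ := hf.partialT_partialZbar hz
  have e3 := hf.inner_partialZbar_partialS hz
  have e4 := hf.inner_partialS_partialZ hz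
  rw [key, key, e1, e2]
  simp only [inner_add_right, inner_smul_right, inner_sub_left, inner_smul_left, e3, e4,
    hf.inner_partialZbar hz]
  have hc : conj (metricFactor f z) = metricFactor f z := inner_conj_symm _ _
  simp only [map_mul, map_neg, Complex.conj_I, hc]
  simp only [partialS, map_ofNat]
  ring

/-- In the orthogonal frame `f`, `partialZ f`, `partialZbar f`, the cubic form is the component of
`P_s` along `partialZbar f`, and the component along `f` is `-ρ`. Only a multiple of `P` remains. -/
theorem partialZ_partialZ_of_cubicForm_eq_zero (hq : cubicForm f z = 0) :
    (2 * metricFactor f z) • (partialS (partialZ f) z + metricFactor f z • f z) =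
      (inner ℂ (partialZ f z) (partialS (partialZ f) z) : ℂ) • partialZ f z := by
  set ρ := metricFactor f z with hρ
  rw [← sub_eq_zero]
  set X := (2 * ρ) • (partialS (partialZ f) z + ρ • f z) -
      (inner ℂ (partialZ f z) (partialS (partialZ f) z) : ℂ) • partialZ f z with hX
  have hPf : (inner ℂ (partialZ f z) (f z) : ℂ) = 0 := by
    rw [← inner_conj_symm, hf.inner_partialZ hz, map_zero]
  have h1 : (inner ℂ (f z) X : ℂ) = 0 := by
    simp only [hX, inner_sub_right, inner_smul_right, inner_add_right, hf.inner_partialZ hz,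
      hf.inner_self hz, hf.inner_partialS_partialZ hz]
    ring
  have hP : (inner ℂ (partialZ f z) X : ℂ) = 0 := by
    simp only [hX, inner_sub_right, inner_smul_right, inner_add_right,
      hf.inner_partialZ_partialZ hz, hPf]
    ring
  have hM : (inner ℂ (partialZbar f z) X : ℂ) = 0 := by
    have : (inner ℂ (partialZbar f z) (partialS (partialZ f) z) : ℂ) = 0 := hq
    simp only [hX, inner_sub_right, inner_smul_right, inner_add_right, this,
      hf.inner_partialZbar_partialZ hz, hf.inner_partialZbar hz]
    ring
  simp only [partialZ, inner_sub_left, inner_smul_left, Complex.conj_I] at hP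
  simp only [partialZbar, inner_add_left, inner_smul_left, Complex.conj_I] at hM
  apply eq_zero_of_inner_crossC3 (hf.inner_self hz) (hf.partialS_ne_zero hz)
    (hf.inner_partialS hz) h1
  · linear_combination (hP + hM) / 2
  · rw [← hf.special z hz]
    have hI := Complex.I_mul_I
    linear_combination (hP - hM) * (-Complex.I / 2) + (inner ℂ (partialT f z) X : ℂ) * hI

omit hz in
-- When the cubic form vanishes, `∂P/∂z = λ P` and `∂ρ/∂z = λ ρ` with the same `λ`. So `⟨P, a⟩`,
-- which is antilinear in `P`, and the real function `ρ` both satisfy `∂u/∂z̄ = conj λ · u`, and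
-- their quotient is holomorphic.
theorem differentiableAt_inner_partialZ_of_cubicForm_eq_zero (hq : ∀ w ∈ V, cubicForm f w = 0)
    (hz : z ∈ V) (a : C3) :
    DifferentiableAt ℂ (fun w => (inner ℂ (partialZ f w) a : ℂ) / metricFactor f w) z := by
  have hP := hf.differentiableAt_partialZ hz
  have hρ := hf.differentiableAt_metricFactor hz
  have hρ0 := hf.metricFactor_ne_zero hz
  have hin : DifferentiableAt ℝ (fun w => (inner ℂ (partialZ f w) a : ℂ)) z :=
    hP.inner ℂ (by fun_prop)
  have hc : conj (metricFactor f z) = metricFactor f z := inner_conj_symm _ _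
  have hPf : (inner ℂ (partialZ f z) (f z) : ℂ) = 0 := by
    rw [← inner_conj_symm, hf.inner_partialZ hz, map_zero]
  have hb : DifferentiableAt ℝ (fun w => (inner ℂ (partialZ f w) a : ℂ) / metricFactor f w) z :=
    hin.mul (hρ.inv hρ0)
  apply differentiableAt_complex_of_real hb
  have d1 : ∀ v, fderiv ℝ (fun w => (inner ℂ (partialZ f w) a : ℂ)) z v =
      inner ℂ (fderiv ℝ (partialZ f) z v) a := by
    intro v
    rw [fderiv_inner_apply ℂ hP (by fun_prop)]
    simp
  have d2 : ∀ v, 2 * fderiv ℝ (metricFactor f) z v =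
      inner ℂ (partialZ f z) (fderiv ℝ (partialZ f) z v) +
      inner ℂ (fderiv ℝ (partialZ f) z v) (partialZ f z) := by
    intro v
    rw [← fderiv_inner_apply ℂ hP hP, ContDiffOn.fderiv_congr_of_isOpen hf.isOpen
      (fun y hy => hf.inner_partialZ_partialZ hy) hz, fderiv_const_mul hρ]
    simp
  have d3 : ∀ v, fderiv ℝ (fun w => (inner ℂ (partialZ f w) a : ℂ) / metricFactor f w) z v *
      (metricFactor f z) ^ 2 = fderiv ℝ (fun w => (inner ℂ (partialZ f w) a : ℂ)) z v *
        metricFactor f z - (inner ℂ (partialZ f z) a : ℂ) * fderiv ℝ (metricFactor f) z v := by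
    intro v
    have : fderiv ℝ (fun w => (inner ℂ (partialZ f w) a : ℂ)) z =
        fderiv ℝ (fun w => (inner ℂ (partialZ f w) a : ℂ) / metricFactor f w * metricFactor f w) z :=
      ContDiffOn.fderiv_congr_of_isOpen hf.isOpen
        (fun w hw => (div_mul_cancel₀ _ (hf.metricFactor_ne_zero hw)).symm) hz
    rw [this, fderiv_fun_mul hb hρ]
    simp
    field_simp
    ring
  have e1 : fderiv ℝ (partialZ f) z Complex.I = _ := hf.partialT_partialZ hz
  have e0 : fderiv ℝ (partialZ f) z 1 = partialS (partialZ f) z := rfl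
  have k := hf.partialZ_partialZ_of_cubicForm_eq_zero hz (hq z hz)
  have k2 := congrArg (fun x => (inner ℂ x a : ℂ)) k
  simp only [inner_smul_left, inner_add_left, map_mul, hc, map_ofNat] at k2
  have s1 := d2 1
  have s2 := d2 Complex.I
  rw [e0] at s1
  rw [e1] at s2
  simp only [inner_add_left, inner_add_right, inner_smul_right, inner_smul_left, map_mul,
    Complex.conj_I, hc, hPf, hf.inner_partialZ hz, map_ofNat, mul_zero, add_zero] at s2
  have t1 := d3 1
  have t2 := d3 Complex.I
  rw [d1, e0] at t1
  rw [d1, e1] at t2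
  simp only [inner_add_left, inner_smul_left, map_mul, Complex.conj_I, hc, map_ofNat] at t2
  have : (metricFactor f z) ^ 2 ≠ 0 := pow_ne_zero 2 hρ0
  apply mul_right_cancel₀ this
  rw [t2]
  have hcs : (inner ℂ (partialS (partialZ f) z) (partialZ f z) : ℂ) =
    conj (inner ℂ (partialZ f z) (partialS (partialZ f) z)) := (inner_conj_symm _ _).symm
  rw [hcs] at s1 s2
  linear_combination (-Complex.I) * k2 + (inner ℂ (partialZ f z) a / 2 : ℂ) * (Complex.I * s1 - s2) -
    Complex.I * t1

end IsSLMap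

/-! ### Jacobian determinants of maps between tori -/

theorem det_complex_eq (A : ℂ →L[ℝ] ℂ) :
    A.det = (A 1).re * (A Complex.I).im - (A 1).im * (A Complex.I).re := by
  rw [ContinuousLinearMap.det, ← LinearMap.det_toMatrix Complex.basisOneI, Matrix.det_fin_two]
  simp [LinearMap.toMatrix_apply]
  ring

/-- The Jacobian is the divergence of `(u v_y, -u v_x)`. Since `v_x` and `v_y` are periodic,
opposite sides of the square differ by an increment of `u` times a total increment of `v`. -/
theorem integral_jacobian_real {u v : ℝ × ℝ → ℝ} (hu : ContDiff ℝ ∞ u) (hv : ContDiff ℝ ∞ v)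
    {a₁ a₂ b₁ b₂ : ℝ} (hua : ∀ x y, u (x + 1, y) = u (x, y) + a₁)
    (hub : ∀ x y, u (x, y + 1) = u (x, y) + b₁) (hva : ∀ x y, v (x + 1, y) = v (x, y) + a₂)
    (hvb : ∀ x y, v (x, y + 1) = v (x, y) + b₂) :
    ∫ q in Set.Icc (0 : ℝ × ℝ) 1, (fderiv ℝ u q (1, 0) * fderiv ℝ v q (0, 1) -
      fderiv ℝ u q (0, 1) * fderiv ℝ v q (1, 0)) = a₁ * b₂ - b₁ * a₂ := by
  set vx : ℝ × ℝ → ℝ := fun q => fderiv ℝ v q (1, 0) with hvx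
  set vy : ℝ × ℝ → ℝ := fun q => fderiv ℝ v q (0, 1) with hvy
  have hvxs : ContDiff ℝ ∞ vx := hv.fderiv_apply_const _
  have hvys : ContDiff ℝ ∞ vy := hv.fderiv_apply_const _
  have hud : Differentiable ℝ u := hu.differentiable (by simp)
  have hvd : Differentiable ℝ v := hv.differentiable (by simp)
  have hvxd : Differentiable ℝ vx := hvxs.differentiable (by simp)
  have hvyd : Differentiable ℝ vy := hvys.differentiable (by simp)
  have hvxc : Continuous vx := hvxs.continuous
  have hvyc : Continuous vy := hvys.continuous
  have huc : Continuous u := hu.continuous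
  have hcomm : ∀ q, fderiv ℝ vy q (1, 0) = fderiv ℝ vx q (0, 1) := fun q =>
    fderiv_fderiv_comm hv.contDiffOn isOpen_univ (Set.mem_univ q) _ _
  have hfx : ∀ q, fderiv ℝ (fun q => u q * vy q) q (1, 0) +
      fderiv ℝ (fun q => -(u q * vx q)) q (0, 1) =
      fderiv ℝ u q (1, 0) * fderiv ℝ v q (0, 1) - fderiv ℝ u q (0, 1) * fderiv ℝ v q (1, 0) := by
    intro q
    rw [fderiv_fun_neg, fderiv_fun_mul (hud q) (hvyd q), fderiv_fun_mul (hud q) (hvxd q)]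
    simp [hcomm]
    ring
  have hpvx : ∀ x y, vx (x, y + 1) = vx (x, y) := by
    intro x y
    have : (fun q : ℝ × ℝ => v (q + (0, 1))) = fun q => v q + b₂ := by
      ext q; obtain ⟨q1, q2⟩ := q; simpa using hvb q1 q2
    have h2 := congrArg (fun w => fderiv ℝ w (x, y) (1, 0)) this
    simpa [fderiv_comp_add_right, fderiv_add_const] using h2
  have hpvy : ∀ x y, vy (x + 1, y) = vy (x, y) := by
    intro x y
    have : (fun q : ℝ × ℝ => v (q + (1, 0))) = fun q => v q + a₂ := by
      ext q; obtain ⟨q1, q2⟩ := q; simpa using hva q1 q2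
    have h2 := congrArg (fun w => fderiv ℝ w (x, y) (0, 1)) this
    simpa [fderiv_comp_add_right, fderiv_add_const] using h2
  have hdiv := MeasureTheory.integral_divergence_prod_Icc_of_hasFDerivAt_of_le
    (fun q => u q * vy q) (fun q => -(u q * vx q)) (fun q => fderiv ℝ (fun q => u q * vy q) q)
    (fun q => fderiv ℝ (fun q => -(u q * vx q)) q) (0 : ℝ × ℝ) 1 (by simp)
    (by fun_prop) (by fun_prop)
    (fun q _ => ((hud q).mul (hvyd q)).hasFDerivAt)
    (fun q _ => ((hud q).mul (hvxd q)).fun_neg.hasFDerivAt)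
    (by
      have h1 : Continuous (fun q => fderiv ℝ (fun q => u q * vy q) q) :=
        (hu.mul hvys).continuous_fderiv (by simp)
      have h2 : Continuous (fun q => fderiv ℝ (fun q => -(u q * vx q)) q) :=
        (hu.mul hvxs).neg.continuous_fderiv (by simp)
      apply ContinuousOn.integrableOn_compact isCompact_Icc
      fun_prop)
  simp only [hfx] at hdiv
  rw [hdiv]
  simp only [Prod.fst_zero, Prod.snd_zero, Prod.fst_one, Prod.snd_one]
  have e1 : (∫ x in (0:ℝ)..1, -(u (x, 1) * vx (x, 1))) - ∫ x in (0:ℝ)..1, -(u (x, 0) * vx (x, 0)) =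
      -(b₁ * a₂) := by
    rw [← intervalIntegral.integral_sub (Continuous.intervalIntegrable (by fun_prop) _ _)
      (Continuous.intervalIntegrable (by fun_prop) _ _)]
    have : ∀ x, -(u (x, 1) * vx (x, 1)) - -(u (x, 0) * vx (x, 0)) = -(b₁ * vx (x, 0)) := by
      intro x
      have h1 := hub x 0
      have h2 := hpvx x 0
      rw [zero_add] at h1 h2
      rw [h1, h2]; ring
    simp only [this]
    rw [intervalIntegral.integral_neg, intervalIntegral.integral_const_mul]
    have hd : ∀ x, HasDerivAt (fun x => v (x, 0)) (vx (x, 0)) x := fun x => by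
      have := (hvd (x, 0)).hasFDerivAt.comp_hasDerivAt x
        ((hasDerivAt_id x).prodMk (hasDerivAt_const x (0 : ℝ)))
      exact this
    rw [intervalIntegral.integral_eq_sub_of_hasDerivAt (fun x _ => hd x)
      (Continuous.intervalIntegrable (by fun_prop) _ _)]
    have := hva 0 0
    rw [zero_add] at this
    rw [this]; ring
  have e2 : (∫ y in (0:ℝ)..1, u (1, y) * vy (1, y)) - ∫ y in (0:ℝ)..1, u (0, y) * vy (0, y) =
      a₁ * b₂ := by
    rw [← intervalIntegral.integral_sub (Continuous.intervalIntegrable (by fun_prop) _ _)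
      (Continuous.intervalIntegrable (by fun_prop) _ _)]
    have : ∀ y, u (1, y) * vy (1, y) - u (0, y) * vy (0, y) = a₁ * vy (0, y) := by
      intro x
      have h1 := hua 0 x
      have h2 := hpvy 0 x
      rw [zero_add] at h1 h2
      rw [h1, h2]; ring
    simp only [this]
    rw [intervalIntegral.integral_const_mul]
    have hd : ∀ x, HasDerivAt (fun x => v (0, x)) (vy (0, x)) x := fun x => by
      have := (hvd (0, x)).hasFDerivAt.comp_hasDerivAt x
        ((hasDerivAt_const x (0 : ℝ)).prodMk (hasDerivAt_id x))
      exact this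
    rw [intervalIntegral.integral_eq_sub_of_hasDerivAt (fun x _ => hd x)
      (Continuous.intervalIntegrable (by fun_prop) _ _)]
    have := hvb 0 0
    rw [zero_add] at this
    rw [this]; ring
  linarith

/-- The closed unit square in the complex plane. -/
def unitSquare : Set ℂ := Complex.measurableEquivRealProd ⁻¹' Set.Icc 0 1

theorem mem_unitSquare {z : ℂ} :
    z ∈ unitSquare ↔ (0 ≤ z.re ∧ z.re ≤ 1) ∧ (0 ≤ z.im ∧ z.im ≤ 1) := by
  simp [unitSquare, Prod.le_def, Complex.measurableEquivRealProd_apply]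
  tauto

theorem isCompact_unitSquare : IsCompact unitSquare := by
  have : unitSquare = Complex.equivRealProdCLM.symm '' Set.Icc 0 1 := by
    rw [ContinuousLinearEquiv.image_symm_eq_preimage]; rfl
  rw [this]
  exact isCompact_Icc.image (Complex.equivRealProdCLM.symm).continuous

/-- The signed area depends only on the periods. It is used twice: with zero periods to exclude
zeros of sections, and for the developing map to see that its periods are independent. -/
theorem integral_det_fderiv_unitSquare {F : ℂ → ℂ} (hF : ContDiff ℝ ∞ F) {a b : ℂ}
    (ha : ∀ z, F (z + 1) = F z + a) (hb : ∀ z, F (z + Complex.I) = F z + b) :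
    ∫ z in unitSquare, (fderiv ℝ F z).det = a.re * b.im - b.re * a.im := by
  let e := Complex.equivRealProdCLM.symm
  have hFe : ContDiff ℝ ∞ (fun q : ℝ × ℝ => F (e q)) := hF.comp e.contDiff
  have hu : ContDiff ℝ ∞ (fun q : ℝ × ℝ => (F (e q)).re) := Complex.reCLM.contDiff.comp hFe
  have hv : ContDiff ℝ ∞ (fun q : ℝ × ℝ => (F (e q)).im) := Complex.imCLM.contDiff.comp hFe
  have e1 : ∀ x y : ℝ, e (x + 1, y) = e (x, y) + 1 := fun x y => by
    apply Complex.ext <;> simp [e]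
  have e2 : ∀ x y : ℝ, e (x, y + 1) = e (x, y) + Complex.I := fun x y => by
    apply Complex.ext <;> simp [e]
  have key := integral_jacobian_real (a₁ := a.re) (a₂ := a.im) (b₁ := b.re) (b₂ := b.im) hu hv
    (fun x y => by simp [e1, ha]) (fun x y => by simp [e2, hb]) (fun x y => by simp [e1, ha])
    (fun x y => by simp [e2, hb])
  rw [← key]
  have hmp := Complex.volume_preserving_equiv_real_prod
  rw [unitSquare, ← hmp.setIntegral_preimage_emb Complex.measurableEquivRealProd.measurableEmbedding]
  congr 1
  ext z
  have hFd := hF.differentiable (by simp)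
  have hez : e (Complex.measurableEquivRealProd z) = z := by
    apply Complex.ext <;> simp [e, Complex.measurableEquivRealProd_apply]
  have hd : HasFDerivAt (fun q : ℝ × ℝ => F (e q)) ((fderiv ℝ F z).comp (e : ℝ × ℝ →L[ℝ] ℂ))
      (Complex.measurableEquivRealProd z) := by
    have h1 := (hFd (e (Complex.measurableEquivRealProd z))).hasFDerivAt.comp _ e.hasFDerivAt
    rw [hez] at h1
    exact h1
  have hdu : fderiv ℝ (fun q : ℝ × ℝ => (F (e q)).re) (Complex.measurableEquivRealProd z) = _ :=
    (Complex.reCLM.hasFDerivAt.comp _ hd).fderiv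
  have hdv : fderiv ℝ (fun q : ℝ × ℝ => (F (e q)).im) (Complex.measurableEquivRealProd z) = _ :=
    (Complex.imCLM.hasFDerivAt.comp _ hd).fderiv
  rw [hdu, hdv, det_complex_eq]
  have f1 : e (1, 0) = 1 := by apply Complex.ext <;> simp [e]
  have f2 : e (0, 1) = Complex.I := by apply Complex.ext <;> simp [e]
  simp [f1, f2]
  ring

/-! ### Zeros of sections over a torus -/

/-- The map `w ↦ w / √(|w|² + ε)` of the plane onto the unit disc. -/
noncomputable def discMap (ε : ℝ) (w : ℂ) : ℂ := (Real.sqrt (Complex.normSq w + ε))⁻¹ • w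

theorem contDiff_normSq : ContDiff ℝ ∞ Complex.normSq := by
  change ContDiff ℝ ∞ (fun z => Complex.normSq z)
  simp only [Complex.normSq_apply]
  exact (Complex.reCLM.contDiff.mul Complex.reCLM.contDiff).add
    (Complex.imCLM.contDiff.mul Complex.imCLM.contDiff)

theorem contDiff_discMap {ε : ℝ} (hε : 0 < ε) : ContDiff ℝ ∞ (discMap ε) := by
  have h0 : ∀ w, Complex.normSq w + ε ≠ 0 := fun w => by
    have := Complex.normSq_nonneg w; positivity
  have h1 : ContDiff ℝ ∞ (fun w => (Real.sqrt (Complex.normSq w + ε))⁻¹) :=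
    ((contDiff_normSq.add contDiff_const).sqrt h0).inv
      (fun w => by have := Complex.normSq_nonneg w; positivity)
  exact h1.smul contDiff_id

/-- As `ε → 0` this density concentrates at the origin, so composition with `discMap ε` detects
zeros by area. -/
theorem det_fderiv_discMap {ε : ℝ} (hε : 0 < ε) (w : ℂ) :
    (fderiv ℝ (discMap ε) w).det = ε / (Complex.normSq w + ε) ^ 2 := by
  have hn := Complex.normSq_nonneg w
  have hpos : 0 < Complex.normSq w + ε := by positivity
  set s : ℂ → ℝ := fun w => (Real.sqrt (Complex.normSq w + ε))⁻¹ with hs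
  have hds : ∀ v : ℂ, fderiv ℝ s w v = -(s w) ^ 3 * (w.re * v.re + w.im * v.im) := by
    intro v
    have h1 : HasFDerivAt (fun z : ℂ => Complex.normSq z + ε)
        ((2 * w.re) • Complex.reCLM + (2 * w.im) • Complex.imCLM) w := by
      simp only [Complex.normSq_apply]
      have hr := Complex.reCLM.hasFDerivAt (x := w)
      have hi := Complex.imCLM.hasFDerivAt (x := w)
      have := ((hr.fun_mul hr).fun_add (hi.fun_mul hi)).add_const ε
      refine this.congr_fderiv (ContinuousLinearMap.ext fun v => ?_)
      simp
      ring
    have h2 := ((Real.hasDerivAt_sqrt hpos.ne').inv (by positivity)).comp_hasFDerivAt w h1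
    have h3 : fderiv ℝ s w = _ := h2.fderiv
    rw [h3]
    have hsq := Real.sq_sqrt hpos.le
    have : 0 < Real.sqrt (Complex.normSq w + ε) := by positivity
    simp [hs]
    field_simp
    ring
  have hsd : DifferentiableAt ℝ s w := by
    have h0 : ∀ w, Complex.normSq w + ε ≠ 0 := fun w => by
      have := Complex.normSq_nonneg w; positivity
    have h1 : ContDiff ℝ ∞ s := ((contDiff_normSq.add contDiff_const).sqrt h0).inv
      (fun w => by have := Complex.normSq_nonneg w; positivity)
    exact h1.differentiable (by simp) w
  have hd : ∀ v, fderiv ℝ (discMap ε) w v = s w • v + (fderiv ℝ s w v) • w := by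
    intro v
    change fderiv ℝ (fun w => s w • w) w v = _
    rw [fderiv_fun_smul hsd (by fun_prop)]
    simp
  rw [det_complex_eq, hd, hd, hds, hds]
  have h4 : (s w) ^ 2 * (Complex.normSq w + ε) = 1 := by
    simp only [hs, inv_pow, Real.sq_sqrt hpos.le]
    field_simp
  simp only [Complex.add_re, Complex.add_im, Complex.real_smul, Complex.mul_re, Complex.mul_im,
    Complex.ofReal_re, Complex.ofReal_im, Complex.one_re, Complex.one_im, Complex.I_re,
    Complex.I_im]
  rw [eq_div_iff (by positivity)]
  have hn2 := Complex.normSq_apply w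
  generalize hN : Complex.normSq w = N at *
  generalize s w = t at *
  have h5 : t ^ 4 * (N + ε) ^ 2 = 1 := by
    calc t ^ 4 * (N + ε) ^ 2 = (t ^ 2 * (N + ε)) ^ 2 := by ring
      _ = 1 := by rw [h4]; norm_num
  have h6 : t ^ 2 - t ^ 4 * N = t ^ 4 * ε := by linear_combination -(t ^ 2) * h4
  linear_combination (N + ε) ^ 2 * h6 + ε * h5 + t ^ 4 * (N + ε) ^ 2 * hn2

theorem ball_subset_discMap_image {ε δ : ℝ} (hε : 0 < ε) (hδ : 0 < δ) (h : ε ≤ δ ^ 2) :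
    Metric.ball (0 : ℂ) (1 / 2) ⊆ discMap ε '' Metric.ball 0 δ := by
  intro w hw
  rw [mem_ball_zero_iff] at hw
  have hw2 : Complex.normSq w < 1 / 4 := by
    rw [Complex.normSq_eq_norm_sq]; nlinarith [norm_nonneg w]
  have hn := Complex.normSq_nonneg w
  have h1 : 0 < 1 - Complex.normSq w := by linarith
  -- The preimage of `w` is sought on its own ray: `discMap ε (c w) = w` as soon as `c²|w|² + ε =
  -- c²`.
  set c := Real.sqrt (ε / (1 - Complex.normSq w)) with hc
  have hcpos : 0 < c := Real.sqrt_pos.mpr (by positivity)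
  have hc2 : c ^ 2 = ε / (1 - Complex.normSq w) := Real.sq_sqrt (by positivity)
  refine ⟨c • w, ?_, ?_⟩
  · rw [mem_ball_zero_iff, norm_smul, Real.norm_of_nonneg hcpos.le]
    have h2 : (c * ‖w‖) ^ 2 < δ ^ 2 := by
      rw [mul_pow, hc2, ← Complex.normSq_eq_norm_sq, div_mul_eq_mul_div, div_lt_iff₀ h1]
      nlinarith
    exact lt_of_pow_lt_pow_left₀ 2 hδ.le h2
  · have h3 : Complex.normSq (c • w) + ε = c ^ 2 := by
      have : Complex.normSq (c • w) = c ^ 2 * Complex.normSq w := by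
        rw [Complex.real_smul, Complex.normSq_mul, Complex.normSq_ofReal]; ring
      rw [this, hc2]
      field_simp
      ring
    rw [discMap, h3, Real.sqrt_sq hcpos.le, smul_smul, inv_mul_cancel₀ hcpos.ne', one_smul]

theorem det_fderiv_comp {g f : ℂ → ℂ} {z : ℂ} (hg : DifferentiableAt ℝ g (f z))
    (hf : DifferentiableAt ℝ f z) :
    (fderiv ℝ (g ∘ f) z).det = (fderiv ℝ g (f z)).det * (fderiv ℝ f z).det := by
  rw [fderiv_comp z hg hf]
  simp [ContinuousLinearMap.det, LinearMap.det_comp]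

/-- Dominated convergence: `ε n / (n + ε)²` is at most `1` for `n ≥ 0` and tends to `0` whether `n`
is zero or positive. -/
theorem tendsto_integral_regularized {f : ℂ → ℂ} (hf : Continuous f) :
    Filter.Tendsto (fun n : ℕ => ∫ z in unitSquare, ((1 : ℝ) / (n + 1)) * Complex.normSq (f z) /
      (Complex.normSq (f z) + 1 / (n + 1)) ^ 2) Filter.atTop (nhds 0) := by
  have : (0 : ℝ) = ∫ z in unitSquare, (0 : ℝ) := by simp
  rw [this]
  have hnc : Continuous fun z => Complex.normSq (f z) := Complex.continuous_normSq.comp hf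
  have hpos : ∀ (n : ℕ) z, 0 < Complex.normSq (f z) + 1 / ((n : ℝ) + 1) := fun n z => by
    have := Complex.normSq_nonneg (f z); positivity
  have : IsFiniteMeasure (volume.restrict unitSquare) :=
    ⟨by rw [Measure.restrict_apply_univ]; exact isCompact_unitSquare.measure_lt_top⟩
  apply tendsto_integral_of_dominated_convergence (fun _ => (1 : ℝ))
  · intro n
    apply Continuous.aestronglyMeasurable
    refine Continuous.div (by fun_prop) (by fun_prop) fun z => (pow_pos (hpos n z) 2).ne'
  · exact integrable_const _
  · intro n
    refine Filter.Eventually.of_forall fun z => ?_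
    have h1 := Complex.normSq_nonneg (f z)
    have h2 : (0 : ℝ) < 1 / ((n : ℝ) + 1) := by positivity
    rw [Real.norm_of_nonneg (by positivity), div_le_one (by positivity)]
    nlinarith
  · refine Filter.Eventually.of_forall fun z => ?_
    have h1 := Complex.normSq_nonneg (f z)
    have ht : Filter.Tendsto (fun n : ℕ => (1 : ℝ) / (n + 1)) Filter.atTop (nhds 0) :=
      tendsto_one_div_add_atTop_nhds_zero_nat
    rcases h1.eq_or_lt with h0 | h0
    · simp [← h0]
    · have h3 : Filter.Tendsto (fun n : ℕ => (1 : ℝ) / (n + 1) * Complex.normSq (f z) /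
          (Complex.normSq (f z) + 1 / (n + 1)) ^ 2) Filter.atTop
          (nhds (0 * Complex.normSq (f z) / (Complex.normSq (f z) + 0) ^ 2)) :=
        (ht.mul_const _).div ((tendsto_const_nhds.add ht).pow 2) (by positivity)
      simpa using h3

/-- The nonnegative density `ε (det df + C|f|²) / (|f|² + ε)²` has the integral of its second part
only, because the first part is the Jacobian of a periodic map; this integral tends to `0`. Up to a
constant the density dominates the Jacobian of `discMap ε' ∘ H` on `U`, whose image contains the
disc of radius `1/2` for all small `ε`. -/
theorem false_of_zero_aux {f : ℂ → ℂ} (hf : ContDiff ℝ ∞ f) (h1 : ∀ z, f (z + 1) = f z)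
    (hI : ∀ z, f (z + Complex.I) = f z) {C M : ℝ} (hC : 0 ≤ C) (hM : 0 < M)
    (hlow : ∀ z, 0 ≤ (fderiv ℝ f z).det + C * Complex.normSq (f z))
    {H : ℂ → ℂ} {U : Set ℂ} (hU : IsOpen U) (hUQ : U ⊆ unitSquare)
    (hHd : DifferentiableOn ℝ H U)
    (hH : ∀ z ∈ U, |(fderiv ℝ H z).det| ≤ C * ((fderiv ℝ f z).det + C * Complex.normSq (f z)))
    (hfH : ∀ z ∈ U, ‖f z‖ ≤ M * ‖H z‖) {δ : ℝ} (hδ : 0 < δ)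
    (hopen : Metric.ball 0 δ ⊆ H '' U) : False := by
  have hfd := hf.differentiable (by simp)
  have hcf : Continuous f := hf.continuous
  have hcdet : Continuous fun z => (fderiv ℝ f z).det :=
    ContinuousLinearMap.continuous_det.comp (hf.continuous_fderiv (by simp))
  have hnc : Continuous fun z => Complex.normSq (f z) := Complex.continuous_normSq.comp hcf
  -- the total Jacobian of `discMap ε ∘ f` vanishes
  have hzero : ∀ ε, 0 < ε → ∫ z in unitSquare,
      ε * (fderiv ℝ f z).det / (Complex.normSq (f z) + ε) ^ 2 = 0 := by
    intro ε hε
    have := integral_det_fderiv_unitSquare (F := discMap ε ∘ f) (a := 0) (b := 0)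
      ((contDiff_discMap hε).comp hf) (by simp [h1]) (by simp [hI])
    simp only [Complex.zero_re, Complex.zero_im, mul_zero, sub_zero] at this
    rw [← this]
    congr 1
    ext z
    rw [det_fderiv_comp ((contDiff_discMap hε).differentiable (by simp) _) (hfd z),
      det_fderiv_discMap hε]
    ring
  have hint : ∀ ε, 0 < ε → ∀ g : ℂ → ℝ, Continuous g →
      IntegrableOn (fun z => ε * g z / (Complex.normSq (f z) + ε) ^ 2) unitSquare := by
    intro ε hε g hg
    apply ContinuousOn.integrableOn_compact isCompact_unitSquare
    apply Continuous.continuousOn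
    refine Continuous.div (by fun_prop) (by fun_prop) fun z => ?_
    have := Complex.normSq_nonneg (f z)
    positivity
  have hbound : ∀ ε, 0 < ε → ε ≤ M ^ 2 * δ ^ 2 →
      volume (Metric.ball (0 : ℂ) (1 / 2)) ≤ ENNReal.ofReal (M ^ 2 * C * (C *
        ∫ z in unitSquare, ε * Complex.normSq (f z) / (Complex.normSq (f z) + ε) ^ 2)) := by
    intro ε hε hεδ
    -- The factor `M²` absorbs `‖f‖ ≤ M‖H‖`: it gives `M²|H|² + ε ≥ |f|² + ε` in the denominator.
    set ε' := ε / M ^ 2 with hε'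
    have hε'pos : 0 < ε' := by positivity
    have hsub : Metric.ball (0 : ℂ) (1 / 2) ⊆ (discMap ε' ∘ H) '' U := by
      refine (ball_subset_discMap_image hε'pos hδ ?_).trans ?_
      · rw [hε', div_le_iff₀ (by positivity)]; linarith
      · rw [Set.image_comp]; exact Set.image_mono hopen
    have hdc : ∀ z ∈ U, DifferentiableAt ℝ H z := fun z hz => hHd.differentiableAt (hU.mem_nhds hz)
    have hdd := (contDiff_discMap hε'pos).differentiable (by simp)
    calc volume (Metric.ball (0 : ℂ) (1 / 2)) ≤ volume ((discMap ε' ∘ H) '' U) := measure_mono hsub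
      _ ≤ ∫⁻ z in U, ENNReal.ofReal |(fderiv ℝ (discMap ε' ∘ H) z).det| :=
          addHaar_image_le_lintegral_abs_det_fderiv volume hU.measurableSet fun z hz =>
            ((hdd _).comp z (hdc z hz)).hasFDerivAt.hasFDerivWithinAt
      _ ≤ ∫⁻ z in U, ENNReal.ofReal (ε * (M ^ 2 * C * ((fderiv ℝ f z).det +
            C * Complex.normSq (f z))) / (Complex.normSq (f z) + ε) ^ 2) := by
          refine setLIntegral_mono' hU.measurableSet fun z hz => ENNReal.ofReal_le_ofReal ?_
          rw [det_fderiv_comp (hdd _) (hdc z hz), det_fderiv_discMap hε'pos, abs_mul]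
          have hn := Complex.normSq_nonneg (H z)
          have hnf := Complex.normSq_nonneg (f z)
          have hle : Complex.normSq (f z) ≤ M ^ 2 * Complex.normSq (H z) := by
            rw [Complex.normSq_eq_norm_sq, Complex.normSq_eq_norm_sq, ← mul_pow]
            exact pow_le_pow_left₀ (norm_nonneg _) (hfH z hz) 2
          rw [abs_of_nonneg (by positivity)]
          have e1 : ε' / (Complex.normSq (H z) + ε') ^ 2 =
              ε * M ^ 2 / (M ^ 2 * Complex.normSq (H z) + ε) ^ 2 := by
            rw [hε']; field_simp
          have e2 : ε * M ^ 2 / (M ^ 2 * Complex.normSq (H z) + ε) ^ 2 ≤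
              ε * M ^ 2 / (Complex.normSq (f z) + ε) ^ 2 := by
            gcongr
          rw [e1]
          calc _ ≤ ε * M ^ 2 / (Complex.normSq (f z) + ε) ^ 2 *
                (C * ((fderiv ℝ f z).det + C * Complex.normSq (f z))) := by
                gcongr
                exact hH z hz
            _ = _ := by ring
      _ ≤ ∫⁻ z in unitSquare, ENNReal.ofReal (ε * (M ^ 2 * C * ((fderiv ℝ f z).det +
            C * Complex.normSq (f z))) / (Complex.normSq (f z) + ε) ^ 2) :=
          lintegral_mono_set hUQ
      _ = ENNReal.ofReal (∫ z in unitSquare, ε * (M ^ 2 * C * ((fderiv ℝ f z).det +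
            C * Complex.normSq (f z))) / (Complex.normSq (f z) + ε) ^ 2) := by
          rw [ofReal_integral_eq_lintegral_ofReal (hint ε hε _ (by fun_prop))]
          refine Filter.Eventually.of_forall fun z => ?_
          have := hlow z
          simp only [Pi.zero_apply]
          positivity
      _ = _ := by
          congr 1
          have : ∀ z, ε * (M ^ 2 * C * ((fderiv ℝ f z).det + C * Complex.normSq (f z))) /
              (Complex.normSq (f z) + ε) ^ 2 =
              M ^ 2 * C * (ε * (fderiv ℝ f z).det / (Complex.normSq (f z) + ε) ^ 2 +
                C * (ε * Complex.normSq (f z) / (Complex.normSq (f z) + ε) ^ 2)) := by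
            intro z; ring
          simp only [this]
          rw [integral_const_mul, integral_add (hint ε hε _ hcdet) ((hint ε hε _ hnc).const_mul C),
            hzero ε hε, integral_const_mul, zero_add]
  have hlim : Filter.Tendsto (fun n : ℕ => ENNReal.ofReal (M ^ 2 * C * (C *
        ∫ z in unitSquare, ((1 : ℝ) / (n + 1)) * Complex.normSq (f z) /
      (Complex.normSq (f z) + 1 / (n + 1)) ^ 2))) Filter.atTop (nhds 0) := by
    have := ((tendsto_integral_regularized hcf).const_mul C).const_mul (M ^ 2 * C)
    have h2 := (ENNReal.continuous_ofReal.tendsto _).comp this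
    rw [mul_zero, mul_zero, ENNReal.ofReal_zero] at h2
    exact h2
  have hev : ∀ᶠ n : ℕ in Filter.atTop, (1 : ℝ) / (n + 1) ≤ M ^ 2 * δ ^ 2 :=
    (tendsto_one_div_add_atTop_nhds_zero_nat (𝕜 := ℝ)).eventually_le_const (by positivity)
  have : volume (Metric.ball (0 : ℂ) (1 / 2)) ≤ 0 := by
    refine ge_of_tendsto hlim ?_
    filter_upwards [hev] with n hn
    exact hbound _ (by positivity) hn
  exact (Metric.measure_ball_pos volume (0 : ℂ) (by norm_num : (0 : ℝ) < 1 / 2)).not_ge this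

/-- A smooth function on the torus cannot have a zero near which it is, up to a bounded factor,
an open map whose Jacobian is controlled. -/
theorem false_of_zero {f : ℂ → ℂ} (hf : ContDiff ℝ ∞ f) (h1 : ∀ z, f (z + 1) = f z)
    (hI : ∀ z, f (z + Complex.I) = f z) {C M : ℝ} (hC : 0 ≤ C) (hM : 0 < M)
    (hlow : ∀ z, 0 ≤ (fderiv ℝ f z).det + C * Complex.normSq (f z))
    {H : ℂ → ℂ} {x : ℂ} {U : Set ℂ} (hU : IsOpen U) (hx : x ∈ U)
    (hHd : DifferentiableOn ℝ H U)
    (hH : ∀ z ∈ U, |(fderiv ℝ H z).det| ≤ C * ((fderiv ℝ f z).det + C * Complex.normSq (f z)))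
    (hfH : ∀ z ∈ U, ‖f z‖ ≤ M * ‖H z‖)
    (hopen : nhds 0 ≤ Filter.map H (nhds x)) : False := by
  -- Translation by `c` moves `x` to the centre of the unit square, so that a neighbourhood of it
  -- fits into one period cell.
  set c : ℂ := x - ⟨1 / 2, 1 / 2⟩ with hc
  have hU' : IsOpen ((fun z => z + c) ⁻¹' U ∩ interior unitSquare) :=
    (hU.preimage (by fun_prop)).inter isOpen_interior
  have hmem : (⟨1 / 2, 1 / 2⟩ : ℂ) ∈ (fun z => z + c) ⁻¹' U ∩ interior unitSquare := by
    refine ⟨by simpa [hc] using hx, ?_⟩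
    rw [mem_interior_iff_mem_nhds, unitSquare]
    have : Continuous fun z => Complex.measurableEquivRealProd z := Complex.equivRealProdCLM.continuous
    apply this.continuousAt.preimage_mem_nhds
    have hz : (Complex.measurableEquivRealProd ⟨1 / 2, 1 / 2⟩ : ℝ × ℝ) = (1 / 2, 1 / 2) := by
      simp [Complex.measurableEquivRealProd_apply]
    rw [hz, show (0 : ℝ × ℝ) = (0, 0) from rfl, show (1 : ℝ × ℝ) = (1, 1) from rfl,
      Set.Icc_prod_eq]
    exact prod_mem_nhds (Icc_mem_nhds (by norm_num) (by norm_num))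
      (Icc_mem_nhds (by norm_num) (by norm_num))
  have himg : H ∘ (fun z => z + c) '' ((fun z => z + c) ⁻¹' U ∩ interior unitSquare) ∈ nhds 0 := by
    apply hopen
    rw [Filter.mem_map, Set.image_comp]
    apply Filter.mem_of_superset _ (Set.subset_preimage_image _ _)
    have : (fun z => z + c) '' ((fun z => z + c) ⁻¹' U ∩ interior unitSquare) =
        (fun z => z - c) ⁻¹' ((fun z => z + c) ⁻¹' U ∩ interior unitSquare) := by
      ext z
      constructor
      · rintro ⟨w, hw, rfl⟩; simpa using hw
      · intro hz; exact ⟨z - c, hz, by simp⟩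
    rw [this]
    refine (hU'.preimage (by fun_prop)).mem_nhds ?_
    have e : x - c = ⟨1 / 2, 1 / 2⟩ := by simp [hc]
    rw [Set.mem_preimage, e]
    exact hmem
  obtain ⟨δ, hδ, hball⟩ := Metric.mem_nhds_iff.mp himg
  refine false_of_zero_aux (f := fun z => f (z + c)) (H := H ∘ (fun z => z + c))
    (hf.comp (contDiff_id.add contDiff_const)) ?_ ?_ hC hM ?_ hU'
    (Set.inter_subset_right.trans interior_subset) ?_ ?_ ?_ hδ hball
  · intro z; rw [add_right_comm, h1]
  · intro z; rw [add_right_comm, hI]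
  · intro z; rw [fderiv_comp_add_right]; exact hlow _
  · exact (hHd.comp (by fun_prop) fun z hz => hz.1)
  · intro z hz
    rw [fderiv_comp_add_right, Function.comp_def, fderiv_comp_add_right]; exact hH _ hz.1
  · intro z hz; exact hfH _ hz.1

theorem exists_mem_unitSquare (z : ℂ) :
    ∃ w ∈ unitSquare, ∃ m n : ℤ, z = w + m * 1 + n * Complex.I := by
  refine ⟨⟨Int.fract z.re, Int.fract z.im⟩, ?_, ⌊z.re⌋, ⌊z.im⌋, ?_⟩
  · rw [mem_unitSquare]
    exact ⟨⟨Int.fract_nonneg _, (Int.fract_lt_one _).le⟩, Int.fract_nonneg _,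
      (Int.fract_lt_one _).le⟩
  · apply Complex.ext <;> simp [Int.fract_add_floor]

theorem Function.Periodic.exists_mem_unitSquare_eq {α : Type*} {f : ℂ → α}
    (h1 : Function.Periodic f 1) (hI : Function.Periodic f Complex.I) (z : ℂ) :
    ∃ w ∈ unitSquare, f z = f w := by
  obtain ⟨w, hw, m, n, rfl⟩ := exists_mem_unitSquare z
  exact ⟨w, hw, by rw [(hI.int_mul n) _, (h1.int_mul m) _]⟩

theorem Function.Periodic.fderiv_of_complex {F : Type*} [NormedAddCommGroup F] [NormedSpace ℝ F]
    {f : ℂ → F} {c : ℂ} (h : Function.Periodic f c) : Function.Periodic (fderiv ℝ f) c := by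
  intro z
  rw [← fderiv_comp_add_right]
  congr 1
  ext w
  exact h w

/-- The determinant is quadratic. Its mixed term is at most `2‖p‖‖q‖B²`, and the AM–GM inequality
splits this between half of `‖p‖² det T` and a multiple of `‖q‖²`. Applied to `d(h(ζ) k)`, with `p =
k h'` and `q = h`. -/
theorem normSq_mul_det_le {T D : ℂ →L[ℝ] ℂ} {d B : ℝ} (hd : 0 < d) (hB : 0 ≤ B) (hT : d ≤ T.det)
    (hTB : ‖T‖ ≤ B) (hDB : ‖D‖ ≤ B) (p q : ℂ) :
    ‖p‖ ^ 2 * T.det ≤ 2 * (p • T + q • D).det + (2 * B ^ 2 + 4 * B ^ 4 / d) * ‖q‖ ^ 2 := by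
  have hX : ∀ X : ℂ →L[ℝ] ℂ, X.det = (conj (X 1) * X Complex.I).im := by
    intro X; rw [det_complex_eq]; simp; ring
  have e : (p • T + q • D).det = ‖p‖ ^ 2 * T.det + ‖q‖ ^ 2 * D.det +
      (conj (p * T 1) * (q * D Complex.I) + conj (q * D 1) * (p * T Complex.I)).im := by
    rw [hX, hX, hX, ← Complex.normSq_eq_norm_sq, ← Complex.normSq_eq_norm_sq]
    simp [Complex.normSq_apply]
    ring
  have n1 : ‖T 1‖ ≤ B := (T.le_opNorm 1).trans (by simpa using hTB)
  have n2 : ‖T Complex.I‖ ≤ B := (T.le_opNorm _).trans (by simpa using hTB)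
  have n3 : ‖D 1‖ ≤ B := (D.le_opNorm 1).trans (by simpa using hDB)
  have n4 : ‖D Complex.I‖ ≤ B := (D.le_opNorm _).trans (by simpa using hDB)
  have b1 : |(conj (p * T 1) * (q * D Complex.I) + conj (q * D 1) * (p * T Complex.I)).im| ≤
      2 * (‖p‖ * ‖q‖ * B ^ 2) := by
    refine (Complex.abs_im_le_norm _).trans ((norm_add_le _ _).trans ?_)
    simp only [norm_mul, RCLike.norm_conj]
    have a1 : ‖p‖ * ‖T 1‖ * (‖q‖ * ‖D Complex.I‖) ≤ ‖p‖ * B * (‖q‖ * B) := by gcongr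
    have a2 : ‖q‖ * ‖D 1‖ * (‖p‖ * ‖T Complex.I‖) ≤ ‖q‖ * B * (‖p‖ * B) := by gcongr
    nlinarith
  have b2 : |D.det| ≤ B ^ 2 := by
    rw [hX]
    refine (Complex.abs_im_le_norm _).trans ?_
    rw [norm_mul, RCLike.norm_conj, sq]
    gcongr
  rw [e]
  have b3 := (abs_le.mp b1).1
  have b4 := (abs_le.mp b2).1
  have b5 : 4 * (‖p‖ * ‖q‖ * B ^ 2) ≤ ‖p‖ ^ 2 * d + 4 * B ^ 4 / d * ‖q‖ ^ 2 := by
    have : 0 ≤ (‖p‖ * d - 2 * B ^ 2 * ‖q‖) ^ 2 / d := by positivity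
    have e2 : (‖p‖ * d - 2 * B ^ 2 * ‖q‖) ^ 2 / d =
      ‖p‖ ^ 2 * d + 4 * B ^ 4 / d * ‖q‖ ^ 2 - 4 * (‖p‖ * ‖q‖ * B ^ 2) := by
      field_simp; ring
    linarith
  have b6 : ‖p‖ ^ 2 * d ≤ ‖p‖ ^ 2 * T.det := by gcongr
  have b7 : -(‖q‖ ^ 2 * B ^ 2) ≤ ‖q‖ ^ 2 * D.det := by nlinarith [sq_nonneg ‖q‖]
  nlinarith

theorem bijective_of_det_ne_zero {A : ℂ →L[ℝ] ℂ} (h : A.det ≠ 0) : Function.Bijective A :=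
  (A.toContinuousLinearEquivOfDetNeZero h).bijective

/-- Near `x`, the function `f` is the product of a nonvanishing smooth function `k` and the
pull-back of a holomorphic function `h` by an orientation-preserving local diffeomorphism `ζ`. -/
structure IsLocalSection (f : ℂ → ℂ) (U V : Set ℂ) (ζ k h : ℂ → ℂ) : Prop where
  isOpen : IsOpen U
  isOpen_target : IsOpen V
  mapsTo : Set.MapsTo ζ U V
  smooth : ContDiffOn ℝ ∞ ζ U
  smooth_factor : ContDiffOn ℝ ∞ k U
  holomorphic : DifferentiableOn ℂ h V
  det_pos : ∀ y ∈ U, 0 < (fderiv ℝ ζ y).det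
  factor_ne_zero : ∀ y ∈ U, k y ≠ 0
  eq : ∀ y ∈ U, f y = h (ζ y) * k y

namespace IsLocalSection

variable {f : ℂ → ℂ} {U V : Set ℂ} {ζ k h : ℂ → ℂ} (hs : IsLocalSection f U V ζ k h) {x : ℂ}
  (hx : x ∈ U)
include hs hx

theorem fderiv_comp_eq : fderiv ℝ (h ∘ ζ) x = deriv h (ζ x) • fderiv ℝ ζ x := by
  have hh : DifferentiableAt ℂ h (ζ x) :=
    hs.holomorphic.differentiableAt (hs.isOpen_target.mem_nhds (hs.mapsTo hx))
  have hz := hs.smooth.differentiableAt_of_isOpen hs.isOpen hx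
  have h1 := (hh.hasDerivAt.hasFDerivAt.restrictScalars ℝ).comp x hz.hasFDerivAt
  rw [h1.fderiv]
  ext v
  simp [mul_comm]

theorem differentiableAt_comp : DifferentiableAt ℝ (h ∘ ζ) x := by
  have hh : DifferentiableAt ℂ h (ζ x) :=
    hs.holomorphic.differentiableAt (hs.isOpen_target.mem_nhds (hs.mapsTo hx))
  have hz := hs.smooth.differentiableAt_of_isOpen hs.isOpen hx
  exact (hh.restrictScalars ℝ).comp x hz

theorem fderiv_eq : fderiv ℝ f x =
    (k x * deriv h (ζ x)) • fderiv ℝ ζ x + h (ζ x) • fderiv ℝ k x := by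
  have h1 := hs.differentiableAt_comp hx
  have hk := hs.smooth_factor.differentiableAt_of_isOpen hs.isOpen hx
  have : fderiv ℝ f x = fderiv ℝ (fun y => (h ∘ ζ) y * k y) x :=
    ContDiffOn.fderiv_congr_of_isOpen hs.isOpen hs.eq hx
  rw [this, fderiv_fun_mul h1 hk, hs.fderiv_comp_eq hx]
  simp only [Function.comp_apply, smul_smul]
  abel

theorem det_fderiv_comp_eq :
    (fderiv ℝ (h ∘ ζ) x).det = ‖deriv h (ζ x)‖ ^ 2 * (fderiv ℝ ζ x).det := by
  rw [hs.fderiv_comp_eq hx, det_complex_eq, det_complex_eq, ← Complex.normSq_eq_norm_sq]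
  simp [Complex.normSq_apply]
  ring

/-- The differential of `h(ζ) k` is a complex multiple of `dζ`, with nonnegative determinant, plus
the error `h dk`, which is controlled by `|h|` and so by `|f|`. The bounds hold for every larger
`C'` so that finitely many of them can be combined. -/
theorem exists_local_bound : ∃ U' ⊆ U, IsOpen U' ∧ x ∈ U' ∧ ∃ C M : ℝ, 0 ≤ C ∧ 0 < M ∧
    ∀ C' ≥ C, ∀ y ∈ U', 0 ≤ (fderiv ℝ f y).det + C' * Complex.normSq (f y) ∧
      |(fderiv ℝ (h ∘ ζ) y).det| ≤ C' * ((fderiv ℝ f y).det + C' * Complex.normSq (f y)) ∧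
      ‖f y‖ ≤ M * ‖(h ∘ ζ) y‖ := by
  have cz : ContinuousOn (fderiv ℝ ζ) U := hs.smooth.continuousOn_fderiv_of_isOpen hs.isOpen (by simp)
  have ck : ContinuousOn (fderiv ℝ k) U :=
    hs.smooth_factor.continuousOn_fderiv_of_isOpen hs.isOpen (by simp)
  have hU := hs.isOpen.mem_nhds hx
  have c1 : ContinuousAt (fun y => (fderiv ℝ ζ y).det) x :=
    ContinuousLinearMap.continuous_det.continuousAt.comp (cz.continuousAt hU)
  have c2 : ContinuousAt (fun y => ‖fderiv ℝ ζ y‖) x := (cz.continuousAt hU).norm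
  have c3 : ContinuousAt (fun y => ‖fderiv ℝ k y‖) x := (ck.continuousAt hU).norm
  have c4 : ContinuousAt (fun y => ‖k y‖) x :=
    (hs.smooth_factor.continuousOn.continuousAt hU).norm
  set d := (fderiv ℝ ζ x).det / 2 with hd
  have hdpos : 0 < d := by have := hs.det_pos x hx; positivity
  set B := ‖fderiv ℝ ζ x‖ + ‖fderiv ℝ k x‖ + 1 with hB
  have hBpos : 0 < B := by positivity
  set κ := ‖k x‖ / 2 with hκ
  have hk0 : 0 < ‖k x‖ := norm_pos_iff.mpr (hs.factor_ne_zero x hx)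
  have hκpos : 0 < κ := by positivity
  -- Each inequality is strict at `x` and persists by continuity; `4κ` is `2‖k x‖`.
  have ev : ∀ᶠ y in nhds x, y ∈ U ∧ d < (fderiv ℝ ζ y).det ∧ ‖fderiv ℝ ζ y‖ < B ∧
      ‖fderiv ℝ k y‖ < B ∧ κ < ‖k y‖ ∧ ‖k y‖ < 4 * κ := by
    refine Filter.Eventually.and hU <| (c1.eventually_const_lt ?_).and <| (c2.eventually_lt_const ?_).and <|
      (c3.eventually_lt_const ?_).and <| (c4.eventually_const_lt ?_).and
      (c4.eventually_lt_const ?_)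
    · rw [hd]; have := hs.det_pos x hx; linarith
    · rw [hB]; have := norm_nonneg (fderiv ℝ k x); linarith
    · rw [hB]; have := norm_nonneg (fderiv ℝ ζ x); linarith
    · rw [hκ]; linarith
    · rw [hκ]; linarith
  obtain ⟨U', hU'sub, hU'o, hxU'⟩ := mem_nhds_iff.mp ev
  set C0 := 2 * B ^ 2 + 4 * B ^ 4 / d with hC0
  have hC0pos : 0 < C0 := by positivity
  -- The summand `C0 / κ²` makes `det df + C'|f|²` nonnegative; `2 / κ²` lets it bound the Jacobian
  -- of `h ∘ ζ`.
  refine ⟨U', fun y hy => (hU'sub hy).1, hU'o, hxU', C0 / κ ^ 2 + 2 / κ ^ 2, 4 * κ,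
    by positivity, by positivity, fun C' hC' y hy => ?_⟩
  obtain ⟨hyU, h1, h2, h3, h4, h5⟩ := hU'sub hy
  have hkey := normSq_mul_det_le hdpos hBpos.le h1.le h2.le h3.le (k y * deriv h (ζ y)) (h (ζ y))
  rw [← hs.fderiv_eq hyU, norm_mul, mul_pow, ← hC0] at hkey
  have hff : Complex.normSq (f y) = ‖h (ζ y)‖ ^ 2 * ‖k y‖ ^ 2 := by
    rw [Complex.normSq_eq_norm_sq, hs.eq y hyU, norm_mul, mul_pow]
  have hdet := hs.det_fderiv_comp_eq hyU
  set X := ‖deriv h (ζ y)‖ ^ 2 * (fderiv ℝ ζ y).det with hX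
  have hXpos : 0 ≤ X := mul_nonneg (by positivity) (hs.det_pos y hyU).le
  have hk2 : κ ^ 2 ≤ ‖k y‖ ^ 2 := by gcongr
  have hfl : κ ^ 2 * ‖h (ζ y)‖ ^ 2 ≤ Complex.normSq (f y) := by
    rw [hff]; nlinarith [sq_nonneg ‖h (ζ y)‖]
  have hnf := Complex.normSq_nonneg (f y)
  have e1 : κ ^ 2 * X ≤ ‖k y‖ ^ 2 * ‖deriv h (ζ y)‖ ^ 2 * (fderiv ℝ ζ y).det := by
    rw [mul_assoc]; exact mul_le_mul_of_nonneg_right hk2 hXpos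
  have e2 : C0 * ‖h (ζ y)‖ ^ 2 ≤ C0 / κ ^ 2 * Complex.normSq (f y) := by
    rw [div_mul_eq_mul_div, le_div_iff₀ (by positivity)]
    nlinarith
  have e3 : κ ^ 2 * X ≤ 2 * ((fderiv ℝ f y).det + C0 / κ ^ 2 * Complex.normSq (f y)) := by
    have : 0 ≤ C0 / κ ^ 2 * Complex.normSq (f y) := by positivity
    linarith
  have e4 : (fderiv ℝ f y).det + C0 / κ ^ 2 * Complex.normSq (f y) ≤
      (fderiv ℝ f y).det + C' * Complex.normSq (f y) := by
    have : C0 / κ ^ 2 ≤ C' := by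
      have : 0 ≤ 2 / κ ^ 2 := by positivity
      linarith
    gcongr
  have e5 : 0 ≤ (fderiv ℝ f y).det + C' * Complex.normSq (f y) := by
    have : 0 ≤ κ ^ 2 * X := by positivity
    linarith
  refine ⟨e5, ?_, ?_⟩
  · rw [hdet, abs_of_nonneg hXpos]
    have e6 : X ≤ 2 / κ ^ 2 * ((fderiv ℝ f y).det + C' * Complex.normSq (f y)) := by
      rw [div_mul_eq_mul_div, le_div_iff₀ (by positivity)]
      linarith
    refine e6.trans (mul_le_mul_of_nonneg_right ?_ e5)
    have : 0 ≤ C0 / κ ^ 2 := by positivity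
    linarith
  · rw [hs.eq y hyU, norm_mul, mul_comm]
    exact mul_le_mul_of_nonneg_right h5.le (norm_nonneg _)

theorem map_nhds_eq : Filter.map ζ (nhds x) = nhds (ζ x) := by
  have hz := (hs.smooth.contDiffAt (hs.isOpen.mem_nhds hx)).hasStrictFDerivAt (by simp)
  refine hz.map_nhds_eq_of_surj ?_
  rw [LinearMap.range_eq_top]
  exact (bijective_of_det_ne_zero (hs.det_pos x hx).ne').surjective

/-- The open mapping theorem for `h`, transported by the local diffeomorphism `ζ`. -/
theorem eventually_eq_zero_or (h0 : f x = 0) :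
    (∀ᶠ y in nhds x, f y = 0) ∨ nhds 0 ≤ Filter.map (h ∘ ζ) (nhds x) := by
  have hh : AnalyticAt ℂ h (ζ x) :=
    hs.holomorphic.analyticAt (hs.isOpen_target.mem_nhds (hs.mapsTo hx))
  have hz0 : h (ζ x) = 0 := by
    have := hs.eq x hx
    rw [h0] at this
    exact (mul_eq_zero.mp this.symm).resolve_right (hs.factor_ne_zero x hx)
  rcases hh.eventually_constant_or_nhds_le_map_nhds with hc | ho
  · left
    rw [← hs.map_nhds_eq hx] at hc
    filter_upwards [Filter.eventually_map.mp hc, hs.isOpen.mem_nhds hx] with y hy hyU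
    rw [hs.eq y hyU, hy, hz0, zero_mul]
  · right
    rw [← Filter.map_map, hs.map_nhds_eq hx, ← hz0]
    exact ho

end IsLocalSection

/-- A section of a power of the canonical bundle of a torus has no zeros or vanishes
identically. -/
theorem eq_zero_of_exists_zero {f : ℂ → ℂ} (hf : ContDiff ℝ ∞ f) (h1 : Function.Periodic f 1)
    (hI : Function.Periodic f Complex.I)
    (hloc : ∀ x, ∃ U V ζ k h, x ∈ U ∧ IsLocalSection f U V ζ k h) {x₀ : ℂ} (hx₀ : f x₀ = 0) (x : ℂ) :
    f x = 0 := by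
  -- One constant serves the compact square, hence by periodicity the whole plane.
  obtain ⟨C, hC, hlow⟩ : ∃ C : ℝ, 0 ≤ C ∧ ∀ C' ≥ C, ∀ z ∈ unitSquare,
      0 ≤ (fderiv ℝ f z).det + C' * Complex.normSq (f z) := by
    refine isCompact_unitSquare.induction_on (p := fun s => ∃ C : ℝ, 0 ≤ C ∧ ∀ C' ≥ C, ∀ z ∈ s,
      0 ≤ (fderiv ℝ f z).det + C' * Complex.normSq (f z)) ⟨0, le_rfl, by simp⟩ ?_ ?_ ?_
    · rintro s t hst ⟨C, hC, h⟩
      exact ⟨C, hC, fun C' hC' z hz => h C' hC' z (hst hz)⟩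
    · rintro s t ⟨C, hC, h⟩ ⟨D, hD, h'⟩
      refine ⟨max C D, hC.trans (le_max_left _ _), fun C' hC' z hz => ?_⟩
      rcases hz with hz | hz
      · exact h C' ((le_max_left _ _).trans hC') z hz
      · exact h' C' ((le_max_right _ _).trans hC') z hz
    · intro y _
      obtain ⟨U, V, ζ, k, h, hy, hs⟩ := hloc y
      obtain ⟨U', -, hU', hyU', C, M, hC, -, hb⟩ := hs.exists_local_bound hy
      exact ⟨U', mem_nhdsWithin_of_mem_nhds (hU'.mem_nhds hyU'), C, hC,
        fun C' hC' z hz => (hb C' hC' z hz).1⟩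
  have hglob : ∀ C' ≥ C, ∀ z, 0 ≤ (fderiv ℝ f z).det + C' * Complex.normSq (f z) := by
    intro C' hC' z
    have p1 : Function.Periodic (fun z => (fderiv ℝ f z).det + C' * Complex.normSq (f z)) 1 :=
      fun z => by simp only [h1.fderiv_of_complex z, h1 z]
    have p2 : Function.Periodic (fun z => (fderiv ℝ f z).det + C' * Complex.normSq (f z))
        Complex.I := fun z => by simp only [hI.fderiv_of_complex z, hI z]
    obtain ⟨w, hw, e⟩ := p1.exists_mem_unitSquare_eq p2 z
    rw [e]
    exact hlow C' hC' w hw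
  -- At a zero near which `f` is not identically zero, `h ∘ ζ` would be open, against
  -- `false_of_zero`. The zero set is therefore open as well as closed.
  have hzero : ∀ x, f x = 0 → ∀ᶠ y in nhds x, f y = 0 := by
    intro x hx
    obtain ⟨U, V, ζ, k, h, hxU, hs⟩ := hloc x
    refine (hs.eventually_eq_zero_or hxU hx).resolve_right fun hop => ?_
    obtain ⟨U', hUU', hU', hxU', C₁, M, hC₁, hM, hb⟩ := hs.exists_local_bound hxU
    refine false_of_zero hf h1 hI (C := max C C₁) (M := M) (hC.trans (le_max_left _ _)) hM
      (hglob _ (le_max_left _ _)) hU' hxU' (H := h ∘ ζ) ?_ ?_ ?_ hop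
    · exact fun y hy => (hs.differentiableAt_comp (hUU' hy)).differentiableWithinAt
    · exact fun y hy => (hb _ (le_max_right C _) y hy).2.1
    · exact fun y hy => (hb _ (le_max_right C _) y hy).2.2
  have hopen : IsOpen {x | f x = 0} := isOpen_iff_mem_nhds.mpr hzero
  have hclosed : IsClosed {x | f x = 0} := isClosed_eq hf.continuous continuous_const
  have huniv : {x | f x = 0} = Set.univ := IsClopen.eq_univ ⟨hclosed, hopen⟩ ⟨x₀, hx₀⟩
  have : x ∈ {x | f x = 0} := huniv ▸ Set.mem_univ x
  exact this

/-! ### Developing maps of tori -/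

/-- The real linear map sending `1` to `a` and `i` to `b`. -/
noncomputable def frameMap (a b : ℂ) : ℂ →L[ℝ] ℂ :=
  Complex.reCLM.smulRight a + Complex.imCLM.smulRight b

theorem frameMap_apply (a b z : ℂ) : frameMap a b z = z.re * a + z.im * b := by
  simp [frameMap]

theorem det_frameMap (a b : ℂ) : (frameMap a b).det = a.re * b.im - a.im * b.re := by
  rw [det_complex_eq]; simp [frameMap_apply]

theorem linearIndependent_of_det {a b : ℂ} (h : a.re * b.im - a.im * b.re ≠ 0) :
    LinearIndependent ℝ ![a, b] := by
  rw [LinearIndependent.pair_iff]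
  intro s t hst
  have hr := congrArg Complex.re hst
  have hi := congrArg Complex.im hst
  simp at hr hi
  constructor
  · apply (mul_eq_zero.mp (?_ : s * (a.re * b.im - a.im * b.re) = 0)).resolve_right h
    linear_combination b.im * hr - b.re * hi
  · apply (mul_eq_zero.mp (?_ : t * (a.re * b.im - a.im * b.re) = 0)).resolve_right h
    linear_combination a.re * hi - a.im * hr

section Developing

variable {F : ℂ → ℂ} (hF : ContDiff ℝ ∞ F) {a b : ℂ} (hdet : ∀ z, 0 < (fderiv ℝ F z).det)
  (ha : ∀ z, F (z + 1) = F z + a) (hb : ∀ z, F (z + Complex.I) = F z + b)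
include hF hdet

theorem isLocalHomeomorph_of_det_pos : IsLocalHomeomorph F := by
  intro z
  have hs := (hF.contDiffAt (x := z)).hasStrictFDerivAt (by simp)
  have := (hdet z).ne'
  rw [← ContinuousLinearMap.coe_toContinuousLinearEquivOfDetNeZero _ this] at hs
  exact ⟨hs.toOpenPartialHomeomorph F, hs.mem_toOpenPartialHomeomorph_source, rfl⟩

include ha hb

/-- The integral of the positive Jacobian is the signed area of the period parallelogram. -/
theorem period_det_pos : 0 < a.re * b.im - a.im * b.re := by
  have h := integral_det_fderiv_unitSquare hF ha hb
  have hc : Continuous fun z => (fderiv ℝ F z).det :=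
    ContinuousLinearMap.continuous_det.comp (hF.continuous_fderiv (by simp))
  have hpos : 0 < ∫ z in unitSquare, (fderiv ℝ F z).det := by
    rw [setIntegral_pos_iff_support_of_nonneg_ae
      (Filter.Eventually.of_forall fun z => (hdet z).le)
      (hc.continuousOn.integrableOn_compact isCompact_unitSquare)]
    have : (Function.support fun z => (fderiv ℝ F z).det) = Set.univ :=
      Set.eq_univ_of_forall fun z => (hdet z).ne'
    rw [this, Set.univ_inter, unitSquare,
      Complex.volume_preserving_equiv_real_prod.measure_preimage_equiv,
      show (0 : ℝ × ℝ) = (0, 0) from rfl, show (1 : ℝ × ℝ) = (1, 1) from rfl, ← Set.Icc_prod_Icc,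
      Measure.volume_eq_prod, Measure.prod_prod]
    simp
  rw [h] at hpos
  linarith

/-- `F` differs from the linear isomorphism with the same periods by a doubly periodic, hence
bounded, function. -/
theorem isProperMap_developing : IsProperMap F := by
  rw [isProperMap_iff_tendsto_cocompact]
  refine ⟨hF.continuous, ?_⟩
  have hd : (frameMap a b).det ≠ 0 := by
    rw [det_frameMap]; exact (period_det_pos hF hdet ha hb).ne'
  set L := (frameMap a b).toContinuousLinearEquivOfDetNeZero hd with hL
  have hLc : ∀ z, L z = frameMap a b z := fun z => rfl
  set G : ℂ → ℂ := fun z => F z - frameMap a b z with hG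
  have hGc : Continuous G := hF.continuous.sub (frameMap a b).continuous
  have p1 : Function.Periodic G 1 := fun z => by
    simp only [hG, ha, map_add]; simp [frameMap_apply]
  have pI : Function.Periodic G Complex.I := fun z => by
    simp only [hG, hb, map_add]; simp [frameMap_apply]
  obtain ⟨C, hC⟩ := isCompact_unitSquare.exists_bound_of_continuousOn hGc.continuousOn
  have hbd : ∀ z, ‖F z - L z‖ ≤ C := fun z => by
    obtain ⟨w, hw, e⟩ := p1.exists_mem_unitSquare_eq pI z
    change ‖G z‖ ≤ C
    rw [e]
    exact hC w hw
  have hLt : Filter.Tendsto (fun z => ‖L z‖ - C) (Filter.cocompact ℂ) Filter.atTop := by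
    apply Filter.tendsto_atTop_add_const_right
    exact tendsto_norm_cocompact_atTop.comp L.toHomeomorph.isClosedEmbedding.tendsto_cocompact
  have hFt : Filter.Tendsto (fun z => ‖F z‖) (Filter.cocompact ℂ) Filter.atTop := by
    refine Filter.tendsto_atTop_mono (fun z => ?_) hLt
    have h1 := hbd z
    have h2 := norm_sub_norm_le (L z) (F z)
    rw [norm_sub_rev] at h1
    linarith
  rw [← Metric.cobounded_eq_cocompact]
  rw [← Metric.cobounded_eq_cocompact] at hFt
  exact tendsto_norm_atTop_iff_cobounded.mp hFt

/-- A proper local homeomorphism with finite fibres is a covering. As the plane is simply connected,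
the covering has a section through any given point, and uniqueness of lifts makes this section a
two-sided inverse. -/
theorem bijective_developing : Function.Bijective F := by
  have hlh := isLocalHomeomorph_of_det_pos hF hdet
  have hp := isProperMap_developing hF hdet ha hb
  have hfin : ∀ x, (F ⁻¹' {x}).Finite := by
    intro x
    have hcpt : IsCompact (F ⁻¹' {x}) := hp.isCompact_preimage isCompact_singleton
    refine hcpt.finite (.of_openPartialHomeomorph F subset_rfl fun y _ => ?_)
    obtain ⟨e, hye, he⟩ := hlh y
    exact ⟨e, hye, he.symm⟩
  have hcov : IsCoveringMap F := by
    rw [isCoveringMap_iff_isCoveringMapOn_univ]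
    exact hp.isClosedMap.isCoveringMapOn_of_isLocalHomeomorphOn (fun x _ => hfin x)
      (by simpa [isLocalHomeomorph_iff_isLocalHomeomorphOn_univ] using hlh)
  have hsurj : Function.Surjective F := by
    have : IsClopen (Set.range F) := ⟨hp.isClosedMap.isClosed_range, hlh.isOpenMap.isOpen_range⟩
    exact Set.range_eq_univ.mp (this.eq_univ (Set.range_nonempty F))
  refine ⟨fun x y hxy => ?_, hsurj⟩
  obtain ⟨s, ⟨hs1, hs2⟩, -⟩ := hcov.existsUnique_continuousMap_lifts (ContinuousMap.id ℂ) (F x) x rfl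
  have : (fun z => s (F z)) = id := by
    apply hcov.eq_of_comp_eq (by fun_prop) continuous_id _ x
    · simpa using hs1
    · ext z
      exact congrFun hs2 (F z)
  have h1 := congrFun this x
  have h2 := congrFun this y
  simp only [id] at h1 h2
  rw [← h1, hxy, h2]

end Developing

/-! ### Conformal charts of special Legendrian tori -/

/-- On `U` the map `F₀` is a special Legendrian immersion in the conformal coordinate `ζ`. -/
structure IsConformalChart (F₀ : ℂ → C3) (U V : Set ℂ) (ζ : ℂ → ℂ) (f : ℂ → C3) : Prop where
  isOpen : IsOpen U
  smooth : ContDiffOn ℝ ∞ ζ U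
  image_eq : ζ '' U = V
  isSLMap : IsSLMap f V
  eq : ∀ y ∈ U, F₀ y = f (ζ y)

/-- The `(1,0)` part of `∂F/∂s`, doubled. -/
noncomputable def frameZ (F₀ : ℂ → C3) (y : ℂ) : C3 :=
  partialS F₀ y - Complex.I • crossC3 (F₀ y) (partialS F₀ y)

/-- The `(0,1)` part of `∂F/∂s`, doubled. -/
noncomputable def frameZbar (F₀ : ℂ → C3) (y : ℂ) : C3 :=
  partialS F₀ y + Complex.I • crossC3 (F₀ y) (partialS F₀ y)

/-- The cubic differential evaluated on `∂/∂s`. -/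
noncomputable def frameCubic (F₀ : ℂ → C3) (y : ℂ) : ℂ :=
  inner ℂ (frameZbar F₀ y) (partialS (frameZ F₀) y)

/-- The area density of `F`, oriented by the cross product. -/
noncomputable def frameArea (F₀ : ℂ → C3) (y : ℂ) : ℝ :=
  inner ℝ (crossC3 (F₀ y) (partialS F₀ y)) (partialT F₀ y)

/-- The ratio of the values at `∂/∂t` and `∂/∂s` of a form of type `(1,0)`. -/
noncomputable def frameSlope (F₀ : ℂ → C3) (y : ℂ) : ℂ :=
  ((‖partialS F₀ y‖ ^ 2)⁻¹ : ℝ) •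
    ((inner ℝ (partialS F₀ y) (partialT F₀ y) : ℝ) + frameArea F₀ y * Complex.I : ℂ)

namespace IsConformalChart

variable {F₀ : ℂ → C3} {U V : Set ℂ} {ζ : ℂ → ℂ} {f : ℂ → C3} (hc : IsConformalChart F₀ U V ζ f)
include hc

theorem mapsTo : Set.MapsTo ζ U V := by
  rw [← hc.image_eq]; exact Set.mapsTo_image _ _

variable {y : ℂ} (hy : y ∈ U)
include hy

theorem differentiableAt_coord : DifferentiableAt ℝ ζ y :=
  hc.smooth.differentiableAt_of_isOpen hc.isOpen hy

theorem fderiv_eq (v : ℂ) : fderiv ℝ F₀ y v = fderiv ℝ f (ζ y) (fderiv ℝ ζ y v) := by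
  rw [ContDiffOn.fderiv_congr_of_isOpen (g := f ∘ ζ) hc.isOpen hc.eq hy,
    fderiv_comp _ (hc.isSLMap.differentiableAt (hc.mapsTo hy)) (hc.differentiableAt_coord hy)]
  rfl

theorem cross_fderiv (v : ℂ) : crossC3 (F₀ y) (fderiv ℝ F₀ y v) =
    fderiv ℝ f (ζ y) (Complex.I * fderiv ℝ ζ y v) := by
  rw [hc.fderiv_eq hy, hc.eq y hy, hc.isSLMap.cross_fderiv (hc.mapsTo hy)]

theorem frameZ_eq : frameZ F₀ y = fderiv ℝ ζ y 1 • partialZ f (ζ y) := by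
  rw [frameZ, partialS, hc.cross_fderiv hy, hc.fderiv_eq hy, fderiv_complex_apply,
    fderiv_complex_apply _ (Complex.I * _)]
  generalize fderiv ℝ ζ y 1 = c
  simp only [partialZ, partialS, partialT, Complex.mul_re, Complex.mul_im, Complex.I_re,
    Complex.I_im, zero_mul, one_mul, zero_sub, zero_add]
  generalize fderiv ℝ f (ζ y) 1 = s
  generalize fderiv ℝ f (ζ y) Complex.I = t
  ext i
  simp
  linear_combination (norm := skip) (s i - Complex.I * t i) * Complex.re_add_im c
  linear_combination (c.im * t i) * Complex.I_mul_I

theorem frameZbar_eq : frameZbar F₀ y = conj (fderiv ℝ ζ y 1) • partialZbar f (ζ y) := by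
  rw [frameZbar, partialS, hc.cross_fderiv hy, hc.fderiv_eq hy, fderiv_complex_apply,
    fderiv_complex_apply _ (Complex.I * _)]
  generalize fderiv ℝ ζ y 1 = c
  simp only [partialZbar, partialS, partialT, Complex.mul_re, Complex.mul_im, Complex.I_re,
    Complex.I_im, zero_mul, one_mul, zero_sub, zero_add]
  generalize fderiv ℝ f (ζ y) 1 = s
  generalize fderiv ℝ f (ζ y) Complex.I = t
  have h : conj c = c.re - c.im * Complex.I := by
    apply Complex.ext <;> simp
  ext i
  simp [h]
  linear_combination (c.im * t i) * Complex.I_mul_I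

/-- The second derivative of `ζ` contributes a multiple of `partialZ f` and the harmonic map
equation a multiple of `f`. Both are orthogonal to `partialZbar f`, so the cubic form transforms
tensorially. -/
theorem frameCubic_eq : frameCubic F₀ y = cubicForm f (ζ y) * (fderiv ℝ ζ y 1) ^ 3 := by
  have hz := hc.mapsTo hy
  have hP := hc.isSLMap.differentiableAt_partialZ hz
  have hζ := hc.differentiableAt_coord hy
  have hPd : DifferentiableAt ℝ (fun y => partialZ f (ζ y)) y := hP.comp y hζ
  have hcd : DifferentiableAt ℝ (fun y => fderiv ℝ ζ y 1) y :=
    (hc.smooth.fderiv_apply_const hc.isOpen 1).differentiableAt_of_isOpen hc.isOpen hy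
  have e1 : partialS (frameZ F₀) y = fderiv ℝ ζ y 1 • fderiv ℝ (partialZ f) (ζ y) (fderiv ℝ ζ y 1) +
      fderiv ℝ (fun y => fderiv ℝ ζ y 1) y 1 • partialZ f (ζ y) := by
    rw [partialS, ContDiffOn.fderiv_congr_of_isOpen hc.isOpen (fun y hy => hc.frameZ_eq hy) hy,
      fderiv_fun_smul hcd hPd]
    have : fderiv ℝ (fun y => partialZ f (ζ y)) y = _ := fderiv_comp (g := partialZ f) y hP hζ
    rw [this]
    simp
  rw [frameCubic, e1, hc.frameZbar_eq hy, fderiv_complex_apply (fderiv ℝ (partialZ f) (ζ y))]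
  have e2 := hc.isSLMap.partialT_partialZ hz
  have e3 : fderiv ℝ (partialZ f) (ζ y) 1 = partialS (partialZ f) (ζ y) := rfl
  have e4 : fderiv ℝ (partialZ f) (ζ y) Complex.I = partialT (partialZ f) (ζ y) := rfl
  rw [e3, e4, e2, cubicForm]
  generalize fderiv ℝ ζ y 1 = c
  simp only [inner_smul_left, inner_add_right, inner_smul_right, inner_smul_right_eq_smul,
    hc.isSLMap.inner_partialZbar hz, hc.isSLMap.inner_partialZbar_partialZ hz, Complex.real_smul]
  simp only [Complex.conj_conj]
  linear_combination (c ^ 2 * inner ℂ (partialZbar f (ζ y)) (partialS (partialZ f) (ζ y)) : ℂ) *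
    Complex.re_add_im c

theorem inner_partialS_fderiv (w : ℂ) : (inner ℝ (partialS F₀ y) (fderiv ℝ F₀ y w) : ℝ) =
    (metricFactor f (ζ y)).re * (conj (fderiv ℝ ζ y 1) * fderiv ℝ ζ y w).re := by
  rw [real_inner_C3, partialS, hc.fderiv_eq hy, hc.fderiv_eq hy,
    hc.isSLMap.inner_fderiv_fderiv (hc.mapsTo hy), Complex.re_mul_ofReal]
  simp [metricFactor]

theorem inner_cross_fderiv (w : ℂ) :
    (inner ℝ (crossC3 (F₀ y) (partialS F₀ y)) (fderiv ℝ F₀ y w) : ℝ) =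
    (metricFactor f (ζ y)).re * (conj (fderiv ℝ ζ y 1) * fderiv ℝ ζ y w).im := by
  rw [real_inner_C3, partialS, hc.cross_fderiv hy, hc.fderiv_eq hy,
    hc.isSLMap.inner_fderiv_fderiv (hc.mapsTo hy), Complex.re_mul_ofReal]
  simp [metricFactor]
  left
  ring

theorem frameArea_eq : frameArea F₀ y = (metricFactor f (ζ y)).re * (fderiv ℝ ζ y).det := by
  rw [frameArea, partialT, hc.inner_cross_fderiv hy, det_complex_eq]
  simp
  left
  ring

theorem metricFactor_pos : 0 < (metricFactor f (ζ y)).re := by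
  have h := hc.isSLMap.partialS_ne_zero (hc.mapsTo hy)
  rw [metricFactor, inner_self_eq_norm_sq_to_K]
  have : 0 < ‖partialS f (ζ y)‖ := norm_pos_iff.mpr h
  norm_cast
  exact pow_pos this 2

theorem det_pos (h : 0 < frameArea F₀ y) : 0 < (fderiv ℝ ζ y).det := by
  rw [hc.frameArea_eq hy] at h
  exact (pos_iff_pos_of_mul_pos h).mp (hc.metricFactor_pos hy)

theorem fderiv_one_ne_zero (h : 0 < frameArea F₀ y) : fderiv ℝ ζ y 1 ≠ 0 := by
  intro h0
  have := (bijective_of_det_ne_zero (hc.det_pos hy h).ne').injective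
  exact one_ne_zero (this (h0.trans (map_zero _).symm))

/-- By conformality `⟨F_s, F_t⟩ + i · area = ρ conj(ζ_s) ζ_t` and `‖F_s‖² = ρ |ζ_s|²`. The direction
of `dζ` is thereby read off from `F₀` alone, independently of the chart. -/
theorem frameSlope_eq (h : 0 < frameArea F₀ y) :
    frameSlope F₀ y * fderiv ℝ ζ y 1 = fderiv ℝ ζ y Complex.I := by
  have h0 := hc.fderiv_one_ne_zero hy h
  have hρ := hc.metricFactor_pos hy
  have e1 : ‖partialS F₀ y‖ ^ 2 = (metricFactor f (ζ y)).re * Complex.normSq (fderiv ℝ ζ y 1) := by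
    rw [← real_inner_self_eq_norm_sq]
    rw [show inner ℝ (partialS F₀ y) (partialS F₀ y) =
      inner ℝ (partialS F₀ y) (fderiv ℝ F₀ y 1) from rfl, hc.inner_partialS_fderiv hy]
    rw [mul_comm (conj _), Complex.mul_conj, Complex.ofReal_re]
  have e2 := hc.inner_partialS_fderiv hy Complex.I
  have e3 := hc.inner_cross_fderiv hy Complex.I
  rw [frameSlope, e1]
  change (_ • ((inner ℝ (partialS F₀ y) (fderiv ℝ F₀ y Complex.I) : ℝ) +
    (inner ℝ (crossC3 (F₀ y) (partialS F₀ y)) (fderiv ℝ F₀ y Complex.I) : ℝ) * Complex.I : ℂ)) * _ = _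
  rw [e2, e3]
  push_cast
  set c := fderiv ℝ ζ y 1
  set d := fderiv ℝ ζ y Complex.I
  have e4 : (((metricFactor f (ζ y)).re : ℂ) * ((conj c * d).re : ℂ) +
      ((metricFactor f (ζ y)).re : ℂ) * ((conj c * d).im : ℂ) * Complex.I) =
      (metricFactor f (ζ y)).re * (conj c * d) := by
    conv_rhs => rw [← Complex.re_add_im (conj c * d)]
    ring
  rw [e4, Complex.real_smul]
  push_cast
  rw [Complex.normSq_eq_conj_mul_self]
  have h1 : conj c ≠ 0 := by simpa using h0
  have h2 : ((metricFactor f (ζ y)).re : ℂ) ≠ 0 := by exact_mod_cast hρ.ne'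
  field_simp

end IsConformalChart

/-- A doubly periodic map of the plane which is special Legendrian for some complex structure
on the torus. -/
structure IsSLTorus (F₀ : ℂ → C3) : Prop where
  smooth : ContDiff ℝ ∞ F₀
  periodic_one : Function.Periodic F₀ 1
  periodic_I : Function.Periodic F₀ Complex.I
  area_pos : ∀ y, 0 < frameArea F₀ y
  chart : ∀ x, ∃ U V ζ f, x ∈ U ∧ IsConformalChart F₀ U V ζ f

theorem IsConformalChart.isLocalSection {F₀ : ℂ → C3} {U V : Set ℂ} {ζ : ℂ → ℂ} {f : ℂ → C3}
    (hc : IsConformalChart F₀ U V ζ f) (hF : ∀ y, 0 < frameArea F₀ y) {s k h : ℂ → ℂ}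
    (hk : ContDiffOn ℝ ∞ k U) (hk0 : ∀ y ∈ U, k y ≠ 0) (hh : DifferentiableOn ℂ h V)
    (hs : ∀ y ∈ U, s y = h (ζ y) * k y) : IsLocalSection s U V ζ k h where
  isOpen := hc.isOpen
  isOpen_target := hc.isSLMap.isOpen
  mapsTo := hc.mapsTo
  smooth := hc.smooth
  smooth_factor := hk
  holomorphic := hh
  det_pos y hy := hc.det_pos hy (hF y)
  factor_ne_zero := hk0
  eq := hs

namespace IsSLTorus

variable {F₀ : ℂ → C3} (hF : IsSLTorus F₀)
include hF

theorem smooth_partialS : ContDiff ℝ ∞ (partialS F₀) := hF.smooth.fderiv_apply_const 1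

theorem smooth_partialT : ContDiff ℝ ∞ (partialT F₀) := hF.smooth.fderiv_apply_const Complex.I

theorem smooth_cross : ContDiff ℝ ∞ fun y => crossC3 (F₀ y) (partialS F₀ y) :=
  hF.smooth.crossC3 hF.smooth_partialS

theorem smooth_frameZ : ContDiff ℝ ∞ (frameZ F₀) :=
  hF.smooth_partialS.sub (hF.smooth_cross.const_smul Complex.I)

theorem smooth_frameCubic : ContDiff ℝ ∞ (frameCubic F₀) :=
  (hF.smooth_partialS.add (hF.smooth_cross.const_smul Complex.I)).inner ℂ
    (hF.smooth_frameZ.fderiv_apply_const 1)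

theorem partialS_ne_zero (y : ℂ) : partialS F₀ y ≠ 0 := by
  intro h
  have := hF.area_pos y
  rw [frameArea, h] at this
  have e : crossC3 (F₀ y) 0 = 0 := by ext i; fin_cases i <;> simp [crossC3]
  simp [e] at this

theorem smooth_frameSlope : ContDiff ℝ ∞ (frameSlope F₀) := by
  have h1 : ContDiff ℝ ∞ fun y => (‖partialS F₀ y‖ ^ 2)⁻¹ :=
    (hF.smooth_partialS.norm_sq ℝ).inv fun y => by
      have := norm_pos_iff.mpr (hF.partialS_ne_zero y); positivity
  have h2 : ContDiff ℝ ∞ fun y => (inner ℝ (partialS F₀ y) (partialT F₀ y) : ℝ) :=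
    hF.smooth_partialS.inner ℝ hF.smooth_partialT
  have h3 : ContDiff ℝ ∞ (frameArea F₀) := hF.smooth_cross.inner ℝ hF.smooth_partialT
  exact h1.smul ((Complex.ofRealCLM.contDiff.comp h2).add
    ((Complex.ofRealCLM.contDiff.comp h3).mul contDiff_const))

section Periodic

variable {c : ℂ} (hc : Function.Periodic F₀ c)
include hc
omit hF

theorem periodic_partialS : Function.Periodic (partialS F₀) c := fun z => by
  rw [partialS, hc.fderiv_of_complex z]; rfl

theorem periodic_partialT : Function.Periodic (partialT F₀) c := fun z => by
  rw [partialT, hc.fderiv_of_complex z]; rfl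

theorem periodic_frameZ : Function.Periodic (frameZ F₀) c := fun z => by
  rw [frameZ, periodic_partialS hc z, hc z]; rfl

theorem periodic_frameCubic : Function.Periodic (frameCubic F₀) c := fun z => by
  rw [frameCubic, frameZbar, periodic_partialS hc z, hc z,
    periodic_partialS (periodic_frameZ hc) z]; rfl

theorem periodic_frameSlope : Function.Periodic (frameSlope F₀) c := fun z => by
  rw [frameSlope, frameArea, periodic_partialS hc z, periodic_partialT hc z, hc z]; rfl

end Periodic

theorem frameCubic_eq_zero_of_exists {x₀ : ℂ} (h0 : frameCubic F₀ x₀ = 0) (x : ℂ) :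
    frameCubic F₀ x = 0 := by
  refine eq_zero_of_exists_zero hF.smooth_frameCubic (periodic_frameCubic hF.periodic_one)
    (periodic_frameCubic hF.periodic_I) (fun y => ?_) h0 x
  obtain ⟨U, V, ζ, f, hy, hc⟩ := hF.chart y
  refine ⟨U, V, ζ, fun y => (fderiv ℝ ζ y 1) ^ 3, cubicForm f, hy, hc.isLocalSection hF.area_pos
    ((hc.smooth.fderiv_apply_const hc.isOpen 1).pow 3)
    (fun y hy => pow_ne_zero 3 (hc.fderiv_one_ne_zero hy (hF.area_pos y)))
    (fun z hz => (hc.isSLMap.differentiableAt_cubicForm hz).differentiableWithinAt)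
    (fun y hy => hc.frameCubic_eq hy)⟩

/-- The cubic differential has no zeros. -/
theorem frameCubic_ne_zero (x : ℂ) : frameCubic F₀ x ≠ 0 := by
  intro h0
  have hQ := hF.frameCubic_eq_zero_of_exists h0
  have hq : ∀ {U V ζ f}, IsConformalChart F₀ U V ζ f → ∀ w ∈ V, cubicForm f w = 0 := by
    intro U V ζ f hc w hw
    rw [← hc.image_eq] at hw
    obtain ⟨y, hy, rfl⟩ := hw
    have := hQ y
    rw [hc.frameCubic_eq hy] at this
    exact (mul_eq_zero.mp this).resolve_right
      (pow_ne_zero 3 (hc.fderiv_one_ne_zero hy (hF.area_pos y)))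
  -- Locally `⟨P, a⟩ / ρ` is holomorphic, so these are sections too: one zero forces identical
  -- vanishing. The complex line of `frameZ F₀` therefore never moves.
  have hB : ∀ a : C3, (inner ℂ (frameZ F₀ 0) a : ℂ) = 0 → ∀ y, (inner ℂ (frameZ F₀ y) a : ℂ) = 0 := by
    intro a ha
    refine eq_zero_of_exists_zero (hF.smooth_frameZ.inner ℂ contDiff_const)
      (fun z => by rw [periodic_frameZ hF.periodic_one])
      (fun z => by rw [periodic_frameZ hF.periodic_I]) (fun y => ?_) ha
    obtain ⟨U, V, ζ, f, hy, hc⟩ := hF.chart y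
    have hcd := hc.smooth.fderiv_apply_const hc.isOpen 1
    refine ⟨U, V, ζ, fun y => conj (fderiv ℝ ζ y 1) * metricFactor f (ζ y),
      fun w => inner ℂ (partialZ f w) a / metricFactor f w, hy,
      hc.isLocalSection hF.area_pos ?_ (fun y hy => ?_) (fun z hz => ?_) (fun y hy => ?_)⟩
    · exact (Complex.conjCLE.contDiff.comp_contDiffOn hcd).mul
        (hc.isSLMap.smooth_metricFactor.comp hc.smooth hc.mapsTo)
    · exact mul_ne_zero ((map_ne_zero _).mpr (hc.fderiv_one_ne_zero hy (hF.area_pos y)))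
        (hc.isSLMap.metricFactor_ne_zero (hc.mapsTo hy))
    · exact (hc.isSLMap.differentiableAt_inner_partialZ_of_cubicForm_eq_zero (hq hc) hz
        a).differentiableWithinAt
    · have := hc.isSLMap.metricFactor_ne_zero (hc.mapsTo hy)
      rw [hc.frameZ_eq hy, inner_smul_left]
      field_simp
  obtain ⟨U, V, ζ, f, hy, hc⟩ := hF.chart 0
  have hz := hc.mapsTo hy
  have hP : ∀ a : C3, (inner ℂ (frameZ F₀ 0) a : ℂ) = 0 →
      ∀ w ∈ V, (inner ℂ (partialZ f w) a : ℂ) = 0 := by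
    intro a ha w hw
    rw [← hc.image_eq] at hw
    obtain ⟨y, hy, rfl⟩ := hw
    have := hB a ha y
    rw [hc.frameZ_eq hy, inner_smul_left] at this
    exact (mul_eq_zero.mp this).resolve_left
      ((map_ne_zero _).mpr (hc.fderiv_one_ne_zero hy (hF.area_pos y)))
  set z := ζ 0
  have hPd := hc.isSLMap.differentiableAt_partialZ hz
  have hdP : ∀ a : C3, (inner ℂ (frameZ F₀ 0) a : ℂ) = 0 → ∀ v,
      (inner ℂ (fderiv ℝ (partialZ f) z v) a : ℂ) = 0 := by
    intro a ha v
    have h1 : fderiv ℝ (fun w => (inner ℂ (partialZ f w) a : ℂ)) z v = 0 := by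
      rw [ContDiffOn.fderiv_congr_of_isOpen (g := fun _ => (0 : ℂ)) hc.isSLMap.isOpen (hP a ha) hz]
      simp
    rw [fderiv_inner_apply ℂ hPd (by fun_prop)] at h1
    simpa using h1
  -- The contradiction comes from `a = f z`. It is orthogonal to `P`, but the derivatives of `P` in
  -- `s` and `t` cannot both be orthogonal to it, by the term `2iρ f` in `partialT_partialZ`.
  have hfz : (inner ℂ (frameZ F₀ 0) (f z) : ℂ) = 0 := by
    rw [hc.frameZ_eq hy, inner_smul_left, ← inner_conj_symm, hc.isSLMap.inner_partialZ hz]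
    simp
  have h1 := hdP (f z) hfz 1
  have h2 := hdP (f z) hfz Complex.I
  have h3 : fderiv ℝ (partialZ f) z Complex.I = _ := hc.isSLMap.partialT_partialZ hz
  have h4 : fderiv ℝ (partialZ f) z 1 = partialS (partialZ f) z := rfl
  rw [h4] at h1
  rw [h3, inner_add_left, inner_smul_left, inner_smul_left, h1, hc.isSLMap.inner_self hz] at h2
  have h5 := hc.isSLMap.metricFactor_ne_zero hz
  simp [h5] at h2

end IsSLTorus

/-! ### Uniformization of special Legendrian tori -/

theorem exists_primitive {E F : Type*} [NormedAddCommGroup E] [NormedSpace ℝ E]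
    [NormedAddCommGroup F] [NormedSpace ℝ F] [CompleteSpace F] {η : E → E →L[ℝ] F}
    (hη : ContDiff ℝ ∞ η)
    (hs : ∀ x u v, fderiv ℝ η x u v = fderiv ℝ η x v u) :
    ∃ f : E → F, ContDiff ℝ ∞ f ∧ ∀ x, fderiv ℝ f x = η x := by
  obtain ⟨f, hf⟩ := convex_univ.exists_forall_hasFDerivAt_of_fderiv_symmetric isOpen_univ
    (hη.differentiable (by simp)).differentiableOn (fun x _ => hs x)
  have h : ∀ x, HasFDerivAt f (η x) x := fun x => hf x (Set.mem_univ x)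
  refine ⟨f, ?_, fun x => (h x).fderiv⟩
  rw [contDiff_infty_iff_fderiv]
  refine ⟨fun x => (h x).differentiableAt, ?_⟩
  rwa [show fderiv ℝ f = η from funext fun x => (h x).fderiv]

/-- The form `dA/A` is closed, so a primitive on the plane is a logarithm of `A` up to a constant;
one third of it is exponentiated. -/
theorem exists_cube_root {A : ℂ → ℂ} (hA : ContDiff ℝ ∞ A) (h0 : ∀ x, A x ≠ 0) :
    ∃ g : ℂ → ℂ, ContDiff ℝ ∞ g ∧ ∀ x, g x ^ 3 = A x := by
  have hd : Differentiable ℝ A := hA.differentiable (by simp)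
  have hinv : ContDiff ℝ ∞ fun x => (A x)⁻¹ := hA.inv h0
  have hinvd : Differentiable ℝ fun x => (A x)⁻¹ := hinv.differentiable (by simp)
  have hfd : ContDiff ℝ ∞ (fderiv ℝ A) := hA.fderiv_right (m := ∞) (by simp)
  have hfdd : Differentiable ℝ (fderiv ℝ A) := hfd.differentiable (by simp)
  obtain ⟨l, hl, hdl⟩ := exists_primitive (η := fun x => (A x)⁻¹ • fderiv ℝ A x) (hinv.smul hfd) (by
    intro x u v
    have hinv' : ∀ w, fderiv ℝ (fun x => (A x)⁻¹) x w = -(A x)⁻¹ ^ 2 * fderiv ℝ A x w := by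
      intro w
      have h1 : fderiv ℝ (fun x => (A x)⁻¹ * A x) x w = 0 := by
        have : (fun x => (A x)⁻¹ * A x) = fun _ => 1 := funext fun x => inv_mul_cancel₀ (h0 x)
        rw [this]; simp
      rw [fderiv_fun_mul (hinvd x) (hd x)] at h1
      simp at h1
      have := h0 x
      field_simp
      field_simp at h1
      linear_combination h1
    have hsym : fderiv ℝ (fderiv ℝ A) x u v = fderiv ℝ (fderiv ℝ A) x v u := by
      have := fderiv_fderiv_comm hA.contDiffOn isOpen_univ (Set.mem_univ x) v u
      rwa [fderiv_fderiv_apply_const hA.contDiffOn isOpen_univ (Set.mem_univ x),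
        fderiv_fderiv_apply_const hA.contDiffOn isOpen_univ (Set.mem_univ x)] at this
    rw [fderiv_fun_smul (hinvd x) (hfdd x)]
    simp [hinv', hsym]
    ring)
  have hld : Differentiable ℝ l := hl.differentiable (by simp)
  have hconst : ∀ x, A x * Complex.exp (-l x) = A 0 * Complex.exp (-l 0) := by
    intro x
    have hE : ∀ x, HasFDerivAt (fun x => Complex.exp (-l x))
        (Complex.exp (-l x) • -fderiv ℝ l x) x := fun x => (hld x).hasFDerivAt.neg.cexp
    refine is_const_of_fderiv_eq_zero (𝕜 := ℝ) (f := fun x => A x * Complex.exp (-l x))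
      (fun x => (hd x).mul (hE x).differentiableAt) (fun x => ?_) x 0
    rw [fderiv_fun_mul (hd x) (hE x).differentiableAt, (hE x).fderiv, hdl]
    ext v
    have := h0 x
    simp
    field_simp
    ring
  obtain ⟨c, hc⟩ := IsAlgClosed.exists_pow_nat_eq (A 0 * Complex.exp (-l 0)) (n := 3) (by norm_num)
  refine ⟨fun x => c * Complex.exp (l x / 3),
    contDiff_const.mul (Complex.contDiff_exp.comp (hl.div_const 3)), fun x => ?_⟩
  rw [mul_pow, hc, ← hconst x, ← Complex.exp_nat_mul, mul_assoc, ← Complex.exp_add]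
  have : -l x + (3 : ℕ) * (l x / 3) = 0 := by push_cast; ring
  rw [this, Complex.exp_zero, mul_one]

theorem contDiff_frameMap {a b : ℂ → ℂ} (ha : ContDiff ℝ ∞ a) (hb : ContDiff ℝ ∞ b) :
    ContDiff ℝ ∞ fun x => frameMap (a x) (b x) := by
  have h1 : ContDiff ℝ ∞ fun x => Complex.reCLM.smulRight (a x) := contDiff_const.smulRight ha
  have h2 : ContDiff ℝ ∞ fun x => Complex.imCLM.smulRight (b x) := contDiff_const.smulRight hb
  exact h1.add h2

theorem clm_ext_complex {F : Type*} [NormedAddCommGroup F] [NormedSpace ℝ F] {A B : ℂ →L[ℝ] F}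
    (h1 : A 1 = B 1) (hI : A Complex.I = B Complex.I) : A = B := by
  ext v
  rw [fderiv_complex_apply A, fderiv_complex_apply B, h1, hI]

/-- The quotient `g(x + c)/g(x)` has cube `1`; differentiating the cube shows that the quotient is
constant. -/
theorem multiplier_of_periodic_cube {g A : ℂ → ℂ} (hg : ContDiff ℝ ∞ g) (hA0 : ∀ x, A x ≠ 0)
    (h : ∀ x, g x ^ 3 = A x) {c : ℂ} (hc : Function.Periodic A c) :
    ∃ χ : ℂ, χ ^ 3 = 1 ∧ ∀ x, g (x + c) = χ * g x := by
  have hg0 : ∀ x, g x ≠ 0 := fun x hx => hA0 x (by rw [← h x, hx]; norm_num)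
  have hr : ContDiff ℝ ∞ fun x => g (x + c) * (g x)⁻¹ :=
    (hg.comp (contDiff_id.add contDiff_const)).mul (hg.inv hg0)
  have hr3 : ∀ x, (g (x + c) * (g x)⁻¹) ^ 3 = 1 := fun x => by
    rw [mul_pow, inv_pow, h, h, hc x, mul_inv_cancel₀ (hA0 x)]
  have hrd : Differentiable ℝ fun x => g (x + c) * (g x)⁻¹ := hr.differentiable (by simp)
  have hconst := is_const_of_fderiv_eq_zero (𝕜 := ℝ) hrd fun x => by
    have h1 : fderiv ℝ (fun x => (g (x + c) * (g x)⁻¹) ^ 3) x = 0 := by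
      rw [funext hr3]; simp
    rw [fderiv_fun_pow _ (hrd x)] at h1
    have h2 : g (x + c) * (g x)⁻¹ ≠ 0 := mul_ne_zero (hg0 _) (inv_ne_zero (hg0 _))
    have h3 := smul_eq_zero.mp h1
    exact h3.resolve_left (by simpa using ⟨hg0 _, hg0 _⟩)
  refine ⟨g (0 + c) * (g 0)⁻¹, hr3 0, fun x => ?_⟩
  have := hconst x 0
  beta_reduce at this
  rw [← this, mul_assoc, inv_mul_cancel₀ (hg0 x), mul_one]

theorem eq_add_const_of_fderiv_eq {F G : ℂ → ℂ} (hF : ContDiff ℝ ∞ F) (hG : ContDiff ℝ ∞ G)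
    (h : ∀ x, fderiv ℝ F x = fderiv ℝ G x) : ∃ c, ∀ x, F x = G x + c := by
  have hFd : Differentiable ℝ F := hF.differentiable (by simp)
  have hGd : Differentiable ℝ G := hG.differentiable (by simp)
  refine ⟨F 0 - G 0, fun x => ?_⟩
  have := is_const_of_fderiv_eq_zero (𝕜 := ℝ) (f := fun x => F x - G x) (hFd.fun_sub hGd)
    (fun x => by rw [fderiv_fun_sub (hFd x) (hGd x), h, sub_self]) x 0
  beta_reduce at this
  linear_combination this

theorem exists_multiplier {F : ℂ → ℂ} (hF : ContDiff ℝ ∞ F) {c χ : ℂ}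
    (h : ∀ x, fderiv ℝ F (x + c) = χ • fderiv ℝ F x) : ∃ a, ∀ x, F (x + c) = χ * F x + a := by
  have hFd : Differentiable ℝ F := hF.differentiable (by simp)
  refine eq_add_const_of_fderiv_eq (F := fun x => F (x + c)) (G := fun x => χ * F x)
    (hF.comp (contDiff_id.add contDiff_const)) (contDiff_const.mul hF) fun x => ?_
  rw [fderiv_comp_add_right, h, fderiv_const_mul (hFd x)]

/-- For `χ ≠ 1` the map `w ↦ χ w + a` has a fixed point `F y`, and then `F (y + c) = F y`
contradicts injectivity. -/
theorem eq_translation_of_injective {F : ℂ → ℂ} (hF : Function.Bijective F) {c χ a : ℂ}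
    (hc : c ≠ 0) (h : ∀ x, F (x + c) = χ * F x + a) (x : ℂ) : F (x + c) = F x + a := by
  by_cases hχ : χ = 1
  · rw [h, hχ, one_mul]
  · obtain ⟨y, hy⟩ := hF.2 (a / (1 - χ))
    have h1 : (1 : ℂ) - χ ≠ 0 := sub_ne_zero.mpr (Ne.symm hχ)
    have : F (y + c) = F y := by
      rw [h, hy]; field_simp; ring
    exact absurd (add_eq_left.mp (hF.1 this)) hc

/-- Differentiating `m³ = q(ζ)` with `q` holomorphic shows that `dm` is a complex multiple of `dζ`,
so `d(m dζ) = dm ∧ dζ = 0`. -/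
theorem IsConformalChart.fderiv_symmetric_of_eq {F₀ : ℂ → C3} {U V : Set ℂ} {ζ : ℂ → ℂ}
    {f : ℂ → C3} (hc : IsConformalChart F₀ U V ζ f) {α : ℂ → ℂ →L[ℝ] ℂ} {m : ℂ → ℂ}
    (hm : ContDiffOn ℝ ∞ m U) (hm0 : ∀ y ∈ U, m y ≠ 0)
    (hm3 : ∀ y ∈ U, m y ^ 3 = cubicForm f (ζ y)) (hα : ∀ y ∈ U, α y = m y • fderiv ℝ ζ y) {x : ℂ}
    (hx : x ∈ U) (u v : ℂ) : fderiv ℝ α x u v = fderiv ℝ α x v u := by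
  have hmd := hm.differentiableAt_of_isOpen hc.isOpen hx
  have hζd : DifferentiableAt ℝ (fderiv ℝ ζ) x :=
    (hc.smooth.fderiv_of_isOpen hc.isOpen (m := ∞) (by simp)).differentiableAt_of_isOpen
      hc.isOpen hx
  have hq := hc.isSLMap.differentiableAt_cubicForm (hc.mapsTo hx)
  have key : ∀ w, 3 * m x ^ 2 * fderiv ℝ m x w =
      deriv (cubicForm f) (ζ x) * fderiv ℝ ζ x w := by
    intro w
    have h1 : fderiv ℝ (fun y => m y ^ 3) x = fderiv ℝ (cubicForm f ∘ ζ) x :=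
      ContDiffOn.fderiv_congr_of_isOpen hc.isOpen hm3 hx
    have h2 := (hq.hasDerivAt.hasFDerivAt.restrictScalars ℝ).comp x
      (hc.differentiableAt_coord hx).hasFDerivAt
    rw [fderiv_fun_pow _ hmd, h2.fderiv] at h1
    have := congrArg (fun T => T w) h1
    simp at this
    linear_combination this
  have hsym := fderiv_fderiv_comm hc.smooth hc.isOpen hx v u
  rw [fderiv_fderiv_apply_const hc.smooth hc.isOpen hx,
    fderiv_fderiv_apply_const hc.smooth hc.isOpen hx] at hsym
  rw [ContDiffOn.fderiv_congr_of_isOpen hc.isOpen hα hx, fderiv_fun_smul hmd hζd]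
  simp only [add_apply, smul_apply,
    ContinuousLinearMap.smulRight_apply, smul_eq_mul, hsym]
  have : 3 * m x ^ 2 ≠ 0 := mul_ne_zero three_ne_zero (pow_ne_zero 2 (hm0 x hx))
  apply mul_left_cancel₀ this
  linear_combination fderiv ℝ ζ x v * key u - fderiv ℝ ζ x u * key v

/-- A special Legendrian torus becomes special Legendrian in the standard coordinates of the plane
after a diffeomorphism of the plane which conjugates the translations by `1` and `i` to
translations. -/
theorem IsSLTorus.exists_uniformization {F₀ : ℂ → C3} (hF₀ : IsSLTorus F₀) :
    ∃ (F : ℂ ≃ₜ ℂ) (a b : ℂ), ContDiff ℝ ∞ F ∧ ContDiff ℝ ∞ F.symm ∧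
      LinearIndependent ℝ ![a, b] ∧ (∀ x, F (x + 1) = F x + a) ∧
      (∀ x, F (x + Complex.I) = F x + b) ∧ IsSLMap (F₀ ∘ F.symm) Set.univ := by
  obtain ⟨g, hg, hg3⟩ := exists_cube_root hF₀.smooth_frameCubic hF₀.frameCubic_ne_zero
  have hg0 : ∀ x, g x ≠ 0 := fun x hx => hF₀.frameCubic_ne_zero x (by rw [← hg3, hx]; norm_num)
  -- A global one-form whose cube is the cubic differential: in a chart it is a cube root of
  -- `cubicForm f (ζ y)` times `dζ`.
  set α : ℂ → ℂ →L[ℝ] ℂ := fun x => frameMap (g x) (g x * frameSlope F₀ x) with hαdef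
  have hα : ContDiff ℝ ∞ α := contDiff_frameMap hg (hg.mul hF₀.smooth_frameSlope)
  have hloc : ∀ {U V ζ f}, IsConformalChart F₀ U V ζ f → ∀ y ∈ U,
      α y = (g y * (fderiv ℝ ζ y 1)⁻¹) • fderiv ℝ ζ y := by
    intro U V ζ f hc y hy
    have h0 := hc.fderiv_one_ne_zero hy (hF₀.area_pos y)
    apply clm_ext_complex
    · simp [hαdef, frameMap_apply, mul_assoc, inv_mul_cancel₀ h0]
    · simp only [hαdef, frameMap_apply, smul_apply, smul_eq_mul]
      rw [← hc.frameSlope_eq hy (hF₀.area_pos y)]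
      field_simp
      simp
  obtain ⟨F, hF, hdF⟩ := exists_primitive hα fun x u v => by
    obtain ⟨U, V, ζ, f, hx, hc⟩ := hF₀.chart x
    have hcd := hc.smooth.fderiv_apply_const hc.isOpen 1
    have h0 : ∀ y ∈ U, fderiv ℝ ζ y 1 ≠ 0 := fun y hy =>
      hc.fderiv_one_ne_zero hy (hF₀.area_pos y)
    refine hc.fderiv_symmetric_of_eq (hg.contDiffOn.mul (hcd.inv h0))
      (fun y hy => mul_ne_zero (hg0 y) (inv_ne_zero (h0 y hy))) (fun y hy => ?_) (hloc hc) hx u v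
    rw [mul_pow, hg3, hc.frameCubic_eq hy, Pi.inv_apply, inv_pow]
    have := h0 y hy
    field_simp
  have hdet : ∀ x, 0 < (fderiv ℝ F x).det := by
    intro x
    obtain ⟨U, V, ζ, f, hx, hc⟩ := hF₀.chart x
    rw [hdF, hloc hc x hx]
    have h1 := hc.det_pos hx (hF₀.area_pos x)
    have h0 := hc.fderiv_one_ne_zero hx (hF₀.area_pos x)
    set m := g x * (fderiv ℝ ζ x 1)⁻¹ with hm
    have hm0 : m ≠ 0 := mul_ne_zero (hg0 x) (inv_ne_zero h0)
    have : (m • fderiv ℝ ζ x).det = Complex.normSq m * (fderiv ℝ ζ x).det := by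
      rw [det_complex_eq, det_complex_eq]
      simp [Complex.normSq_apply]
      ring
    rw [this]
    exact mul_pos (Complex.normSq_pos.mpr hm0) h1
  have hmult : ∀ {c}, Function.Periodic F₀ c → ∃ χ : ℂ, χ ^ 3 = 1 ∧
      ∀ x, fderiv ℝ F (x + c) = χ • fderiv ℝ F x := by
    intro c hc
    obtain ⟨χ, hχ, h⟩ := multiplier_of_periodic_cube hg hF₀.frameCubic_ne_zero hg3
      (IsSLTorus.periodic_frameCubic hc)
    refine ⟨χ, hχ, fun x => ?_⟩
    rw [hdF, hdF]
    apply clm_ext_complex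
    · simp [hαdef, frameMap_apply, h]
    · simp [hαdef, frameMap_apply, h, IsSLTorus.periodic_frameSlope hc x, mul_assoc]
  -- The multipliers are cube roots of unity, so tripled periods act by genuine translations and
  -- `bijective_developing` applies to `x ↦ F (3 * x)`.
  have hthree : ∀ {c}, Function.Periodic F₀ c → ∃ a, ∀ x, F (3 * (x + c)) = F (3 * x) + a := by
    intro c hc
    obtain ⟨χ, hχ, h⟩ := hmult hc
    obtain ⟨a, ha⟩ := exists_multiplier hF (c := 3 * c) (χ := 1) fun x => by
      rw [show x + 3 * c = x + c + c + c by ring, h, h, h, smul_smul, smul_smul,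
        show χ * χ * χ = χ ^ 3 by ring, hχ]
    exact ⟨a, fun x => by rw [mul_add, ha, one_mul]⟩
  have hbij : Function.Bijective F := by
    obtain ⟨a, ha⟩ := hthree hF₀.periodic_one
    obtain ⟨b, hb⟩ := hthree hF₀.periodic_I
    have hd3 : ∀ z, fderiv ℝ (fun x => F (3 * x)) z = (3 : ℝ) • fderiv ℝ F (3 * z) := by
      intro z
      have h1 : HasFDerivAt (fun x : ℂ => 3 * x) ((3 : ℝ) • ContinuousLinearMap.id ℝ ℂ) z := by
        have := ((3 : ℝ) • ContinuousLinearMap.id ℝ ℂ).hasFDerivAt (x := z)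
        refine this.congr_of_eventuallyEq (Filter.Eventually.of_forall fun x => ?_)
        simp
      have h2 := ((hF.differentiable (by simp)) (3 * z)).hasFDerivAt.comp z h1
      have h3 : fderiv ℝ (fun x => F (3 * x)) z = _ := h2.fderiv
      rw [h3]
      ext v
      simp
    have hb3 : Function.Bijective fun x => F (3 * x) := by
      refine bijective_developing (hF.comp (contDiff_const.mul contDiff_id)) (fun z => ?_) ha hb
      have := hdet (3 * z)
      have e : ((3 : ℝ) • fderiv ℝ F (3 * z)).det = 9 * (fderiv ℝ F (3 * z)).det := by
        rw [det_complex_eq, det_complex_eq]; simp; ring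
      rw [hd3, e]
      positivity
    have e : F = (fun x => F (3 * x)) ∘ fun x => x / 3 := by
      ext x
      simp [mul_div_cancel₀]
    rw [e]
    exact hb3.comp ⟨fun x y h => by simpa using h, fun y => ⟨3 * y, by simp⟩⟩
  -- Bijectivity of `F` now shows that the untripled periods are translations too.
  have htrans : ∀ {c}, c ≠ 0 → Function.Periodic F₀ c → ∃ a, ∀ x, F (x + c) = F x + a := by
    intro c hc0 hc
    obtain ⟨χ, -, h⟩ := hmult hc
    obtain ⟨a, ha⟩ := exists_multiplier hF h
    exact ⟨a, eq_translation_of_injective hbij hc0 ha⟩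
  obtain ⟨a, ha⟩ := htrans one_ne_zero hF₀.periodic_one
  obtain ⟨b, hb⟩ := htrans Complex.I_ne_zero hF₀.periodic_I
  let e : ℂ ≃ₜ ℂ := (Equiv.ofBijective F hbij).toHomeomorphOfContinuousOpen hF.continuous
    (isLocalHomeomorph_of_det_pos hF hdet).isOpenMap
  have heF : ∀ x, e x = F x := fun x => rfl
  have hes : ContDiff ℝ ∞ e.symm :=
    e.contDiff_symm (f₀' := fun x => (fderiv ℝ F x).toContinuousLinearEquivOfDetNeZero (hdet x).ne')
      (fun x => by
        rw [ContinuousLinearMap.coe_toContinuousLinearEquivOfDetNeZero]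
        exact (hF.differentiable (by simp) x).hasFDerivAt) hF
  refine ⟨e, a, b, hF, hes, linearIndependent_of_det (period_det_pos hF hdet ha hb).ne', ha, hb, ?_⟩
  have hsm : ContDiff ℝ ∞ (F₀ ∘ e.symm) := hF₀.smooth.comp hes
  -- The derivative of the change from the flat coordinate to a conformal one is multiplication by a
  -- complex number `m⁻¹`, so the first order equations carry over.
  have key : ∀ z, ∃ U V ζ f, ∃ m : ℂ, e.symm z ∈ U ∧ IsConformalChart F₀ U V ζ f ∧ m ≠ 0 ∧
      ∀ v, fderiv ℝ (F₀ ∘ e.symm) z v = fderiv ℝ f (ζ (e.symm z)) (m⁻¹ * v) := by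
    intro z
    set x := e.symm z with hx
    obtain ⟨U, V, ζ, f, hxU, hc⟩ := hF₀.chart x
    have h0 := hc.fderiv_one_ne_zero hxU (hF₀.area_pos x)
    have hm0 : g x * (fderiv ℝ ζ x 1)⁻¹ ≠ 0 := mul_ne_zero (hg0 x) (inv_ne_zero h0)
    refine ⟨U, V, ζ, f, g x * (fderiv ℝ ζ x 1)⁻¹, hxU, hc, hm0, fun v => ?_⟩
    have hesd := hes.differentiable (by simp) z
    rw [fderiv_comp _ (hF₀.smooth.differentiable (by simp) _) hesd]
    change fderiv ℝ F₀ x (fderiv ℝ e.symm z v) = _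
    rw [hc.fderiv_eq hxU]
    congr 1
    have h1 : fderiv ℝ (F ∘ e.symm) z v = v := by
      have : F ∘ e.symm = id := funext fun w => e.apply_symm_apply w
      rw [this]; simp
    rw [fderiv_comp _ (hF.differentiable (by simp) _) hesd] at h1
    change fderiv ℝ F x (fderiv ℝ e.symm z v) = v at h1
    rw [hdF, hloc hc x hxU] at h1
    simp only [smul_apply, smul_eq_mul] at h1
    exact (eq_inv_mul_iff_mul_eq₀ hm0).mpr h1
  refine ⟨isOpen_univ, hsm.contDiffOn, fun z _ => ?_, fun z _ => ?_, fun z _ => ?_, fun z _ => ?_⟩ <;>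
  obtain ⟨U, V, ζ, f, m, hx, hc, hm0, hd⟩ := key z
  · rw [Function.comp_apply, hc.eq _ hx]
    exact hc.isSLMap.norm_eq_one _ (hc.mapsTo hx)
  · rw [Function.comp_apply, hc.eq _ hx, kahlerForm_eq, partialS, hd,
      hc.isSLMap.inner_fderiv (hc.mapsTo hx), Complex.zero_im]
  · rw [Function.comp_apply, hc.eq _ hx, partialS, partialT, hd, hd,
      hc.isSLMap.cross_fderiv (hc.mapsTo hx)]
    congr 1
    ring
  · intro v w hvw
    rw [hd, hd] at hvw
    exact mul_left_cancel₀ (inv_ne_zero hm0) (hc.isSLMap.injective _ (hc.mapsTo hx) hvw)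

/-! ### Riemann surfaces as real surfaces -/

theorem contDiffGroupoid_complex_le_real (n : WithTop ℕ∞) :
    contDiffGroupoid ω 𝓘(ℂ) ≤ contDiffGroupoid n 𝓘(ℝ, ℂ) := by
  refine groupoid_of_pregroupoid_le _ _ fun f s h => ?_
  have h' : ContDiffOn ℂ ω f s := by simpa [contDiffPregroupoid] using h
  have : ContDiffOn ℝ n f s := (h'.restrict_scalars ℝ).of_le le_top
  simpa [contDiffPregroupoid] using this

section Surface

variable {S : Type*} [TopologicalSpace S] [ChartedSpace ℂ S]

theorem isManifold_real [IsManifold 𝓘(ℂ) ω S] (n : WithTop ℕ∞) : IsManifold 𝓘(ℝ, ℂ) n S where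
  toHasGroupoid := hasGroupoid_of_le (G₁ := contDiffGroupoid ω 𝓘(ℂ)) inferInstance
    (contDiffGroupoid_complex_le_real n)

theorem holCoords_mem_maximalAtlas_real (n : WithTop ℕ∞) {e : OpenPartialHomeomorph S ℂ}
    (he : e ∈ holCoords (S := S)) : e ∈ IsManifold.maximalAtlas 𝓘(ℝ, ℂ) n S :=
  StructureGroupoid.maximalAtlas_mono (contDiffGroupoid_complex_le_real n) he

theorem exists_holCoords [IsManifold 𝓘(ℂ) ω S] (σ : S) :
    ∃ e ∈ holCoords (S := S), σ ∈ e.source :=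
  ⟨chartAt ℂ σ, IsManifold.chart_mem_maximalAtlas σ, mem_chart_source ℂ σ⟩

/-- A smooth covering of the surface `S` by the plane, with deck group the Gaussian integers. -/
structure IsTorusParam (q : ℂ → S) : Prop where
  smooth : ContMDiff 𝓘(ℝ, ℂ) 𝓘(ℝ, ℂ) ∞ q
  surjective : Function.Surjective q
  eq_iff : ∀ z w : ℂ, q z = q w ↔ ∃ m n : ℤ, z - w = m + n * Complex.I
  immersion : ∀ z, Function.Injective (mfderiv 𝓘(ℝ, ℂ) 𝓘(ℝ, ℂ) q z)

theorem circleExp_eq_iff (x y : ℝ) : Circle.exp (2 * Real.pi * x) = Circle.exp (2 * Real.pi * y) ↔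
    ∃ m : ℤ, x - y = m := by
  rw [Circle.exp_eq_exp]
  refine exists_congr fun m => ?_
  have := Real.pi_pos
  constructor
  · intro h
    have : 2 * Real.pi * (x - y - m) = 0 := by linarith
    have := (mul_eq_zero.1 this).resolve_left (by positivity)
    linarith
  · intro h
    rw [show x = y + m by linarith]; ring

theorem IsTorus.exists_isTorusParam (hS : IsTorus S) : ∃ q : ℂ → S, IsTorusParam q := by
  obtain ⟨D⟩ := hS
  let E : ℂ → Circle × Circle := fun z =>
    (Circle.exp (2 * Real.pi * z.re), Circle.exp (2 * Real.pi * z.im))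
  have hE : ContMDiff 𝓘(ℝ, ℂ) ((𝓡 1).prod (𝓡 1)) ∞ E := by
    refine ContMDiff.prodMk ?_ ?_
    · exact contMDiff_circleExp.comp
        (contDiff_const.mul Complex.reCLM.contDiff).contMDiff
    · exact contMDiff_circleExp.comp
        (contDiff_const.mul Complex.imCLM.contDiff).contMDiff
  have hq : ContMDiff 𝓘(ℝ, ℂ) 𝓘(ℝ, ℂ) ∞ (D.symm ∘ E) := D.symm.contMDiff.comp hE
  refine ⟨D.symm ∘ E, hq, ?_, ?_, ?_⟩
  · refine D.symm.surjective.comp fun ⟨a, b⟩ => ?_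
    obtain ⟨x, rfl⟩ := Circle.exp_surjective a
    obtain ⟨y, rfl⟩ := Circle.exp_surjective b
    have h := Real.pi_ne_zero
    refine ⟨⟨x / (2 * Real.pi), y / (2 * Real.pi)⟩, ?_⟩
    simp only [E]
    congr 2 <;> field_simp
  · intro z w
    change D.symm (E z) = D.symm (E w) ↔ _
    have hD : D.symm (E z) = D.symm (E w) ↔ E z = E w := D.symm.injective.eq_iff
    rw [hD, Prod.mk.injEq, circleExp_eq_iff, circleExp_eq_iff]
    constructor
    · rintro ⟨⟨m, hm⟩, n, hn⟩
      exact ⟨m, n, by apply Complex.ext <;> simp [hm, hn]⟩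
    · rintro ⟨m, n, h⟩
      have h1 := congrArg Complex.re h
      have h2 := congrArg Complex.im h
      simp at h1 h2
      exact ⟨⟨m, h1⟩, n, h2⟩
  · intro z
    -- Injectivity is tested after embedding the torus in `ℂ²`, where the parametrization is a pair
    -- of exponentials.
    let c : Circle → ℂ := (↑)
    have := finrank_real_complex_fact'
    have hc : ContMDiff (𝓡 1) 𝓘(ℝ, ℂ) ∞ c := contMDiff_coe_sphere
    let d : S → ℂ × ℂ := fun σ => (c (D σ).1, c (D σ).2)
    have hd : ContMDiff 𝓘(ℝ, ℂ) 𝓘(ℝ, ℂ × ℂ) ∞ d :=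
      (hc.comp (contMDiff_fst.comp D.contMDiff)).prodMk_space
        (hc.comp (contMDiff_snd.comp D.contMDiff))
    have hdq : d ∘ (D.symm ∘ E) = fun z : ℂ =>
        (Complex.exp ((2 * Real.pi * z.re : ℝ) * Complex.I),
          Complex.exp ((2 * Real.pi * z.im : ℝ) * Complex.I)) := by
      funext z
      simp [d, c, E, Circle.coe_exp]
    have hcomp := mfderiv_comp (I' := 𝓘(ℝ, ℂ)) z (hd.mdifferentiableAt (by simp) (x := (D.symm ∘ E) z))
      (hq.mdifferentiableAt (by simp) (x := z))
    have hinj : Function.Injective (mfderiv 𝓘(ℝ, ℂ) 𝓘(ℝ, ℂ × ℂ) (d ∘ (D.symm ∘ E)) z) := by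
      rw [hdq, mfderiv_eq_fderiv]
      have h1 : HasFDerivAt (fun z : ℂ => Complex.exp ((2 * Real.pi * z.re : ℝ) * Complex.I)) _ z :=
        ((Complex.ofRealCLM.hasFDerivAt.comp z
          (Complex.reCLM.hasFDerivAt.const_mul (2 * Real.pi))).mul_const Complex.I).cexp
      have h2 : HasFDerivAt (fun z : ℂ => Complex.exp ((2 * Real.pi * z.im : ℝ) * Complex.I)) _ z :=
        ((Complex.ofRealCLM.hasFDerivAt.comp z
          (Complex.imCLM.hasFDerivAt.const_mul (2 * Real.pi))).mul_const Complex.I).cexp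
      rw [(h1.prodMk h2).fderiv]
      change Function.Injective (ContinuousLinearMap.prod _ _ : ℂ →L[ℝ] ℂ × ℂ)
      refine (injective_iff_map_eq_zero _).2 fun v hv => ?_
      rw [Prod.ext_iff] at hv
      have hpi := Real.pi_ne_zero
      apply Complex.ext
      · simpa [Complex.exp_ne_zero, hpi] using hv.1
      · simpa [Complex.exp_ne_zero, hpi] using hv.2
    rw [hcomp] at hinj
    exact Function.Injective.of_comp hinj

variable [IsManifold 𝓘(ℂ) ω S] {e : OpenPartialHomeomorph S ℂ}

theorem contMDiffOn_holCoords (n : WithTop ℕ∞) (he : e ∈ holCoords (S := S)) :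
    ContMDiffOn 𝓘(ℝ, ℂ) 𝓘(ℝ, ℂ) n e e.source :=
  have := isManifold_real (S := S) n
  contMDiffOn_of_mem_maximalAtlas (holCoords_mem_maximalAtlas_real n he)

theorem contMDiffOn_holCoords_symm (n : WithTop ℕ∞) (he : e ∈ holCoords (S := S)) :
    ContMDiffOn 𝓘(ℝ, ℂ) 𝓘(ℝ, ℂ) n e.symm e.target :=
  have := isManifold_real (S := S) n
  contMDiffOn_symm_of_mem_maximalAtlas (holCoords_mem_maximalAtlas_real n he)

theorem mfderiv_holCoords_injective (he : e ∈ holCoords (S := S)) {σ : S} (hσ : σ ∈ e.source) :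
    Function.Injective (mfderiv 𝓘(ℝ, ℂ) 𝓘(ℝ, ℂ) e σ) := by
  have := isManifold_real (S := S) 1
  have h : e.MDifferentiable 𝓘(ℝ, ℂ) 𝓘(ℝ, ℂ) :=
    ⟨(contMDiffOn_holCoords 1 he).mdifferentiableOn one_ne_zero,
      (contMDiffOn_holCoords_symm 1 he).mdifferentiableOn one_ne_zero⟩
  exact h.mfderiv_injective hσ

theorem ContMDiff.contDiffOn_holCoords {F : Type*} [NormedAddCommGroup F] [NormedSpace ℝ F]
    {n : WithTop ℕ∞} {g : S → F} (hg : ContMDiff 𝓘(ℝ, ℂ) 𝓘(ℝ, F) n g)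
    (he : e ∈ holCoords (S := S)) : ContDiffOn ℝ n (g ∘ e.symm) e.target :=
  contMDiffOn_iff_contDiffOn.1 (hg.comp_contMDiffOn (contMDiffOn_holCoords_symm n he))

theorem mfderiv_holCoords_symm_injective (he : e ∈ holCoords (S := S)) {z : ℂ} (hz : z ∈ e.target) :
    Function.Injective (mfderiv 𝓘(ℝ, ℂ) 𝓘(ℝ, ℂ) e.symm z) := by
  have := isManifold_real (S := S) 1
  have h : e.symm.MDifferentiable 𝓘(ℝ, ℂ) 𝓘(ℝ, ℂ) :=
    ⟨(contMDiffOn_holCoords_symm 1 he).mdifferentiableOn one_ne_zero,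
      (contMDiffOn_holCoords 1 he).mdifferentiableOn one_ne_zero⟩
  exact h.mfderiv_injective hz

theorem IsSLCone.isSLMap {φ : S → C3} (hφ : IsSLCone φ) (he : e ∈ holCoords (S := S)) :
    IsSLMap (φ ∘ e.symm) e.target where
  isOpen := e.open_target
  smooth := (hφ.analytic.contDiffOn_holCoords he).of_le le_top
  norm_eq_one z _ := hφ.norm_eq_one _
  legendrian := hφ.legendrian e he
  special := hφ.special e he
  injective z hz := by
    rw [← mfderiv_eq_fderiv, mfderiv_comp (I' := 𝓘(ℝ, ℂ)) z
      (hφ.analytic.mdifferentiableAt (by simp))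
      (((contMDiffOn_holCoords_symm 1 he).contMDiffAt
        (e.open_target.mem_nhds hz)).mdifferentiableAt one_ne_zero)]
    exact (hφ.immersion _).comp (mfderiv_holCoords_symm_injective he hz)

end Surface

/-! ### Orientation and conformal charts of the parametrized torus -/

section Surface

variable {S : Type*} [TopologicalSpace S] [ChartedSpace ℂ S]

/-- Reverses the orientation of the parametrization when it disagrees with that of the Riemann
surface. -/
theorem IsTorusParam.comp_conj {q : ℂ → S} (hq : IsTorusParam q) :
    IsTorusParam (q ∘ Complex.conjCLE) where
  smooth := hq.smooth.comp Complex.conjCLE.contDiff.contMDiff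
  surjective := hq.surjective.comp Complex.conjCLE.surjective
  eq_iff z w := by
    simp only [Function.comp, hq.eq_iff]
    constructor
    all_goals
      rintro ⟨m, n, h⟩
      refine ⟨m, -n, ?_⟩
      have := congrArg conj h
      simpa using this
  immersion z := by
    rw [mfderiv_comp (I' := 𝓘(ℝ, ℂ)) z (hq.smooth.mdifferentiableAt (by simp))
      Complex.conjCLE.differentiableAt.mdifferentiableAt]
    refine (hq.immersion _).comp ?_
    rw [mfderiv_eq_fderiv, ContinuousLinearEquiv.fderiv]
    exact Complex.conjCLE.injective

theorem frameArea_comp_conj {F₀ : ℂ → C3} (h : ContDiff ℝ ∞ F₀) (y : ℂ) :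
    frameArea (F₀ ∘ Complex.conjCLE) y = -frameArea F₀ (conj y) := by
  have h1 (v : ℂ) : fderiv ℝ (F₀ ∘ Complex.conjCLE) y v = fderiv ℝ F₀ (conj y) (conj v) := by
    rw [fderiv_comp _ (h.differentiable (by simp) _) Complex.conjCLE.differentiableAt,
      ContinuousLinearEquiv.fderiv]
    rfl
  rw [frameArea, frameArea, partialS, partialT, partialS, partialT, h1, h1]
  simp [Function.comp]

theorem continuous_frameArea {F₀ : ℂ → C3} (h : ContDiff ℝ ∞ F₀) : Continuous (frameArea F₀) :=
  ((h.crossC3 (h.fderiv_apply_const 1)).inner ℝ (h.fderiv_apply_const Complex.I)).continuous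

variable [IsManifold 𝓘(ℂ) ω S] {e : OpenPartialHomeomorph S ℂ} {φ : S → C3} {q : ℂ → S}

theorem IsTorusParam.contMDiffOn_coord (hq : IsTorusParam q) (he : e ∈ holCoords (S := S)) :
    ContDiffOn ℝ ∞ (e ∘ q) (q ⁻¹' e.source) :=
  contMDiffOn_iff_contDiffOn.1 ((contMDiffOn_holCoords ∞ he).comp hq.smooth.contMDiffOn
    Set.Subset.rfl)

theorem IsTorusParam.injective_fderiv_coord (hq : IsTorusParam q) (he : e ∈ holCoords (S := S))
    {z : ℂ} (hz : q z ∈ e.source) : Function.Injective (fderiv ℝ (e ∘ q) z) := by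
  rw [← mfderiv_eq_fderiv, mfderiv_comp (I' := 𝓘(ℝ, ℂ)) z
    (((contMDiffOn_holCoords 1 he).contMDiffAt
        (e.open_source.mem_nhds hz)).mdifferentiableAt one_ne_zero)
    (hq.smooth.mdifferentiableAt (by simp))]
  exact (mfderiv_holCoords_injective he hz).comp (hq.immersion z)

theorem IsTorusParam.isConformalChart (hq : IsTorusParam q) (hφ : IsSLCone φ)
    (he : e ∈ holCoords (S := S)) :
    IsConformalChart (φ ∘ q) (q ⁻¹' e.source) e.target (e ∘ q) (φ ∘ e.symm) where
  isOpen := e.open_source.preimage hq.smooth.continuous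
  smooth := hq.contMDiffOn_coord he
  image_eq := by
    rw [Set.image_comp, Set.image_preimage_eq _ hq.surjective, e.image_source_eq_target]
  isSLMap := hφ.isSLMap he
  eq y hy := by simp [e.left_inv hy]

theorem IsTorusParam.frameArea_ne_zero (hq : IsTorusParam q) (hφ : IsSLCone φ) (y : ℂ) :
    frameArea (φ ∘ q) y ≠ 0 := by
  obtain ⟨e, he, hy⟩ := exists_holCoords (q y)
  have hc := hq.isConformalChart hφ he
  rw [hc.frameArea_eq hy]
  refine mul_ne_zero (hc.metricFactor_pos hy).ne' fun h0 => ?_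
  have := hq.injective_fderiv_coord he hy
  exact LinearMap.bot_lt_ker_of_det_eq_zero (f := (fderiv ℝ (e ∘ q) y).toLinearMap) h0 |>.ne'
    (LinearMap.ker_eq_bot.2 this)

/-- The area density is continuous and nowhere zero on the connected plane, so it has one sign, and
conjugation of the coordinate makes this sign positive. -/
theorem IsTorus.exists_isSLTorus (hS : IsTorus S) (hφ : IsSLCone φ) :
    ∃ q : ℂ → S, IsTorusParam q ∧ IsSLTorus (φ ∘ q) := by
  have key (q : ℂ → S) (hq : IsTorusParam q) (h : ∀ y, 0 < frameArea (φ ∘ q) y) :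
      IsSLTorus (φ ∘ q) := by
    refine ⟨contMDiff_iff_contDiff.1 ((hφ.analytic.of_le le_top).comp hq.smooth), fun x => ?_,
      fun x => ?_, h, fun x => ?_⟩
    · exact congrArg φ ((hq.eq_iff _ _).2 ⟨1, 0, by simp⟩)
    · exact congrArg φ ((hq.eq_iff _ _).2 ⟨0, 1, by simp⟩)
    · obtain ⟨e, he, hx⟩ := exists_holCoords (q x)
      exact ⟨_, _, _, _, hx, hq.isConformalChart hφ he⟩
  obtain ⟨q, hq⟩ := hS.exists_isTorusParam
  have hs : ContDiff ℝ ∞ (φ ∘ q) :=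
    contMDiff_iff_contDiff.1 ((hφ.analytic.of_le le_top).comp hq.smooth)
  have hne := hq.frameArea_ne_zero hφ
  have hcont := continuous_frameArea hs
  by_cases h0 : 0 < frameArea (φ ∘ q) 0
  · refine ⟨q, hq, key q hq fun y => ?_⟩
    by_contra! hy
    obtain ⟨x, hx⟩ := mem_range_of_exists_le_of_exists_ge hcont ⟨y, hy⟩ ⟨0, h0.le⟩
    exact hne x hx
  · refine ⟨_, hq.comp_conj, key _ hq.comp_conj fun y => ?_⟩
    rw [← Function.comp_assoc, frameArea_comp_conj hs, neg_pos]
    by_contra! hy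
    obtain ⟨x, hx⟩ := mem_range_of_exists_le_of_exists_ge hcont ⟨0, not_lt.1 h0⟩ ⟨_, hy⟩
    exact hne x hx

end Surface

/-! ### Uniformization of the base by a locally biholomorphic map -/

section Surface

variable {S : Type*} [TopologicalSpace S] [ChartedSpace ℂ S]

/-- A locally biholomorphic map from the plane, read in holomorphic coordinates. -/
structure IsHolImmersion (p : ℂ → S) : Prop where
  continuous : Continuous p
  differentiableAt : ∀ e ∈ holCoords (S := S), ∀ z, p z ∈ e.source → DifferentiableAt ℂ (e ∘ p) z
  deriv_ne_zero : ∀ e ∈ holCoords (S := S), ∀ z, p z ∈ e.source → deriv (e ∘ p) z ≠ 0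

namespace IsHolImmersion

variable {p : ℂ → S} (hp : IsHolImmersion p) {e : OpenPartialHomeomorph S ℂ}
include hp

theorem contDiffAt (he : e ∈ holCoords (S := S)) {z : ℂ} (hz : p z ∈ e.source) :
    ContDiffAt ℂ ω (e ∘ p) z := by
  have ho : IsOpen (p ⁻¹' e.source) := e.open_source.preimage hp.continuous
  have : DifferentiableOn ℂ (e ∘ p) (p ⁻¹' e.source) := fun w hw =>
    (hp.differentiableAt e he w hw).differentiableWithinAt
  exact (this.contDiffOn ho).contDiffAt (ho.mem_nhds hz)

theorem eventuallyEq {z : ℂ} (hz : p z ∈ e.source) : p =ᶠ[nhds z] e.symm ∘ (e ∘ p) := by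
  filter_upwards [hp.continuous.continuousAt.preimage_mem_nhds (e.open_source.mem_nhds hz)]
    with w hw
  exact (e.left_inv hw).symm

variable [IsManifold 𝓘(ℂ) ω S]

theorem contMDiff : ContMDiff 𝓘(ℂ) 𝓘(ℂ) ω p := by
  intro z
  obtain ⟨e, he, hz⟩ := exists_holCoords (p z)
  refine ContMDiffAt.congr_of_eventuallyEq ?_ (hp.eventuallyEq hz)
  refine ContMDiffAt.comp (I' := 𝓘(ℂ)) z ?_ (hp.contDiffAt he hz).contMDiffAt
  exact (contMDiffOn_symm_of_mem_maximalAtlas he).contMDiffAt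
    (e.open_target.mem_nhds (e.map_source hz))

theorem map_nhds_eq (z : ℂ) : Filter.map p (nhds z) = nhds (p z) := by
  obtain ⟨e, he, hz⟩ := exists_holCoords (p z)
  have h1 : Filter.map (e ∘ p) (nhds z) = nhds (e (p z)) :=
    (((hp.contDiffAt he hz).hasStrictDerivAt (by simp))).map_nhds_eq (hp.deriv_ne_zero e he z hz)
  rw [Filter.map_congr (hp.eventuallyEq hz), ← Filter.map_map, h1,
    e.symm.map_nhds_eq (e.map_source hz), e.left_inv hz]

theorem isOpenMap : IsOpenMap p := IsOpenMap.of_nhds_le fun z => (hp.map_nhds_eq z).ge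

theorem exists_injOn (z : ℂ) : ∃ U, IsOpen U ∧ z ∈ U ∧ Set.InjOn p U := by
  obtain ⟨e, he, hz⟩ := exists_holCoords (p z)
  have hs := (hp.contDiffAt he hz).hasStrictDerivAt (by simp)
  let G := hs.localInverse
  have hl := hs.eventually_left_inverse (hp.deriv_ne_zero e he z hz)
  obtain ⟨U, hU, hUo, hzU⟩ := eventually_nhds_iff.1 hl
  refine ⟨U, hUo, hzU, fun x hx y hy hxy => ?_⟩
  rw [← hU x hx, ← hU y hy, Function.comp, Function.comp, hxy]

/-- The restriction of `p` to an open set where it is injective. -/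
noncomputable def localHomeo {U : Set ℂ} (hU : IsOpen U) (hinj : Set.InjOn p U) :
    OpenPartialHomeomorph ℂ S :=
  OpenPartialHomeomorph.ofContinuousOpen (hinj.toPartialEquiv p U) hp.continuous.continuousOn
    hp.isOpenMap hU

/-- Local inverses of `p` are holomorphic by the complex inverse function theorem, so they lie in
the maximal atlas. Near every point `p⁻¹` can then be used as the coordinate. -/
theorem localHomeo_symm_mem {U : Set ℂ} (hU : IsOpen U) (hinj : Set.InjOn p U) :
    (hp.localHomeo hU hinj).symm ∈ holCoords (S := S) := by
  set P := hp.localHomeo hU hinj with hP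
  have hcoe : ⇑P = p := rfl
  refine OpenPartialHomeomorph.mem_maximalAtlas_of_contMDiffOn _ ?_ ?_
  · intro σ hσ
    have hσ' : σ ∈ P.target := hσ
    have hpz : p (P.symm σ) = σ := P.right_inv hσ'
    obtain ⟨e, he, hσe⟩ := exists_holCoords σ
    have hz : p (P.symm σ) ∈ e.source := by rwa [hpz]
    let H := P ≫ₕ e
    have hH : ⇑H = e ∘ p := rfl
    have hHs : H.symm (e σ) = P.symm σ := by simp [H, e.left_inv hσe]
    have hHt : e σ ∈ H.target := by
      have : P.symm σ ∈ H.source := by simpa [H, P.map_target hσ', hcoe] using hz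
      have := H.map_source this
      rwa [hH, Function.comp, hpz] at this
    have h1 : ContDiffAt ℂ ω H.symm (e σ) := by
      refine H.contDiffAt_symm_deriv (hp.deriv_ne_zero e he _ hz) hHt ?_ ?_
      · rw [hHs, hH]
        exact (hp.differentiableAt e he _ hz).hasDerivAt
      · rw [hHs, hH]
        exact hp.contDiffAt he hz
    have h2 : ContMDiffAt 𝓘(ℂ) 𝓘(ℂ) ω e σ :=
      (contMDiffOn_of_mem_maximalAtlas he).contMDiffAt (e.open_source.mem_nhds hσe)
    have h3 : P.symm =ᶠ[nhds σ] H.symm ∘ e := by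
      filter_upwards [e.open_source.mem_nhds hσe] with τ hτ
      simp [H, e.left_inv hτ]
    exact ((h1.contMDiffAt.comp σ h2).congr_of_eventuallyEq h3).contMDiffWithinAt
  · exact hp.contMDiff.contMDiffOn

theorem exists_chart (z : ℂ) : ∃ e ∈ holCoords (S := S), z ∈ e.target ∧ ⇑e.symm = p := by
  obtain ⟨U, hU, hz, hinj⟩ := hp.exists_injOn z
  exact ⟨_, hp.localHomeo_symm_mem hU hinj, hz, rfl⟩

end IsHolImmersion

/-- A uniformization of the base of a special Lagrangian cone. -/
structure IsSLUniformization (φ : S → C3) (a b : ℂ) (p : ℂ → S) : Prop where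
  isLattice : IsLatticeUniformization a b p
  isHolImmersion : IsHolImmersion p
  isSLMap : IsSLMap (φ ∘ p) Set.univ

variable [IsManifold 𝓘(ℂ) ω S] {φ : S → C3}

theorem exists_isSLUniformization (hS : IsTorus S) (hφ : IsSLCone φ) :
    ∃ (a b : ℂ) (p : ℂ → S), IsSLUniformization φ a b p := by
  obtain ⟨q, hq, hT⟩ := hS.exists_isSLTorus hφ
  obtain ⟨F, a, b, hF, hF', hab, h1, hI, hsl⟩ := hT.exists_uniformization
  have hpc : Continuous (q ∘ F.symm) := hq.smooth.continuous.comp F.symm.continuous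
  have hloc {e : OpenPartialHomeomorph S ℂ} (he : e ∈ holCoords (S := S)) {z : ℂ}
      (hz : (q ∘ F.symm) z ∈ e.source) : DifferentiableAt ℝ (e ∘ (q ∘ F.symm)) z ∧
        Function.Injective (fderiv ℝ (e ∘ (q ∘ F.symm)) z) := by
    have d1 : DifferentiableAt ℝ (e ∘ q) (F.symm z) :=
      (hq.contMDiffOn_coord he).differentiableAt_of_isOpen
        (e.open_source.preimage hq.smooth.continuous) hz
    have d2 : DifferentiableAt ℝ F.symm z := hF'.differentiable (by simp) z
    have d3 : DifferentiableAt ℝ F (F.symm z) := hF.differentiable (by simp) _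
    refine ⟨d1.comp z d2, ?_⟩
    rw [← Function.comp_assoc, fderiv_comp _ d1 d2]
    refine (hq.injective_fderiv_coord he hz).comp ?_
    have : (fderiv ℝ F (F.symm z)).comp (fderiv ℝ F.symm z) = ContinuousLinearMap.id ℝ ℂ := by
      rw [← fderiv_comp z d3 d2, F.self_comp_symm, fderiv_id]
    exact Function.LeftInverse.injective (g := fderiv ℝ F (F.symm z)) fun v =>
      DFunLike.congr_fun this v
  -- The same immersion is special Legendrian in the flat coordinate and in the chart `e`, so
  -- `special_comp` makes the change between them holomorphic.
  have hhol : ∀ e ∈ holCoords (S := S), ∀ z, (q ∘ F.symm) z ∈ e.source →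
      DifferentiableAt ℂ (e ∘ (q ∘ F.symm)) z := by
    intro e he z hz
    have hs := hφ.isSLMap he
    refine hs.special_comp (e.map_source hz) (hloc he hz).1 ?_
    have heq : (φ ∘ e.symm) ∘ (e ∘ (q ∘ F.symm)) =ᶠ[nhds z] (φ ∘ q) ∘ F.symm := by
      filter_upwards [hpc.continuousAt.preimage_mem_nhds (e.open_source.mem_nhds hz)] with w hw
      exact congrArg φ (e.left_inv hw)
    rw [partialT, partialS, heq.fderiv_eq]
    have := hsl.special z (Set.mem_univ z)
    rw [partialT, partialS] at this
    convert this using 2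
    exact congrArg φ (e.left_inv hz)
  have himm : IsHolImmersion (q ∘ F.symm) := by
    refine ⟨hpc, hhol, fun e he z hz h0 => ?_⟩
    have h2 := (hhol e he z hz).hasDerivAt
    rw [h0] at h2
    have h3 := h2.hasFDerivAt.restrictScalars ℝ
    have h4 := (hloc he hz).2
    rw [h3.fderiv] at h4
    have := @h4 1 0 (by simp)
    exact one_ne_zero this
  refine ⟨a, b, q ∘ F.symm, ⟨hab, himm.contMDiff.mdifferentiable (by simp),
    hq.surjective.comp F.symm.surjective, fun z w => ?_⟩, himm, hsl⟩
  -- `F` conjugates the Gaussian translations, the deck group of `q`, to the translations by `ℤ a +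
  -- ℤ b`.
  have hmn (m n : ℤ) (x : ℂ) : F (x + (m + n * Complex.I)) = F x + (m * a + n * b) := by
    have A : ∀ (m : ℤ) (x : ℂ), F (x + m) = F x + m * a := by
      intro m
      induction m using Int.induction_on with
      | zero => simp
      | succ k ih => intro x; push_cast; rw [← add_assoc, h1, ← Int.cast_natCast, ih]; ring
      | pred k ih =>
        intro x
        have := h1 (x + ((-k - 1 : ℤ) : ℂ))
        rw [show x + ((-k - 1 : ℤ) : ℂ) + 1 = x + ((-k : ℤ) : ℂ) by push_cast; ring, ih] at this
        push_cast at this ⊢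
        linear_combination -this
    have B : ∀ (m : ℤ) (x : ℂ), F (x + m * Complex.I) = F x + m * b := by
      intro m
      induction m using Int.induction_on with
      | zero => simp
      | succ k ih =>
        intro x; push_cast; rw [add_mul, one_mul, ← add_assoc, hI, ← Int.cast_natCast, ih]; ring
      | pred k ih =>
        intro x
        have := hI (x + ((-k - 1 : ℤ) : ℂ) * Complex.I)
        rw [show x + ((-k - 1 : ℤ) : ℂ) * Complex.I + Complex.I = x + ((-k : ℤ) : ℂ) * Complex.I by
          push_cast; ring, ih] at this
        push_cast at this ⊢
        linear_combination -this
    rw [← add_assoc, B, A]; ring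
  rw [Function.comp, Function.comp, hq.eq_iff]
  refine exists_congr fun m => exists_congr fun n => ?_
  have := hmn m n (F.symm w)
  rw [F.apply_symm_apply] at this
  constructor
  · intro h
    rw [show F.symm w + (m + n * Complex.I) = F.symm z by rw [← h]; ring, F.apply_symm_apply] at this
    rw [this]; ring
  · intro h
    have h' : F (F.symm w + (m + n * Complex.I)) = z := by rw [this, ← h]; ring
    rw [← h', F.symm_apply_apply]; ring

end Surface

/-! ### The ruled deformations over the uniformized base -/

section Surface

variable {S : Type*} [TopologicalSpace S] [ChartedSpace ℂ S]

theorem IsTorus.compactSpace (hS : IsTorus S) : CompactSpace S := by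
  obtain ⟨D⟩ := hS
  exact D.toHomeomorph.symm.compactSpace

variable {φ : S → C3} {a b : ℂ} {p : ℂ → S}

theorem IsSLUniformization.smooth (h : IsSLUniformization φ a b p) : ContDiff ℝ ∞ (φ ∘ p) :=
  contDiffOn_univ.1 h.isSLMap.smooth

/-- Lattice translations have derivative the identity, so derivatives in constant directions descend
to the torus. This makes `ψ` well defined. -/
theorem IsSLUniformization.factorsThrough_fderiv (h : IsSLUniformization φ a b p) {F : Type*} [NormedAddCommGroup F] [NormedSpace ℝ F] {g : ℂ → F}
    (hg : g.FactorsThrough p) : (fderiv ℝ g).FactorsThrough p := by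
  intro z w hzw
  obtain ⟨m, n, hmn⟩ := (h.isLattice.eq_iff z w).1 hzw
  have : (fun x => g (x + (w - z))) = g := by
    funext x
    exact hg ((h.isLattice.eq_iff _ _).2 ⟨-m, -n, by push_cast; linear_combination -hmn⟩)
  calc fderiv ℝ g z = fderiv ℝ (fun x => g (x + (w - z))) z := by rw [this]
    _ = fderiv ℝ g w := by rw [fderiv_comp_add_right, add_sub_cancel]

theorem IsSLUniformization.extend_apply (h : IsSLUniformization φ a b p) (w z : ℂ) :
    Function.extend p (fun z => fderiv ℝ (φ ∘ p) z w) 0 (p z) = fderiv ℝ (φ ∘ p) z w :=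
  Function.FactorsThrough.extend_apply
    (fun _ _ hxy => DFunLike.congr_fun (h.factorsThrough_fderiv (fun _ _ => congrArg φ) hxy) w) _ _

variable [IsManifold 𝓘(ℂ) ω S]

theorem IsHolImmersion.contMDiff_real (hp : IsHolImmersion p) (n : WithTop ℕ∞) :
    ContMDiff 𝓘(ℝ, ℂ) 𝓘(ℝ, ℂ) n p := by
  intro z
  obtain ⟨e, he, hz, rfl⟩ := hp.exists_chart z
  exact (contMDiffOn_holCoords_symm n he).contMDiffAt (e.open_target.mem_nhds hz)

theorem IsHolImmersion.contMDiff_of_comp (hp : IsHolImmersion p) (hs : Function.Surjective p)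
    {F : Type*} [NormedAddCommGroup F] [NormedSpace ℝ F] {n : WithTop ℕ∞} {g : S → F}
    (hg : ContDiff ℝ n (g ∘ p)) : ContMDiff 𝓘(ℝ, ℂ) 𝓘(ℝ, F) n g := by
  intro σ
  obtain ⟨z, rfl⟩ := hs σ
  obtain ⟨e, he, hz, rfl⟩ := hp.exists_chart z
  have h1 := (contMDiffOn_holCoords n he).contMDiffAt (e.open_source.mem_nhds (e.map_target hz))
  refine ((hg.contMDiff.contMDiffAt (x := e (e.symm z))).comp _ h1).congr_of_eventuallyEq ?_
  filter_upwards [e.open_source.mem_nhds (e.map_target hz)] with τ hτ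
  simp [e.left_inv hτ]

namespace IsSLUniformization

variable (h : IsSLUniformization φ a b p)
include h

theorem analytic (hφ : IsSLCone φ) : ContDiff ℝ ω (φ ∘ p) :=
  contMDiff_iff_contDiff.1 (hφ.analytic.comp (h.isHolImmersion.contMDiff_real ω))

theorem exists_compact (hS : IsTorus S) : ∃ K : Set ℂ, IsCompact K ∧ p '' K = Set.univ := by
  have := hS.compactSpace
  have hcov : (Set.univ : Set S) ⊆ ⋃ n : ℕ, p '' Metric.ball 0 n := by
    intro σ _
    obtain ⟨z, rfl⟩ := h.isLattice.surjective σ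
    obtain ⟨n, hn⟩ := exists_nat_gt ‖z‖
    exact Set.mem_iUnion.2 ⟨n, z, by simpa using hn, rfl⟩
  obtain ⟨n, hn⟩ := isCompact_univ.elim_directed_cover _
    (fun n : ℕ => h.isHolImmersion.isOpenMap _ Metric.isOpen_ball) hcov
    (Monotone.directed_le fun m n hmn =>
      Set.image_mono (Metric.ball_subset_ball (by exact_mod_cast hmn)))
  exact ⟨Metric.closedBall 0 n, isCompact_closedBall _ _,
    Set.univ_subset_iff.1 (hn.trans (Set.image_mono Metric.ball_subset_closedBall))⟩

/-- The deformation of the cone along the translation-invariant vector field `w`. -/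
noncomputable def ruledFold (w : ℂ) : RuledFold S where
  φ := φ
  ψ := Function.extend p (fun z => fderiv ℝ (φ ∘ p) z w) 0
  smooth_φ := h.isHolImmersion.contMDiff_of_comp h.isLattice.surjective h.smooth
  smooth_ψ := h.isHolImmersion.contMDiff_of_comp h.isLattice.surjective <| by
    rw [show Function.extend p (fun z => fderiv ℝ (φ ∘ p) z w) 0 ∘ p = fun z => fderiv ℝ (φ ∘ p) z w
      from funext (h.extend_apply w)]
    exact h.smooth.fderiv_apply_const w
  norm_φ σ := by
    obtain ⟨z, rfl⟩ := h.isLattice.surjective σ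
    exact h.isSLMap.norm_eq_one z (Set.mem_univ z)
  orthogonal σ := by
    obtain ⟨z, rfl⟩ := h.isLattice.surjective σ
    rw [h.extend_apply, real_inner_C3]
    exact (congrArg Complex.re (h.isSLMap.inner_fderiv (Set.mem_univ z) w)).trans Complex.zero_re

/-- The immersion of the ruled 3-fold in the coordinate of the universal cover. -/
noncomputable def _root_.ruledMap (f : ℂ → C3) (w : ℂ) (x : ℂ × ℝ) : C3 :=
  x.2 • f x.1 + fderiv ℝ f x.1 w

theorem ruledFold_point (w : ℂ) (x : ℂ × ℝ) :
    (h.ruledFold w).point (p x.1, x.2) = ruledMap (φ ∘ p) w x := by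
  change x.2 • φ (p x.1) + _ = _
  exact congrArg _ (h.extend_apply w x.1)

theorem asymptoticCone_eq (w : ℂ) : (h.ruledFold w).asymptoticCone = coneSet φ := by
  ext x
  simp only [RuledFold.asymptoticCone, RuledFold.line, AffineSubspace.direction_mk', coneSet,
    Submodule.mem_span_singleton, Set.mem_ofPred_eq, Set.mem_range, conePoint, Prod.exists]
  rfl

end IsSLUniformization

end Surface

/-! ### Calibrated frames -/

theorem holVolForm_eq (x y z : C3) : holVolForm ![x, y, z] = inner ℂ (crossC3 x y) z := by
  rw [holVolForm, Matrix.det_fin_three, inner_C3]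
  simp [crossC3]
  ring

theorem det_gram_three (x y z : C3) : Matrix.det (Matrix.gram ℝ ![x, y, z]) =
    inner ℝ x x * inner ℝ y y * inner ℝ z z + 2 * inner ℝ x y * inner ℝ y z * inner ℝ x z
      - inner ℝ x x * inner ℝ y z ^ 2 - inner ℝ y y * inner ℝ x z ^ 2
      - inner ℝ z z * inner ℝ x y ^ 2 := by
  rw [Matrix.det_fin_three]
  simp only [Matrix.gram, Matrix.of_apply, Matrix.cons_val_zero, Matrix.cons_val_one,
    Matrix.cons_val]
  rw [real_inner_comm x y, real_inner_comm x z, real_inner_comm y z]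
  ring

/-- For `C = x × A`, both sides equal `(α² + β²)‖C‖²`, and the summand `g • x` drops out. The real
numbers `α`, `β` allow for a holomorphic change of coordinate with derivative `α + iβ`. -/
theorem isCalibratedFrame_of_eq {x A B : C3} {g : ℝ} (hx : ‖x‖ = 1)
    (hA : (inner ℂ x A : ℂ).im = 0) (hB : B = crossC3 x A + g • x) (α β : ℝ) :
    IsCalibratedFrame ![x, α • A + β • B, -β • A + α • B] := by
  have hxx : inner ℂ x x = (1 : ℂ) := by
    rw [inner_self_eq_norm_sq_to_K, hx]; simp
  have hAx : (inner ℂ A x : ℂ) = inner ℂ x A := by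
    rw [← inner_conj_symm]; exact Complex.conj_eq_iff_im.2 hA
  set m : ℝ := (inner ℂ A A : ℂ).re with hm
  have hAA : (inner ℂ A A : ℂ) = m := by
    apply Complex.ext
    · simp [hm]
    · exact inner_self_im (𝕜 := ℂ) A
  set a : ℝ := (inner ℂ x A : ℂ).re with ha
  have hxA : (inner ℂ x A : ℂ) = a := by
    apply Complex.ext <;> simp [ha, hA]
  set C := crossC3 x A with hC
  have hxC : (inner ℂ x C : ℂ) = 0 := inner_crossC3_left _ _
  have hAC : (inner ℂ A C : ℂ) = 0 := inner_crossC3_right _ _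
  have hCx : (inner ℂ C x : ℂ) = 0 := by rw [← inner_conj_symm, hxC, map_zero]
  have hCA : (inner ℂ C A : ℂ) = 0 := by rw [← inner_conj_symm, hAC, map_zero]
  have hCC : (inner ℂ C C : ℂ) = (m - a ^ 2 : ℝ) := by
    rw [hC, inner_crossC3_crossC3, hxx, hAx, hxA, hAA]; push_cast; ring
  have hpos : 0 ≤ m - a ^ 2 := by
    have := inner_self_nonneg (𝕜 := ℂ) (x := C)
    rw [hCC] at this
    exact this
  have hCross : crossC3 x (α • A + β • (C + g • x)) = α • C + β • (a • x - A) := by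
    rw [crossC3_add_right, crossC3_real_smul_right, crossC3_real_smul_right, crossC3_add_right,
      crossC3_real_smul_right, crossC3_self, hC, crossC3_crossC3_left, hxx, hxA]
    simp
  have hdet : Matrix.det (Matrix.gram ℝ ![x, α • A + β • B, -β • A + α • B]) =
      ((α ^ 2 + β ^ 2) * (m - a ^ 2)) ^ 2 := by
    rw [det_gram_three, hB]
    simp only [real_inner_C3, inner_add_left, inner_add_right, inner_smul_left_eq_smul,
      inner_smul_right_eq_smul, hxx, hxA, hAx, hAA, hxC, hAC, hCx, hCA, hCC]
    simp only [Complex.one_re, Complex.zero_re, Complex.ofReal_re]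
    ring
  rw [IsCalibratedFrame, hdet, Real.sqrt_sq (by positivity), holVolForm_eq, hB, hCross]
  simp only [inner_add_left, inner_sub_left, inner_add_right, inner_smul_left_eq_smul,
    inner_smul_right_eq_smul, hxx, hxA, hAx, hAA, hxC, hAC, hCx, hCA, hCC, Complex.real_smul]
  simp only [← Complex.ofReal_one, ← Complex.ofReal_zero, ← Complex.ofReal_mul,
      ← Complex.ofReal_add, ← Complex.ofReal_sub, Complex.ofReal_re]
  ring

/-- The frame `(x, A, x × A + g x)` is degenerate only if `x × A = 0`. -/
theorem eq_zero_of_frame {x A B : C3} {g : ℝ} (hB : B = crossC3 x A + g • x)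
    (hne : crossC3 x A ≠ 0) {c α β : ℝ} (h0 : c • x + (α • A + β • B) = 0) :
    c = 0 ∧ α = 0 ∧ β = 0 := by
  have h1 := congrArg (fun y => (inner ℂ (crossC3 x A) y : ℂ)) h0
  have e1 : (inner ℂ (crossC3 x A) x : ℂ) = 0 := by
    rw [← inner_conj_symm, inner_crossC3_left, map_zero]
  have e2 : (inner ℂ (crossC3 x A) A : ℂ) = 0 := by
    rw [← inner_conj_symm, inner_crossC3_right, map_zero]
  simp [hB, inner_smul_right_eq_smul, e1, e2, hne] at h1
  subst h1
  have h2 := congrArg (crossC3 x) h0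
  rw [crossC3_add_right, crossC3_add_right, crossC3_real_smul_right, crossC3_real_smul_right,
    crossC3_real_smul_right, crossC3_self] at h2
  have h3 : α = 0 := by
    have : crossC3 x (0 : C3) = 0 := by simpa using crossC3_real_smul_right (0 : ℝ) x 0
    simpa [this, hne] using h2
  subst h3
  have h4 : x ≠ 0 := by
    rintro rfl
    apply hne
    simpa using crossC3_real_smul_left (0 : ℝ) 0 A
  simpa [h4] using h0

/-! ### The tangent frame of a ruled deformation -/

namespace IsSLMap

variable {f : ℂ → C3} (hf : IsSLMap f Set.univ) (w : ℂ) (z : ℂ) (r : ℝ)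
include hf

theorem contDiff : ContDiff ℝ ∞ f := contDiffOn_univ.1 hf.smooth

theorem contDiff_ruledMap : ContDiff ℝ ∞ (ruledMap f w) :=
  (contDiff_snd.smul (hf.contDiff.comp contDiff_fst)).add
    ((hf.contDiff.fderiv_apply_const w).comp contDiff_fst)

theorem fderiv_ruledMap_slice (v : ℂ) : fderiv ℝ (fun z => ruledMap f w (z, r)) z v =
    r • fderiv ℝ f z v + (w.re • fderiv ℝ (partialS f) z v + w.im • fderiv ℝ (partialT f) z v) := by
  have h1 : (fun z => ruledMap f w (z, r)) =
      fun z => r • f z + (w.re • partialS f z + w.im • partialT f z) := by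
    funext z
    rw [ruledMap, fderiv_complex_apply]; rfl
  have hd := hf.differentiableAt (Set.mem_univ z)
  have hS := hf.differentiableAt_partialS (Set.mem_univ z)
  have hT := hf.differentiableAt_partialT (Set.mem_univ z)
  rw [h1, fderiv_fun_add (hd.fun_const_smul r)
    ((hS.fun_const_smul w.re).fun_add (hT.fun_const_smul w.im)),
    fderiv_fun_add (hS.fun_const_smul w.re) (hT.fun_const_smul w.im),
    fderiv_fun_const_smul hd, fderiv_fun_const_smul hS, fderiv_fun_const_smul hT]
  rfl

/-- The field `ψ = df(w)` is the variation of `f` under translation, so `ψ_t = f × ψ_s + ψ × f_s`.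
Since `ψ` is tangent, `ψ × f_s` is the stated multiple of `f`. -/
theorem ruledMap_partialT_eq : partialT (fun z => ruledMap f w (z, r)) z =
    crossC3 (f z) (partialS (fun z => ruledMap f w (z, r)) z)
      + (-(w.im * (inner ℂ (partialS f z) (partialS f z) : ℂ).re)) • f z := by
  have hz := Set.mem_univ z
  have hρ : (inner ℂ (partialS f z) (partialS f z) : ℂ) =
      ((inner ℂ (partialS f z) (partialS f z) : ℂ).re : ℝ) := by
    apply Complex.ext
    · rfl
    · exact inner_self_im (𝕜 := ℂ) (partialS f z)
  rw [partialT, partialS, hf.fderiv_ruledMap_slice, hf.fderiv_ruledMap_slice]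
  change r • partialT f z + (w.re • partialT (partialS f) z + w.im • partialT (partialT f) z) =
    crossC3 (f z) (r • partialS f z +
      (w.re • partialS (partialS f) z + w.im • partialS (partialT f) z)) + _
  simp only [crossC3_add_right, crossC3_real_smul_right]
  rw [← hf.special z hz, hf.partialT_partialS hz, hf.partialT_partialT hz,
    ← hf.partialS_partialT hz]
  nth_rw 3 [hf.partialS_partialT hz]
  rw [crossC3_crossC3_left, hf.inner_self hz, hf.inner_partialS_partialS hz, hρ]
  module

theorem inner_partialS_ruledMap_im :
    (inner ℂ (f z) (partialS (fun z => ruledMap f w (z, r)) z) : ℂ).im = 0 := by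
  have hz := Set.mem_univ z
  have hρ : (inner ℂ (partialS f z) (partialS f z) : ℂ).im = 0 := inner_self_im (𝕜 := ℂ) (partialS f z)
  rw [partialS, hf.fderiv_ruledMap_slice]
  change (inner ℂ (f z) (r • partialS f z +
      (w.re • partialS (partialS f) z + w.im • partialS (partialT f) z)) : ℂ).im = 0
  simp [inner_smul_right_eq_smul, hf.inner_partialS hz,
    hf.inner_partialS_partialS hz, hf.inner_partialS_partialT' hz, hρ,
    -inner_self_eq_norm_sq_to_K]

/-- The map is an immersion wherever this vector is nonzero. Being affine in `r` with slope `f_t ≠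
0`, the vector vanishes at most once on each ruling line, and never for large `|r|` over a compact
set. -/
theorem cross_partialS_ruledMap :
    crossC3 (f z) (partialS (fun z => ruledMap f w (z, r)) z) = r • partialT f z +
      crossC3 (f z) (partialS (fun z => ruledMap f w (z, 0)) z) := by
  rw [partialS, partialS, hf.fderiv_ruledMap_slice, hf.fderiv_ruledMap_slice, crossC3_add_right,
    zero_smul, zero_add, crossC3_real_smul_right, hf.special z (Set.mem_univ z), partialS]

theorem fderiv_ruledMap (v : ℂ × ℝ) : fderiv ℝ (ruledMap f w) (z, r) v =
    v.2 • f z + (v.1.re • partialS (fun z => ruledMap f w (z, r)) z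
      + v.1.im • partialT (fun z => ruledMap f w (z, r)) z) := by
  have hd := (hf.contDiff_ruledMap w).differentiable (by simp) (z, r)
  have h1 : HasFDerivAt (fun z' => ruledMap f w (z', r))
      ((fderiv ℝ (ruledMap f w) (z, r)).comp (ContinuousLinearMap.inl ℝ ℂ ℝ)) z :=
    HasFDerivAt.comp (f := fun z' : ℂ => (z', r)) z hd.hasFDerivAt (hasFDerivAt_prodMk_left z r)
  have h2 : HasFDerivAt (fun r' => ruledMap f w (z, r'))
      ((fderiv ℝ (ruledMap f w) (z, r)).comp (ContinuousLinearMap.inr ℝ ℂ ℝ)) r :=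
    HasFDerivAt.comp (f := fun r' : ℝ => (z, r')) r hd.hasFDerivAt (hasFDerivAt_prodMk_right z r)
  have h3 : HasFDerivAt (fun r' => ruledMap f w (z, r'))
      ((ContinuousLinearMap.id ℝ ℝ).smulRight (f z)) r := by
    change HasFDerivAt (fun r' : ℝ => r' • f z + fderiv ℝ f z w) _ r
    exact ((hasFDerivAt_id (𝕜 := ℝ) r).smul_const (f z)).add_const _
  have e2 := DFunLike.congr_fun (h2.unique h3) v.2
  have e1 := fderiv_complex_apply (fderiv ℝ (fun z' => ruledMap f w (z', r)) z) v.1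
  have hv : v = ContinuousLinearMap.inl ℝ ℂ ℝ v.1 + ContinuousLinearMap.inr ℝ ℂ ℝ v.2 := by simp
  conv_lhs => rw [hv, map_add]
  rw [h1.fderiv] at e1
  rw [partialS, partialT, h1.fderiv]
  rw [← e1, add_comm]
  congr 1

theorem injective_fderiv_ruledMap
    (h : crossC3 (f z) (partialS (fun z => ruledMap f w (z, r)) z) ≠ 0) :
    Function.Injective (fderiv ℝ (ruledMap f w) (z, r)) := by
  refine (injective_iff_map_eq_zero _).2 fun v hv => ?_
  rw [hf.fderiv_ruledMap] at hv
  obtain ⟨h1, h2, h3⟩ := eq_zero_of_frame (hf.ruledMap_partialT_eq w z r) h hv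
  exact Prod.ext (Complex.ext h2 h3) h1

end IsSLMap

/-! ### Nonsingular points and calibration of the deformations -/

section Surface

variable {S : Type*} [TopologicalSpace S] [ChartedSpace ℂ S] [IsManifold 𝓘(ℂ) ω S]
  {φ : S → C3} {a b : ℂ} {p : ℂ → S} (h : IsSLUniformization φ a b p) (w : ℂ)
include h

namespace IsSLUniformization

theorem nonsingularAt_of_injective {z : ℂ} {r : ℝ}
    (hi : Function.Injective (fderiv ℝ (ruledMap (φ ∘ p) w) (z, r))) :
    (h.ruledFold w).NonsingularAt (p z, r) := by
  obtain ⟨e, he, hz, hep⟩ := h.isHolImmersion.exists_chart z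
  have hσ : p z ∈ e.source := by rw [← hep]; exact e.map_target hz
  have hez : e (p z) = z := by rw [← hep]; exact e.right_inv hz
  let E : S × ℝ → ℂ × ℝ := fun q => (e q.1, q.2)
  let E' : ℂ × ℝ → S × ℝ := fun x => (p x.1, x.2)
  have hEz : E (p z, r) = (z, r) := by simp [E, hez]
  have hE : MDifferentiableAt (𝓘(ℝ, ℂ).prod 𝓘(ℝ, ℝ)) 𝓘(ℝ, ℂ × ℝ) E (p z, r) := by
    refine MDifferentiableAt.prodMk_space ?_ mdifferentiableAt_snd
    exact MDifferentiableAt.comp (I' := 𝓘(ℝ, ℂ)) (p z, r)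
      (((contMDiffOn_holCoords 1 he).contMDiffAt (e.open_source.mem_nhds hσ)).mdifferentiableAt
        one_ne_zero) mdifferentiableAt_fst
  have hE' : MDifferentiableAt 𝓘(ℝ, ℂ × ℝ) (𝓘(ℝ, ℂ).prod 𝓘(ℝ, ℝ)) E' (E (p z, r)) := by
    refine MDifferentiableAt.prodMk ?_ differentiableAt_snd.mdifferentiableAt
    exact MDifferentiableAt.comp (I' := 𝓘(ℝ, ℂ)) _
      ((h.isHolImmersion.contMDiff_real 1).mdifferentiableAt one_ne_zero)
      differentiableAt_fst.mdifferentiableAt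
  have hpe {q : S × ℝ} (hq : q.1 ∈ e.source) : E' (E q) = q := by
    simp [E, E', ← hep, e.left_inv hq]
  have hnhds : ∀ᶠ q in nhds (p z, r), q.1 ∈ e.source :=
    continuous_fst.continuousAt.preimage_mem_nhds (e.open_source.mem_nhds hσ)
  have hinj : Function.Injective
      (mfderiv (𝓘(ℝ, ℂ).prod 𝓘(ℝ, ℝ)) 𝓘(ℝ, ℂ × ℝ) E (p z, r)) := by
    have h1 := mfderiv_comp (p z, r) hE' hE
    have h2 : E' ∘ E =ᶠ[nhds (p z, r)] id := by
      filter_upwards [hnhds] with q hq using hpe hq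
    rw [h2.mfderiv_eq, mfderiv_id] at h1
    intro x y hxy
    have hx := DFunLike.congr_fun h1 x
    have hy := DFunLike.congr_fun h1 y
    exact hx.trans ((congrArg _ hxy).trans hy.symm)
  have heq : (h.ruledFold w).point =ᶠ[nhds (p z, r)] ruledMap (φ ∘ p) w ∘ E := by
    filter_upwards [hnhds] with q hq
    rw [Function.comp, ← h.ruledFold_point w (E q)]
    exact congrArg _ (hpe hq).symm
  have hG : MDifferentiableAt 𝓘(ℝ, ℂ × ℝ) 𝓘(ℝ, C3) (ruledMap (φ ∘ p) w) (E (p z, r)) :=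
    ((h.isSLMap.contDiff_ruledMap w).differentiable (by simp) _).mdifferentiableAt
  rw [RuledFold.NonsingularAt, heq.mfderiv_eq, mfderiv_comp (p z, r) hG hE]
  rw [mfderiv_eq_fderiv, hEz]
  exact Function.Injective.comp (g := fderiv ℝ (ruledMap (φ ∘ p) w) (z, r)) hi hinj

theorem dense_nonsingularAt : Dense {q | (h.ruledFold w).NonsingularAt q} := by
  rintro ⟨σ, r⟩
  obtain ⟨z, rfl⟩ := h.isLattice.surjective σ
  let A : ℝ → C3 := fun r => crossC3 ((φ ∘ p) z)
    (partialS (fun z => ruledMap (φ ∘ p) w (z, r)) z)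
  have hT : partialT (φ ∘ p) z ≠ 0 := fun h0 =>
    Complex.I_ne_zero (h.isSLMap.injective z (Set.mem_univ z) (a₁ := Complex.I) (a₂ := 0)
      (h0.trans (map_zero _).symm))
  have hsub : Set.Subsingleton {r | A r = 0} := by
    intro r₁ h₁ r₂ h₂
    have e : A r₁ - A r₂ = (r₁ - r₂) • partialT (φ ∘ p) z := by
      simp only [A]
      rw [h.isSLMap.cross_partialS_ruledMap w z r₁, h.isSLMap.cross_partialS_ruledMap w z r₂]
      module
    rw [show A r₁ = 0 from h₁, show A r₂ = 0 from h₂, sub_zero, eq_comm, smul_eq_zero] at e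
    exact sub_eq_zero.1 (e.resolve_right hT)
  have hd : Dense {r | A r = 0}ᶜ := hsub.countable.dense_compl ℝ
  refine map_mem_closure (Continuous.prodMk_right (p z)) (hd r) fun r' hr' => ?_
  exact h.nonsingularAt_of_injective w (h.isSLMap.injective_fderiv_ruledMap w z r' hr')

theorem isSpecialLagrangian : (h.ruledFold w).IsSpecialLagrangian := by
  refine ⟨h.dense_nonsingularAt w, fun e he z hz r _ => ?_⟩
  obtain ⟨z₀, hz₀⟩ := h.isLattice.surjective (e.symm z)
  obtain ⟨e₀, he₀, hz₀t, he₀p⟩ := h.isHolImmersion.exists_chart z₀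
  have hσ : e.symm z ∈ e₀.source := by rw [← hz₀, ← he₀p]; exact e₀.map_target hz₀t
  have hτz : e₀ (e.symm z) = z₀ := by rw [← hz₀, ← he₀p]; exact e₀.right_inv hz₀t
  have hτ : DifferentiableAt ℂ (e₀ ∘ e.symm) z := by
    have h1 := (contMDiffOn_symm_of_mem_maximalAtlas he).contMDiffAt (e.open_target.mem_nhds hz)
    have h2 := (contMDiffOn_of_mem_maximalAtlas he₀).contMDiffAt (e₀.open_source.mem_nhds hσ)
    exact ((h2.comp z h1).contDiffAt).differentiableAt (by simp)
  let G : ℂ → C3 := fun z => ruledMap (φ ∘ p) w (z, r)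
  have hG : DifferentiableAt ℝ G (e₀ (e.symm z)) :=
    ((h.isSLMap.contDiff_ruledMap w).comp (contDiff_prodMk_left r)).differentiable (by simp) _
  have heq : (fun z' => (h.ruledFold w).point (e.symm z', r)) =ᶠ[nhds z]
      G ∘ (e₀ ∘ e.symm) := by
    have hc : ContinuousAt e.symm z := e.symm.continuousAt hz
    filter_upwards [hc.preimage_mem_nhds (e₀.open_source.mem_nhds hσ)] with x hx
    have hpx : p (e₀ (e.symm x)) = e.symm x := by rw [← he₀p]; exact e₀.left_inv hx
    simp only [Function.comp, G]
    rw [← h.ruledFold_point w, hpx]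
  have hd (v : ℂ) : fderiv ℝ (fun z' => (h.ruledFold w).point (e.symm z', r)) z v =
      fderiv ℝ G z₀ (v * deriv (e₀ ∘ e.symm) z) := by
    rw [heq.fderiv_eq, fderiv_comp z hG (hτ.restrictScalars ℝ), Function.comp, hτz,
      (hτ.hasDerivAt.hasFDerivAt.restrictScalars ℝ).fderiv]
    simp
  -- Passing from `e` to the flat coordinate multiplies tangent vectors by the complex derivative of
  -- the transition map; its real and imaginary parts are `α` and `β`.
  have hframe := isCalibratedFrame_of_eq (h.isSLMap.norm_eq_one z₀ (Set.mem_univ _))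
    (h.isSLMap.inner_partialS_ruledMap_im w z₀ r) (h.isSLMap.ruledMap_partialT_eq w z₀ r)
    (deriv (e₀ ∘ e.symm) z).re (deriv (e₀ ∘ e.symm) z).im
  rw [partialS, partialT, hd, hd, fderiv_complex_apply, fderiv_complex_apply _ (Complex.I * _),
    ← hz₀]
  simp
  simp at hframe
  exact hframe

end IsSLUniformization

end Surface

/-! ### Distinctness of the deformations -/

namespace IsSLMap

variable {f : ℂ → C3} (hf : IsSLMap f Set.univ)
include hf

/-- A linear left inverse of `df` at `z₀` turns `f` into a local diffeomorphism of the plane, which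
the inverse function theorem inverts. -/
theorem exists_local_left_inverse (z₀ : ℂ) :
    ∃ L : C3 → ℂ, ∀ᶠ z in nhds z₀, L (f z) = z ∧ DifferentiableAt ℝ L (f z) := by
  have hinj := hf.injective z₀ (Set.mem_univ _)
  obtain ⟨T, hT⟩ := (fderiv ℝ f z₀).toLinearMap.exists_leftInverse_of_injective
    (LinearMap.ker_eq_bot.2 hinj)
  let T' : C3 →L[ℝ] ℂ := LinearMap.toContinuousLinearMap T
  have hs : ContDiff ℝ ∞ (fun z => T' (f z)) := T'.contDiff.comp hf.contDiff
  have hd : HasFDerivAt (fun z => T' (f z)) (ContinuousLinearEquiv.refl ℝ ℂ : ℂ →L[ℝ] ℂ) z₀ := by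
    have := T'.hasFDerivAt.comp z₀ (hf.differentiableAt (Set.mem_univ z₀)).hasFDerivAt
    have e : (ContinuousLinearEquiv.refl ℝ ℂ : ℂ →L[ℝ] ℂ) = T'.comp (fderiv ℝ f z₀) :=
      ContinuousLinearMap.ext fun v => (DFunLike.congr_fun hT v).symm
    rw [e]
    exact this
  have hs1 : ContDiffAt ℝ 1 (fun z => T' (f z)) z₀ := hs.contDiffAt.of_le (by norm_cast)
  have hst := hs1.hasStrictFDerivAt' hd one_ne_zero
  have hK := hs1.to_localInverse hd one_ne_zero
  refine ⟨fun x => hs1.localInverse hd one_ne_zero (T' x), ?_⟩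
  have h1 := hst.eventually_left_inverse
  have h2 := hs.continuous.continuousAt.eventually (hK.eventually (by simp))
  filter_upwards [h1, h2] with z hz1 hz2
  exact ⟨hz1, (hz2.differentiableAt one_ne_zero).comp (f z) T'.differentiableAt⟩

/-- On some open set `z'` is a differentiable function `g` of `z` with `f ∘ g = f`. It is
holomorphic with `w g' = w'`, hence affine on a ball, and analyticity makes `f` invariant under this
affine map everywhere. For `w ≠ w'` it has a fixed point, where differentiating the invariance in
the direction `w` forces `w' = w`. -/
theorem eq_of_forall_exists (ha : ContDiff ℝ ω f) {w w' : ℂ} (hw : w ≠ 0)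
    (h : ∀ z, ∃ z', f z' = f z ∧ fderiv ℝ f z' w' = fderiv ℝ f z w) : w = w' := by
  choose L hL using hf.exists_local_left_inverse
  have hball (z₀ : ℂ) : ∃ ε > 0, ∀ z ∈ Metric.closedBall z₀ ε,
      L z₀ (f z) = z ∧ DifferentiableAt ℝ (L z₀) (f z) := by
    obtain ⟨ε, hε, hb⟩ := Metric.eventually_nhds_iff_ball.1 (hL z₀)
    exact ⟨ε / 2, by positivity, fun z hz => hb z
      (Metric.closedBall_subset_ball (by linarith) hz)⟩
  choose ε hε hB using hball
  obtain ⟨s, hs, hcov⟩ := TopologicalSpace.countable_cover_nhds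
    (fun z => Metric.closedBall_mem_nhds z (hε z))
  have := hs.to_subtype
  -- The points `z` with a partner `z'` in the ball around `x`. Projection along a compact ball
  -- makes `A x` closed, and countably many of these sets cover the plane, so Baire's theorem gives
  -- one with interior points.
  let A : s → Set ℂ := fun x => Prod.fst '' {y : ℂ × Metric.closedBall x.1 (ε x.1) |
    f y.2.1 = f y.1 ∧ fderiv ℝ f y.2.1 w' = fderiv ℝ f y.1 w}
  have hcont (v : ℂ) : Continuous fun z => fderiv ℝ f z v :=
    (hf.contDiff.fderiv_apply_const v).continuous
  have hfc := hf.contDiff.continuous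
  have hA (x : s) : IsClosed (A x) := by
    have : CompactSpace (Metric.closedBall x.1 (ε x.1)) :=
      isCompact_iff_compactSpace.1 (isCompact_closedBall _ _)
    have hsnd : Continuous fun y : ℂ × Metric.closedBall x.1 (ε x.1) => y.2.1 :=
      continuous_subtype_val.comp continuous_snd
    refine isClosedMap_fst_of_compactSpace _ ((isClosed_eq (hfc.comp hsnd)
      (hfc.comp continuous_fst)).inter (isClosed_eq ((hcont w').comp hsnd)
        ((hcont w).comp continuous_fst)))
  have hU : ⋃ x, A x = Set.univ := by
    refine Set.eq_univ_of_forall fun z => ?_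
    obtain ⟨z', h1, h2⟩ := h z
    obtain ⟨x, hx, hzx⟩ := Set.mem_iUnion₂.1 (hcov.ge (Set.mem_univ z'))
    exact Set.mem_iUnion.2 ⟨⟨x, hx⟩, (z, ⟨z', hzx⟩), ⟨h1, h2⟩, rfl⟩
  obtain ⟨x, hx⟩ := nonempty_interior_of_iUnion_of_closed hA hU
  let g : ℂ → ℂ := fun z => L x (f z)
  have hg : ∀ z ∈ interior (A x), f (g z) = f z ∧ fderiv ℝ f (g z) w' = fderiv ℝ f z w ∧
      DifferentiableAt ℝ g z := by
    intro z hz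
    obtain ⟨⟨z₁, z', hz'⟩, ⟨h1, h2⟩, rfl⟩ := interior_subset hz
    obtain ⟨e1, e2⟩ := hB x z' hz'
    simp only at h1 h2 e1 e2
    have hgz : g z₁ = z' := by simp only [g]; rw [← h1, e1]
    refine ⟨by rw [hgz, h1], by rw [hgz, h2], ?_⟩
    refine DifferentiableAt.comp z₁ ?_ (hf.differentiableAt (Set.mem_univ z₁))
    rw [← h1]; exact e2
  have hev {z : ℂ} (hz : z ∈ interior (A x)) : f ∘ g =ᶠ[nhds z] f := by
    filter_upwards [isOpen_interior.mem_nhds hz] with y hy using (hg y hy).1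
  have hgd : ∀ z ∈ interior (A x), HasDerivAt g (w' / w) z := by
    intro z hz
    obtain ⟨h1, h2, h3⟩ := hg z hz
    have h4 : DifferentiableAt ℂ g z := by
      refine hf.special_comp (Set.mem_univ _) h3 ?_
      rw [partialT, partialS, (hev hz).fderiv_eq, h1]
      exact hf.special z (Set.mem_univ z)
    have h5 : fderiv ℝ f z w = fderiv ℝ f (g z) (w * deriv g z) := by
      rw [← (hev hz).fderiv_eq, fderiv_comp z (hf.differentiableAt (Set.mem_univ _)) h3,
        (h4.hasDerivAt.hasFDerivAt.restrictScalars ℝ).fderiv]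
      simp
    have h6 : w * deriv g z = w' := hf.injective _ (Set.mem_univ _) (h5.symm.trans h2.symm)
    rw [← h6, mul_div_cancel_left₀ _ hw]
    exact h4.hasDerivAt
  obtain ⟨z₁, hz₁⟩ := hx
  obtain ⟨δ, hδ, hsub⟩ := Metric.isOpen_iff.1 isOpen_interior z₁ hz₁
  have hgeq : ∀ z ∈ Metric.ball z₁ δ, g z = w' / w * z + (g z₁ - w' / w * z₁) := by
    intro z hz
    have h1 : ∀ y ∈ Metric.ball z₁ δ, HasDerivAt (fun y => g y - w' / w * y) 0 y := by
      intro y hy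
      simpa using (hgd y (hsub hy)).fun_sub ((hasDerivAt_id y).const_mul (w' / w))
    have h2 := (convex_ball z₁ δ).is_const_of_fderivWithin_eq_zero (𝕜 := ℂ)
      (f := fun y => g y - w' / w * y)
      (fun y hy => (h1 y hy).differentiableAt.differentiableWithinAt)
      (fun y hy => by
        rw [fderivWithin_of_isOpen Metric.isOpen_ball hy, (h1 y hy).hasFDerivAt.fderiv]
        simp) hz (Metric.mem_ball_self hδ)
    beta_reduce at h2
    linear_combination h2
  set c := g z₁ - w' / w * z₁
  have hfun : (fun z => f (w' / w * z + c)) = f := by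
    have e1 : AnalyticOnNhd ℝ f Set.univ := (contDiff_omega_iff_analyticOnNhd).1 ha
    have e2 : AnalyticOnNhd ℝ (fun z => f (w' / w * z + c)) Set.univ := by
      refine (contDiff_omega_iff_analyticOnNhd).1 (ha.comp ?_)
      exact (contDiff_const.mul contDiff_id).add contDiff_const
    refine e2.eq_of_eventuallyEq e1 (z₀ := z₁) ?_
    filter_upwards [Metric.ball_mem_nhds z₁ hδ] with z hz
    rw [← hgeq z hz]
    exact (hg z (hsub hz)).1
  by_contra hne
  have hζ : 1 - w' / w ≠ 0 := by
    rw [sub_ne_zero, ne_comm, Ne, div_eq_one_iff_eq hw]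
    exact Ne.symm hne
  set z₀ := c / (1 - w' / w) with hz₀
  have hfix : w' / w * z₀ + c = z₀ := by
    have : z₀ * (1 - w' / w) = c := div_mul_cancel₀ _ hζ
    linear_combination -this
  have hder : HasFDerivAt (fun z : ℂ => w' / w * z + c)
      ((w' / w) • (1 : ℂ →L[ℝ] ℂ)) z₀ := ((hasFDerivAt_id z₀).const_mul (w' / w)).add_const c
  have h7 := congrArg (fun F => fderiv ℝ F z₀ w) hfun
  beta_reduce at h7
  have h8 : fderiv ℝ (fun z => f (w' / w * z + c)) z₀ = _ :=
    fderiv_comp (g := f) z₀ (hf.differentiableAt (Set.mem_univ _)) hder.differentiableAt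
  rw [h8, hder.fderiv, hfix] at h7
  have h9 := hf.injective _ (Set.mem_univ _) h7
  apply hne
  simpa [hw] using h9.symm

end IsSLMap

theorem IsSLUniformization.eq_of_orientedLines_eq {S : Type*} [TopologicalSpace S]
    [ChartedSpace ℂ S] [IsManifold 𝓘(ℂ) ω S] {φ : S → C3} {a b : ℂ} {p : ℂ → S}
    (h : IsSLUniformization φ a b p) (hφ : IsSLCone φ) {w w' : ℂ}
    (hl : (h.ruledFold w).orientedLines = (h.ruledFold w').orientedLines) : w = w' := by
  have key {w w' : ℂ} (hl : (h.ruledFold w).orientedLines = (h.ruledFold w').orientedLines)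
      (z : ℂ) : ∃ z', (φ ∘ p) z' = (φ ∘ p) z ∧
        fderiv ℝ (φ ∘ p) z' w' = fderiv ℝ (φ ∘ p) z w := by
    have h1 : (φ (p z), fderiv ℝ (φ ∘ p) z w) ∈ (h.ruledFold w).orientedLines :=
      ⟨p z, Prod.ext rfl (h.extend_apply w z)⟩
    rw [hl] at h1
    obtain ⟨σ, hσ⟩ := h1
    obtain ⟨z', rfl⟩ := h.isLattice.surjective σ
    rw [Prod.ext_iff] at hσ
    exact ⟨z', hσ.1, (h.extend_apply w' z').symm.trans hσ.2⟩
  -- For `w = 0` the ratio `w' / w` carries no information, but injectivity of the differential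
  -- already gives `w' = 0`.
  by_cases hw : w = 0
  · obtain ⟨z', -, h2⟩ := key hl 0
    rw [hw, map_zero] at h2
    rw [hw]
    exact h.isSLMap.injective z' (Set.mem_univ _) ((map_zero _).trans h2.symm)
  · exact h.isSLMap.eq_of_forall_exists (h.analytic hφ) hw (key hl)

/-! ### Smooth dependence of integrals on parameters, and second order remainders -/

theorem contDiff_parametric_integral {E F : Type*} [NormedAddCommGroup E] [NormedSpace ℝ E]
    [FiniteDimensional ℝ E] [NormedAddCommGroup F] [NormedSpace ℝ F] [CompleteSpace F]
    {Φ : E × ℝ → F} (hΦ : ContDiff ℝ ∞ Φ) :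
    ContDiff ℝ ∞ fun x => ∫ s in (0 : ℝ)..1, Φ (x, s) := by
  have hder (Φ : E × ℝ → F) (hΦ : ContDiff ℝ ∞ Φ) (x : E) :
      HasFDerivAt (fun x => ∫ s in (0 : ℝ)..1, Φ (x, s))
        (∫ s in (0 : ℝ)..1, (fderiv ℝ Φ (x, s)).comp (ContinuousLinearMap.inl ℝ E ℝ)) x := by
    have hc : Continuous fun y : E × ℝ =>
        (fderiv ℝ Φ y).comp (ContinuousLinearMap.inl ℝ E ℝ) :=
      (hΦ.continuous_fderiv (by simp)).clm_comp continuous_const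
    obtain ⟨C, hC⟩ := ((isCompact_closedBall x 1).prod
      (isCompact_Icc (a := (0 : ℝ)) (b := 1))).exists_bound_of_continuousOn hc.continuousOn
    refine intervalIntegral.hasFDerivAt_integral_of_dominated_of_fderiv_le
      (F := fun x s => Φ (x, s)) (bound := fun _ => C)
      (F' := fun x s => (fderiv ℝ Φ (x, s)).comp (ContinuousLinearMap.inl ℝ E ℝ))
      (Metric.closedBall_mem_nhds x one_pos) ?_ ?_ ?_ ?_ ?_ ?_
    · exact .of_forall fun y =>
        (hΦ.continuous.comp (Continuous.prodMk_right y)).aestronglyMeasurable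
    · exact (hΦ.continuous.comp (Continuous.prodMk_right x)).intervalIntegrable _ _
    · exact (hc.comp (Continuous.prodMk_right x)).aestronglyMeasurable
    · refine .of_forall fun s hs y hy => hC (y, s) ⟨hy, ?_⟩
      rw [Set.uIoc_of_le zero_le_one] at hs
      exact ⟨hs.1.le, hs.2⟩
    · exact intervalIntegrable_const
    · exact .of_forall fun s _ y _ => HasFDerivAt.comp (g := Φ) (f := fun y => (y, s)) y
        (hΦ.differentiable (by simp) _).hasFDerivAt (hasFDerivAt_prodMk_left y s)
  rw [contDiff_infty]
  intro n
  induction n generalizing Φ with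
  | zero =>
    exact contDiff_zero.2 (continuous_iff_continuousAt.2 fun x => (hder Φ hΦ x).continuousAt)
  | succ n ih =>
    push_cast
    refine contDiff_succ_iff_fderiv_apply.2 ⟨fun x => (hder Φ hΦ x).differentiableAt,
      fun h => absurd h (WithTop.natCast_ne_top n), fun v => ?_⟩
    have hc (x : E) : Continuous fun s =>
        (fderiv ℝ Φ (x, s)).comp (ContinuousLinearMap.inl ℝ E ℝ) :=
      ((hΦ.continuous_fderiv (by simp)).comp (Continuous.prodMk_right x)).clm_comp
        continuous_const
    have heq : (fun x => fderiv ℝ (fun x => ∫ s in (0 : ℝ)..1, Φ (x, s)) x v) =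
        fun x => ∫ s in (0 : ℝ)..1, (fun y => fderiv ℝ Φ y (v, 0)) (x, s) := by
      funext x
      rw [(hder Φ hΦ x).fderiv,
        ContinuousLinearMap.intervalIntegral_apply ((hc x).intervalIntegrable _ _)]
      rfl
    rw [heq]
    exact ih (hΦ.fderiv_apply_const (v, 0))

/-- The error of the first order Taylor expansion of `f` along the line in the direction `w`. -/
theorem exists_taylor_remainder {F : Type*} [NormedAddCommGroup F] [NormedSpace ℝ F]
    [CompleteSpace F] {f : ℂ → F} (hf : ContDiff ℝ ∞ f) (w : ℂ) :
    ∃ Q : ℂ × ℝ → F, ContDiff ℝ ∞ Q ∧ ∀ x : ℂ × ℝ,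
      f (x.1 - x.2 • w) + x.2 • fderiv ℝ f (x.1 - x.2 • w) w - f x.1 = x.2 ^ 2 • Q x := by
  have hf1 : ContDiff ℝ ∞ fun z => fderiv ℝ f z w := hf.fderiv_apply_const w
  have hf2 : ContDiff ℝ ∞ fun z => fderiv ℝ (fun z => fderiv ℝ f z w) z w :=
    hf1.fderiv_apply_const w
  let Φ : (ℂ × ℝ) × ℝ → F := fun y =>
    (-y.2) • fderiv ℝ (fun z => fderiv ℝ f z w) (y.1.1 - (y.2 * y.1.2) • w) w
  have hΦ : ContDiff ℝ ∞ Φ := by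
    refine contDiff_snd.neg.smul (hf2.comp ?_)
    exact contDiff_fst.fst.sub ((contDiff_snd.mul contDiff_fst.snd).smul contDiff_const)
  refine ⟨_, contDiff_parametric_integral hΦ, fun x => ?_⟩
  -- The first order terms cancel in the `s`-derivative; the surviving second derivative carries the
  -- factor `x.2 ^ 2`.
  have hd : ∀ s ∈ Set.uIcc (0 : ℝ) 1, HasDerivAt (fun s : ℝ => f (x.1 - (s * x.2) • w) +
      (s * x.2) • fderiv ℝ f (x.1 - (s * x.2) • w) w) (x.2 ^ 2 • Φ (x, s)) s := by
    intro s _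
    have h0 : HasDerivAt (fun s : ℝ => x.1 - (s * x.2) • w) (-(x.2 • w)) s := by
      simpa using (((hasDerivAt_id s).mul_const x.2).smul_const w).const_sub x.1
    have h1 : HasDerivAt (fun s : ℝ => f (x.1 - (s * x.2) • w)) _ s :=
      (hf.differentiable (by simp) _).hasFDerivAt.comp_hasDerivAt s h0
    have h2 : HasDerivAt (fun s : ℝ => fderiv ℝ f (x.1 - (s * x.2) • w) w) _ s :=
      (hf1.differentiable (by simp) _).hasFDerivAt.comp_hasDerivAt s h0
    have h3 : HasDerivAt (fun s : ℝ => s * x.2) x.2 s := by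
      simpa using (hasDerivAt_id s).mul_const x.2
    convert h1.fun_add (h3.fun_smul h2) using 1
    simp only [Φ, map_neg, map_smul]
    module
  have hint := intervalIntegral.integral_eq_sub_of_hasDerivAt hd
    ((contDiff_const.smul (hΦ.comp (contDiff_prodMk_right x))).continuous.intervalIntegrable _ _)
  rw [intervalIntegral.integral_smul] at hint
  rw [hint]
  simp

/-! ### The Levi-Civita connection of the cone metric -/

/-- The parametrization of the cone over `f`. -/
noncomputable def coneMap (f : ℂ → C3) (x : ℂ × ℝ) : C3 := x.2 • f x.1

/-- The second derivative `D²f (v, w)`. -/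
noncomputable def hessian (f : ℂ → C3) (z v w : ℂ) : C3 := fderiv ℝ (fun y => fderiv ℝ f y w) z v

/-- The vector which `Df` maps to the part of `X` tangent to the image of `f`. -/
noncomputable def tangentPart (f : ℂ → C3) (z : ℂ) (X : C3) : ℂ :=
  ((‖partialS f z‖ ^ 2)⁻¹ : ℝ) •
    ((inner ℝ (partialS f z) X : ℝ) + (inner ℝ (partialT f z) X : ℝ) * Complex.I : ℂ)

theorem tangentPart_re (f : ℂ → C3) (z : ℂ) (X : C3) :
    (tangentPart f z X).re = (‖partialS f z‖ ^ 2)⁻¹ * inner ℝ (partialS f z) X := by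
  rw [tangentPart, Complex.smul_re]; simp

theorem tangentPart_im (f : ℂ → C3) (z : ℂ) (X : C3) :
    (tangentPart f z X).im = (‖partialS f z‖ ^ 2)⁻¹ * inner ℝ (partialT f z) X := by
  rw [tangentPart, Complex.smul_im]; simp

theorem tangentPart_smul (f : ℂ → C3) (z : ℂ) (c : ℝ) (X : C3) :
    tangentPart f z (c • X) = c • tangentPart f z X := by
  simp only [tangentPart, inner_smul_right, Complex.ofReal_mul, Complex.real_smul]
  ring

/-- Dilation of the tangent vectors of the link. -/
noncomputable def scaleLink (r : ℝ) (v : ℂ × ℝ) : ℂ × ℝ := (r • v.1, v.2)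

/-- The Christoffel symbol of the cone metric at distance `1` from the vertex. -/
noncomputable def coneGamma (f : ℂ → C3) (z : ℂ) (v w : ℂ × ℝ) : ℂ × ℝ :=
  (tangentPart f z (hessian f z v.1 w.1) + v.2 • w.1 + w.2 • v.1,
    inner ℝ (f z) (hessian f z v.1 w.1))

namespace IsSLMap

variable {f : ℂ → C3} (hf : IsSLMap f Set.univ)
include hf

theorem fderiv_coneMap (x v : ℂ × ℝ) :
    fderiv ℝ (coneMap f) x v = x.2 • fderiv ℝ f x.1 v.1 + v.2 • f x.1 := by
  have h1 : HasFDerivAt (fun x : ℂ × ℝ => f x.1) _ x :=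
    HasFDerivAt.comp (g := f) x (hf.contDiff.differentiable (by simp) _).hasFDerivAt hasFDerivAt_fst
  have h2 : HasFDerivAt (coneMap f) _ x := HasFDerivAt.fun_smul hasFDerivAt_snd h1
  rw [h2.fderiv]
  simp

theorem fderiv_fderiv_coneMap (x v w : ℂ × ℝ) :
    fderiv ℝ (fun y => fderiv ℝ (coneMap f) y w) x v = x.2 • hessian f x.1 v.1 w.1 +
      (v.2 • fderiv ℝ f x.1 w.1 + w.2 • fderiv ℝ f x.1 v.1) := by
  have h1 : HasFDerivAt (fun x : ℂ × ℝ => f x.1) _ x :=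
    HasFDerivAt.comp (g := f) x (hf.contDiff.differentiable (by simp) _).hasFDerivAt hasFDerivAt_fst
  have h2 : HasFDerivAt (fun x : ℂ × ℝ => fderiv ℝ f x.1 w.1) _ x :=
    HasFDerivAt.comp (g := fun z => fderiv ℝ f z w.1) x
      ((hf.contDiff.fderiv_apply_const w.1).differentiable (by simp) _).hasFDerivAt hasFDerivAt_fst
  have h4 : HasFDerivAt (fun y : ℂ × ℝ => y.2 • fderiv ℝ f y.1 w.1) _ x :=
    HasFDerivAt.fun_smul hasFDerivAt_snd h2
  have h5 : HasFDerivAt (fun y : ℂ × ℝ => w.2 • f y.1) _ x := h1.fun_const_smul w.2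
  rw [funext fun y => hf.fderiv_coneMap y w, (h4.fun_add h5).fderiv]
  simp [hessian]
  abel

theorem real_inner_fderiv (z v : ℂ) : (inner ℝ (f z) (fderiv ℝ f z v) : ℝ) = 0 := by
  rw [real_inner_C3, hf.inner_fderiv (Set.mem_univ z), Complex.zero_re]

theorem real_inner_fderiv_fderiv (z v w : ℂ) :
    (inner ℝ (fderiv ℝ f z v) (fderiv ℝ f z w) : ℝ) =
      ‖partialS f z‖ ^ 2 * (v.re * w.re + v.im * w.im) := by
  rw [real_inner_C3, hf.inner_fderiv_fderiv (Set.mem_univ z), Complex.re_mul_ofReal,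
    inner_self_eq_norm_sq_to_K]
  norm_cast

/-- The vectors `f_s` and `f_t` are orthogonal, of equal length and orthogonal to the unit vector
`f`, so the projection to the tangent space of the cone is explicit. -/
theorem inner_sub_tangentPart (z : ℂ) (X : C3) (v : ℂ) (ρ : ℝ) :
    (inner ℝ (X - (fderiv ℝ f z (tangentPart f z X) + (inner ℝ (f z) X : ℝ) • f z))
      (fderiv ℝ f z v + ρ • f z) : ℝ) = 0 := by
  have h1 : (inner ℝ (f z) (f z) : ℝ) = 1 := by
    rw [real_inner_self_eq_norm_sq, hf.norm_eq_one z (Set.mem_univ z), one_pow]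
  have h2 (v : ℂ) : (inner ℝ (fderiv ℝ f z v) (f z) : ℝ) = 0 := by
    rw [real_inner_comm, hf.real_inner_fderiv]
  have h3 : ‖partialS f z‖ ≠ 0 := norm_ne_zero_iff.2 (hf.partialS_ne_zero (Set.mem_univ z))
  have h4 : (inner ℝ X (fderiv ℝ f z v) : ℝ) =
      v.re * inner ℝ (partialS f z) X + v.im * inner ℝ (partialT f z) X := by
    rw [fderiv_complex_apply, inner_add_right, inner_smul_right, inner_smul_right, partialS,
      partialT, real_inner_comm _ X, real_inner_comm _ X]
  simp only [inner_sub_left, inner_add_left, inner_add_right, inner_smul_left, inner_smul_right,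
    hf.real_inner_fderiv, h1, h2, h4, hf.real_inner_fderiv_fderiv, real_inner_comm X (f z)]
  simp only [tangentPart_re, tangentPart_im]
  simp
  field_simp
  ring

theorem norm_fderiv_coneMap_sq (x v : ℂ × ℝ) : ‖fderiv ℝ (coneMap f) x v‖ ^ 2 =
    ‖partialS f x.1‖ ^ 2 * ‖(scaleLink x.2 v).1‖ ^ 2 + (scaleLink x.2 v).2 ^ 2 := by
  rw [hf.fderiv_coneMap, norm_add_sq_real, inner_smul_left, inner_smul_right, real_inner_comm,
    hf.real_inner_fderiv, norm_smul, norm_smul, hf.norm_eq_one _ (Set.mem_univ _)]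
  have := hf.real_inner_fderiv_fderiv x.1 v.1 v.1
  rw [real_inner_self_eq_norm_sq] at this
  simp only [mul_pow, this, scaleLink, norm_smul, Complex.sq_norm, Complex.normSq_apply,
    Real.norm_eq_abs, sq_abs]
  simp
  ring

theorem injective_fderiv_coneMap {x : ℂ × ℝ} (hx : x.2 ≠ 0) :
    Function.Injective (fderiv ℝ (coneMap f) x) := by
  refine (injective_iff_map_eq_zero _).2 fun v hv => ?_
  have h1 := hf.norm_fderiv_coneMap_sq x v
  have h3 : 0 < ‖partialS f x.1‖ := norm_pos_iff.2 (hf.partialS_ne_zero (Set.mem_univ _))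
  rw [hv, norm_zero, zero_pow two_ne_zero] at h1
  have h4 : (scaleLink x.2 v).2 ^ 2 = 0 := by
    refine le_antisymm ?_ (sq_nonneg _)
    rw [h1]
    exact le_add_of_nonneg_left (by positivity)
  have h5 : ‖partialS f x.1‖ ^ 2 * ‖(scaleLink x.2 v).1‖ ^ 2 = 0 := by linarith
  simp [scaleLink, h3.ne', hx] at h4 h5
  exact Prod.ext h5 h4

theorem hessian_smul_smul (z : ℂ) (c d : ℝ) (v w : ℂ) :
    hessian f z (c • v) (d • w) = (c * d) • hessian f z v w := by
  have hd : DifferentiableAt ℝ (fun y => fderiv ℝ f y w) z :=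
    (hf.contDiff.fderiv_apply_const w).differentiable (by simp) _
  simp only [hessian, map_smul]
  rw [fderiv_fun_const_smul hd, smul_apply, smul_smul]

theorem coneGamma_smul_smul (z : ℂ) (c d : ℝ) (v w : ℂ × ℝ) :
    coneGamma f z (c • v) (d • w) = (c * d) • coneGamma f z v w := by
  simp only [coneGamma, Prod.smul_fst, Prod.smul_snd, hf.hessian_smul_smul, tangentPart_smul,
    inner_smul_right, Prod.smul_mk, smul_eq_mul, smul_add, smul_smul]
  rw [mul_right_comm, mul_comm d w.2, mul_assoc c d w.2, mul_comm d w.2, mul_comm (w.2 * d),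
    ← mul_assoc c]

/-- Homogeneity of the cone metric: on rescaled vectors its Christoffel symbol is `r⁻¹` times an
expression without `r`. The vector `g` in the proof comes from splitting the second derivative of
the link map into its parts along the link, along the radius and normal to the cone. -/
theorem scaleLink_christoffel {x : ℂ × ℝ} (hx : x.2 ≠ 0) (v w : ℂ × ℝ) :
    scaleLink x.2 (christoffel (coneMap f) x v w) =
      x.2⁻¹ • coneGamma f x.1 (scaleLink x.2 v) (scaleLink x.2 w) := by
  set X := hessian f x.1 v.1 w.1 with hX
  let g : ℂ × ℝ := (tangentPart f x.1 X + x.2⁻¹ • (v.2 • w.1 + w.2 • v.1),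
    x.2 * inner ℝ (f x.1) X)
  have hg : fderiv ℝ (coneMap f) x g = x.2 • (fderiv ℝ f x.1 (tangentPart f x.1 X) +
      (inner ℝ (f x.1) X : ℝ) • f x.1) +
      (v.2 • fderiv ℝ f x.1 w.1 + w.2 • fderiv ℝ f x.1 v.1) := by
    rw [hf.fderiv_coneMap]
    simp only [g, map_add, map_smul, smul_add, smul_smul, mul_inv_cancel_left₀ hx]
    abel
  have hproj : (LinearMap.range (fderiv ℝ (coneMap f) x).toLinearMap).starProjection
      (fderiv ℝ (fun y => fderiv ℝ (coneMap f) y w) x v) = fderiv ℝ (coneMap f) x g := by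
    refine Submodule.eq_starProjection_of_mem_of_inner_eq_zero (LinearMap.mem_range_self _ g) ?_
    rintro _ ⟨u, rfl⟩
    have := hf.inner_sub_tangentPart x.1 X (x.2 • u.1) u.2
    rw [hf.fderiv_fderiv_coneMap, hg, ← hX, add_sub_add_right_eq_sub, ← smul_sub, inner_smul_left]
    refine mul_eq_zero_of_right _ ?_
    change inner ℝ _ (fderiv ℝ (coneMap f) x u) = 0
    rw [hf.fderiv_coneMap, ← map_smul]
    exact this
  have hgeq : christoffel (coneMap f) x v w = g := by
    rw [christoffel, hproj]
    exact Function.leftInverse_invFun (hf.injective_fderiv_coneMap hx) g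
  rw [hgeq]
  simp only [scaleLink, coneGamma, g, hf.hessian_smul_smul, tangentPart_smul,
    inner_smul_right, ← hX]
  refine Prod.ext ?_ ?_
  · simp only [Prod.smul_mk, smul_add, smul_smul]
    rw [inv_mul_cancel_left₀ hx, mul_comm v.2 x.2, mul_comm w.2 x.2, inv_mul_cancel_left₀ hx,
      inv_mul_cancel_left₀ hx, mul_inv_cancel_left₀ hx, mul_inv_cancel_left₀ hx]
    abel
  · simp only [Prod.smul_mk, smul_eq_mul]
    rw [mul_assoc, inv_mul_cancel_left₀ hx]

end IsSLMap

/-! ### Covariant derivatives in scaled coordinates at infinity -/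

theorem Finset.prod_update_tail_mul {k : ℕ} (c : Fin (k + 1) → ℝ) (j : Fin k) :
    ∏ i, Function.update (Fin.tail c) j (c 0 * Fin.tail c j) i = ∏ i, c i := by
  rw [Finset.prod_update_of_mem (Finset.mem_univ j), Fin.prod_univ_succ, mul_assoc]
  congr 1
  change _ = ∏ i, Fin.tail c i
  rw [← Finset.mul_prod_erase Finset.univ (Fin.tail c) (Finset.mem_univ j),
    ← Finset.sdiff_singleton_eq_erase]

/-- The covariant derivatives of `(z, r) ↦ r⁻¹ Q (z, r⁻¹)` in the coordinates `(z, r⁻¹)`, evaluated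
on tangent vectors rescaled to bounded length. -/
noncomputable def scaledDeriv {G : Type*} [NormedAddCommGroup G] [NormedSpace ℝ G] (f : ℂ → C3)
    (Q : ℂ × ℝ → G) : (k : ℕ) → ℂ × ℝ → (Fin k → ℂ × ℝ) → G
  | 0, x, _ => Q x
  | k + 1, x, u =>
      -- A factor `r⁻¹` is taken out throughout. In this direction, the second entry is the
      -- variation of `η = r⁻¹`, and the last is that of the rescaled vectors, whose first parts are
      -- proportional to `r`. The term after it is the derivative of the prefactor `r^{-(k+1)}`.
      fderiv ℝ (fun y : (ℂ × ℝ) × (Fin k → ℂ × ℝ) => scaledDeriv f Q k y.1 y.2) (x, Fin.tail u)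
          (((u 0).1, -(x.2 * (u 0).2)), fun i => ((u 0).2 • (Fin.tail u i).1, 0))
        - ((k + 1) * (u 0).2) • scaledDeriv f Q k x (Fin.tail u)
        - ∑ j : Fin k, scaledDeriv f Q k x
            (Function.update (Fin.tail u) j (coneGamma f x.1 (u 0) (Fin.tail u j)))

namespace IsSLMap

variable {f : ℂ → C3} (hf : IsSLMap f Set.univ)
include hf

section Smooth

variable {E : Type*} [NormedAddCommGroup E] [NormedSpace ℝ E]

theorem contDiff_hessian {z v w : E → ℂ} (hz : ContDiff ℝ ∞ z) (hv : ContDiff ℝ ∞ v)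
    (hw : ContDiff ℝ ∞ w) : ContDiff ℝ ∞ fun x => hessian f (z x) (v x) (w x) := by
  have h1 : ContDiff ℝ ∞ (fderiv ℝ f) := hf.contDiff.fderiv_right le_rfl
  have h2 : ContDiff ℝ ∞ (fderiv ℝ (fderiv ℝ f)) := h1.fderiv_right le_rfl
  have h3 (z v w : ℂ) : hessian f z v w = fderiv ℝ (fderiv ℝ f) z v w := by
    rw [hessian, fderiv_clm_apply (h1.differentiable (by simp) z) (differentiableAt_const w)]
    simp
  simp only [h3]
  exact ((h2.comp hz).clm_apply hv).clm_apply hw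

theorem contDiff_tangentPart {z : E → ℂ} {X : E → C3} (hz : ContDiff ℝ ∞ z)
    (hX : ContDiff ℝ ∞ X) : ContDiff ℝ ∞ fun x => tangentPart f (z x) (X x) := by
  have hs : ContDiff ℝ ∞ fun x => partialS f (z x) := (hf.contDiff.fderiv_apply_const 1).comp hz
  have ht : ContDiff ℝ ∞ fun x => partialT f (z x) :=
    (hf.contDiff.fderiv_apply_const Complex.I).comp hz
  refine ((hs.norm_sq ℝ).inv fun x => ?_).smul
    ((Complex.ofRealCLM.contDiff.comp (hs.inner ℝ hX)).add
      ((Complex.ofRealCLM.contDiff.comp (ht.inner ℝ hX)).mul contDiff_const))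
  exact pow_ne_zero 2 (norm_ne_zero_iff.2 (hf.partialS_ne_zero (Set.mem_univ _)))

theorem contDiff_coneGamma {z : E → ℂ} {v w : E → ℂ × ℝ} (hz : ContDiff ℝ ∞ z)
    (hv : ContDiff ℝ ∞ v) (hw : ContDiff ℝ ∞ w) :
    ContDiff ℝ ∞ fun x => coneGamma f (z x) (v x) (w x) := by
  have hh := hf.contDiff_hessian hz hv.fst hw.fst
  refine ContDiff.prodMk ?_ ((hf.contDiff.comp hz).inner ℝ hh)
  exact ((hf.contDiff_tangentPart hz hh).add (hv.snd.smul hw.fst)).add (hw.snd.smul hv.fst)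

end Smooth

variable {G : Type*} [NormedAddCommGroup G] [NormedSpace ℝ G] {Q : ℂ × ℝ → G}
  (hQ : ContDiff ℝ ∞ Q)
include hQ

theorem contDiff_scaledDeriv (k : ℕ) :
    ContDiff ℝ ∞ fun y : (ℂ × ℝ) × (Fin k → ℂ × ℝ) => scaledDeriv f Q k y.1 y.2 := by
  induction k with
  | zero => exact hQ.comp contDiff_fst
  | succ k ih =>
    have hu (i : Fin (k + 1)) : ContDiff ℝ ∞ fun y : (ℂ × ℝ) × (Fin (k + 1) → ℂ × ℝ) => y.2 i :=
      (contDiff_apply ℝ (ℂ × ℝ) i).comp contDiff_snd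
    have htail : ContDiff ℝ ∞ fun y : (ℂ × ℝ) × (Fin (k + 1) → ℂ × ℝ) => Fin.tail y.2 :=
      contDiff_pi.2 fun i => hu i.succ
    have hx : ContDiff ℝ ∞ fun y : (ℂ × ℝ) × (Fin (k + 1) → ℂ × ℝ) => y.1 := contDiff_fst
    refine ContDiff.sub (ContDiff.sub ?_ ?_) (ContDiff.sum fun j _ => ?_)
    · refine ((ih.fderiv_right le_rfl).comp (hx.prodMk htail)).clm_apply (ContDiff.prodMk
        ((hu 0).fst.prodMk (hx.snd.mul (hu 0).snd).neg) (contDiff_pi.2 fun i => ?_))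
      exact ((hu 0).snd.smul (hu i.succ).fst).prodMk contDiff_const
    · exact (contDiff_const.mul (hu 0).snd).smul (ih.comp (hx.prodMk htail))
    · have hup : ∀ i, ContDiff ℝ ∞ fun y : (ℂ × ℝ) × (Fin (k + 1) → ℂ × ℝ) =>
          Function.update (Fin.tail y.2) j (coneGamma f y.1.1 (y.2 0) (Fin.tail y.2 j)) i := ?_
      · exact ih.comp (hx.prodMk (contDiff_pi.2 hup))
      intro i
      by_cases hij : i = j
      · subst hij
        simp only [Function.update_self]
        exact hf.contDiff_coneGamma hx.fst (hu 0) (hu i.succ)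
      · simp only [Function.update_of_ne hij]
        exact hu i.succ

/-- Homogeneity in each slot suffices in place of full multilinearity: it reduces estimates to the
unit ball, and it lets the factor `r⁻¹` of the Christoffel symbol be pulled out. -/
theorem scaledDeriv_smul (k : ℕ) (x : ℂ × ℝ) (c : Fin k → ℝ) (u : Fin k → ℂ × ℝ) :
    scaledDeriv f Q k x (fun i => c i • u i) = (∏ i, c i) • scaledDeriv f Q k x u := by
  induction k generalizing x with
  | zero => simp [scaledDeriv]
  | succ k ih =>
    have htail : Fin.tail (fun i => c i • u i) = fun i => Fin.tail c i • Fin.tail u i := rfl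
    have hprod : ∏ i, c i = c 0 * ∏ i, Fin.tail c i := Fin.prod_univ_succ c
    set P := fun y : (ℂ × ℝ) × (Fin k → ℂ × ℝ) => scaledDeriv f Q k y.1 y.2 with hP
    have hPd : Differentiable ℝ P := (hf.contDiff_scaledDeriv hQ k).differentiable (by simp)
    -- Rescaling of the slots is the linear map `L`; the induction hypothesis, an identity for `P ∘
    -- L`, is differentiated by the chain rule.
    let L : ((ℂ × ℝ) × (Fin k → ℂ × ℝ)) →L[ℝ] ((ℂ × ℝ) × (Fin k → ℂ × ℝ)) :=
      (ContinuousLinearMap.fst ℝ _ _).prod (ContinuousLinearMap.pi fun i =>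
        Fin.tail c i • (ContinuousLinearMap.proj i).comp (ContinuousLinearMap.snd ℝ _ _))
    have hL (y) : L y = (y.1, fun i => Fin.tail c i • y.2 i) := rfl
    have hPL : P ∘ L = fun y => (∏ i, Fin.tail c i) • P y := by
      funext y
      exact ih y.1 (Fin.tail c) y.2
    have hder (y d) : fderiv ℝ P (L y) (L d) = (∏ i, Fin.tail c i) • fderiv ℝ P y d := by
      have := congrArg (fun F => fderiv ℝ F y d) hPL
      beta_reduce at this
      rwa [fderiv_comp y (hPd _) L.differentiableAt, L.fderiv, fderiv_fun_const_smul (hPd y)] at this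
    rw [scaledDeriv, scaledDeriv, smul_sub, smul_sub, htail]
    congr 1
    · congr 1
      · have h1 := hder (x, Fin.tail u)
          (c 0 • (((u 0).1, -(x.2 * (u 0).2)), fun i => ((u 0).2 • (Fin.tail u i).1, 0)))
        rw [map_smul (fderiv ℝ P (x, Fin.tail u)), smul_smul, mul_comm _ (c 0), ← hprod] at h1
        rw [← h1]
        congr 1
        refine Prod.ext (Prod.ext rfl ?_) (funext fun i => Prod.ext ?_ ?_)
        · simp [L]; ring
        · simp [L]; ring_nf
        · simp [L]
      · rw [ih, hprod, smul_smul, smul_smul]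
        congr 1
        simp
        ring
    · rw [Finset.smul_sum]
      refine Finset.sum_congr rfl fun j _ => ?_
      rw [hf.coneGamma_smul_smul, ← Finset.prod_update_tail_mul c j, ← ih]
      congr 1
      funext i
      by_cases hij : i = j
      · subst hij; simp
      · simp [hij]

theorem scaledDeriv_update_smul (k : ℕ) (x : ℂ × ℝ) (u : Fin k → ℂ × ℝ) (j : Fin k) (c : ℝ)
    (a : ℂ × ℝ) : scaledDeriv f Q k x (Function.update u j (c • a)) =
      c • scaledDeriv f Q k x (Function.update u j a) := by
  have := hf.scaledDeriv_smul hQ k x (Function.update 1 j c) (Function.update u j a)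
  rw [Finset.prod_update_of_mem (Finset.mem_univ j)] at this
  simp only [Pi.one_apply, Finset.prod_const_one, mul_one] at this
  rw [← this]
  congr 1
  funext i
  by_cases hij : i = j
  · subst hij; simp
  · simp [hij]

/-- Every covariant derivative costs exactly one factor `r⁻¹`. What remains is smooth in `r⁻¹` up to
the value `0`, which stands for infinity. -/
theorem covDeriv_coneMap {h : ℂ × ℝ → G} (hh : ∀ y : ℂ × ℝ, y.2 ≠ 0 → h y = y.2⁻¹ • Q (y.1, y.2⁻¹))
    (k : ℕ) {x : ℂ × ℝ} (hx : x.2 ≠ 0) (v : Fin k → ℂ × ℝ) : covDeriv (coneMap f) h k x v =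
      (x.2⁻¹ ^ (k + 1)) • scaledDeriv f Q k (x.1, x.2⁻¹) (fun i => scaleLink x.2 (v i)) := by
  induction k generalizing x with
  | zero => simpa [covDeriv, scaledDeriv] using hh x hx
  | succ k ih =>
    set P := fun y : (ℂ × ℝ) × (Fin k → ℂ × ℝ) => scaledDeriv f Q k y.1 y.2 with hP
    have hPd : Differentiable ℝ P := (hf.contDiff_scaledDeriv hQ k).differentiable (by simp)
    set t := Fin.tail v
    let Ψ : ℂ × ℝ → (ℂ × ℝ) × (Fin k → ℂ × ℝ) := fun y =>
      ((y.1, y.2⁻¹), fun i => (y.2 • (t i).1, (t i).2))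
    have hev : (fun y => covDeriv (coneMap f) h k y t) =ᶠ[nhds x]
        fun y => (y.2⁻¹ ^ (k + 1)) • P (Ψ y) := by
      filter_upwards [(isOpen_ne_fun continuous_snd continuous_const).mem_nhds hx] with y hy
      exact ih hy t
    have hinv : HasFDerivAt (fun y : ℂ × ℝ => y.2⁻¹)
        ((-(x.2 ^ 2)⁻¹) • ContinuousLinearMap.snd ℝ ℂ ℝ) x :=
      (hasDerivAt_inv hx).comp_hasFDerivAt x hasFDerivAt_snd
    set s : Fin k → ℂ × ℝ := fun i => scaleLink x.2 (t i) with hs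
    obtain ⟨Ψ', hΨ, hΨ'⟩ : ∃ Ψ', HasFDerivAt Ψ Ψ' x ∧ Ψ' (v 0) = x.2⁻¹ •
        (((scaleLink x.2 (v 0)).1, -(x.2⁻¹ * (scaleLink x.2 (v 0)).2)),
          fun i => ((scaleLink x.2 (v 0)).2 • (s i).1, 0)) := by
      refine ⟨_, (hasFDerivAt_fst.prodMk hinv).prodMk
        (hasFDerivAt_pi.2 fun i => (hasFDerivAt_snd.smul_const (t i).1).prodMk
          (hasFDerivAt_const (t i).2 x)), ?_⟩
      refine Prod.ext (Prod.ext ?_ ?_) (funext fun i => Prod.ext ?_ ?_)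
      · simp [scaleLink, hx]
      · simp [scaleLink]; ring
      · simp only [hs, scaleLink]
        simp only [ContinuousLinearMap.prod_apply, ContinuousLinearMap.pi_apply, Prod.smul_mk,
          Pi.smul_apply, ContinuousLinearMap.smulRight_apply, ContinuousLinearMap.coe_snd']
        rw [smul_comm (v 0).2 x.2, inv_smul_smul₀ hx]
      · simp
    obtain ⟨c', hc, hc'⟩ : ∃ c', HasFDerivAt (fun y : ℂ × ℝ => y.2⁻¹ ^ (k + 1)) c' x ∧
        c' (v 0) = -((k + 1) * x.2⁻¹ ^ (k + 2) * (v 0).2) := by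
      refine ⟨_, hinv.pow (k + 1), ?_⟩
      simp
      ring
    have hmain : HasFDerivAt (fun y => (y.2⁻¹ ^ (k + 1)) • P (Ψ y)) _ x :=
      hc.fun_smul (HasFDerivAt.comp (g := P) x (hPd _).hasFDerivAt hΨ)
    rw [covDeriv, hev.fderiv_eq, hmain.fderiv, scaledDeriv]
    have hsum (j : Fin k) : covDeriv (coneMap f) h k x
        (Function.update t j (christoffel (coneMap f) x (v 0) (t j))) = x.2⁻¹ ^ (k + 2) •
          scaledDeriv f Q k (x.1, x.2⁻¹)
            (Function.update s j (coneGamma f x.1 (scaleLink x.2 (v 0)) (s j))) := by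
      rw [ih hx, pow_succ _ (k + 1), mul_smul, ← hf.scaledDeriv_update_smul hQ,
        ← hf.scaleLink_christoffel hx]
      congr 2
      funext i
      by_cases hij : i = j
      · subst hij; simp
      · simp [hij, hs]
    change _ - ∑ j, covDeriv (coneMap f) h k x
      (Function.update t j (christoffel (coneMap f) x (v 0) (t j))) = _
    rw [Finset.sum_congr rfl fun j _ => hsum j, ← Finset.smul_sum, smul_sub]
    congr 1
    simp only [add_apply, smul_apply, ContinuousLinearMap.smulRight_apply,
      ContinuousLinearMap.comp_apply, hΨ', hc', map_smul]
    change _ • _ • fderiv ℝ P ((x.1, x.2⁻¹), s) _ + _ • scaledDeriv f Q k (x.1, x.2⁻¹) s =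
      _ • (fderiv ℝ P ((x.1, x.2⁻¹), s) _ - (_ * (v 0).2) • scaledDeriv f Q k (x.1, x.2⁻¹) s)
    rw [smul_sub, smul_smul, smul_smul, sub_eq_add_neg, ← neg_smul]
    congr 2
    ring

end IsSLMap

/-! ### Uniform estimates at infinity -/

namespace IsSLMap

variable {f : ℂ → C3} (hf : IsSLMap f Set.univ) {K : Set ℂ} (hK : IsCompact K)
include hf hK

/-- Compactness, with `η = 0` included in the range, bounds the values on unit vectors; homogeneity
gives the rest. -/
theorem exists_scaledDeriv_bound {G : Type*} [NormedAddCommGroup G] [NormedSpace ℝ G]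
    {Q : ℂ × ℝ → G} (hQ : ContDiff ℝ ∞ Q) (k : ℕ) : ∃ C, ∀ z ∈ K, ∀ η : ℝ, |η| ≤ 1 → ∀ u,
      ‖scaledDeriv f Q k (z, η) u‖ ≤ C * ∏ i, ‖u i‖ := by
  obtain ⟨C, hC⟩ := ((hK.prod (isCompact_closedBall (0 : ℝ) 1)).prod
    (isCompact_closedBall (0 : Fin k → ℂ × ℝ) 1)).exists_bound_of_continuousOn
      (hf.contDiff_scaledDeriv hQ k).continuous.continuousOn
  refine ⟨C, fun z hz η hη u => ?_⟩
  have hu : u = fun i => ‖u i‖ • (‖u i‖⁻¹ • u i) := by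
    funext i
    by_cases h0 : u i = 0
    · simp [h0]
    · rw [smul_inv_smul₀ (norm_ne_zero_iff.2 h0)]
  conv_lhs => rw [hu, hf.scaledDeriv_smul hQ]
  rw [norm_smul, Real.norm_of_nonneg (Finset.prod_nonneg fun i _ => norm_nonneg _), mul_comm]
  refine mul_le_mul_of_nonneg_right (hC ((z, η), _) ⟨⟨hz, ?_⟩, ?_⟩)
    (Finset.prod_nonneg fun i _ => norm_nonneg _)
  · simpa using hη
  · rw [mem_closedBall_zero_iff, pi_norm_le_iff_of_nonneg zero_le_one]
    intro i
    rw [norm_smul, norm_inv, norm_norm]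
    exact inv_mul_le_one

/-- Converts bounds on rescaled coordinate vectors into bounds for the norm of the cone metric. -/
theorem exists_norm_scaleLink_le : ∃ M : ℝ, 0 ≤ M ∧ ∀ z ∈ K, ∀ (r : ℝ) (v : ℂ × ℝ),
    ‖scaleLink r v‖ ≤ M * ‖fderiv ℝ (coneMap f) (z, r) v‖ := by
  have hne (z) : ‖partialS f z‖ ≠ 0 := norm_ne_zero_iff.2 (hf.partialS_ne_zero (Set.mem_univ z))
  have hc : Continuous fun z => ‖partialS f z‖⁻¹ :=
    (hf.contDiff.fderiv_apply_const 1).continuous.norm.inv₀ hne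
  obtain ⟨M, hM⟩ := hK.exists_bound_of_continuousOn hc.continuousOn
  refine ⟨max M 1, le_max_of_le_right zero_le_one, fun z hz r v => ?_⟩
  have h1 := hf.norm_fderiv_coneMap_sq (z, r) v
  simp only at h1
  set D := ‖fderiv ℝ (coneMap f) (z, r) v‖
  have hD : 0 ≤ D := norm_nonneg _
  have h2 : ‖partialS f z‖ * ‖(scaleLink r v).1‖ ≤ D := by
    refine (pow_le_pow_iff_left₀ (by positivity) hD two_ne_zero).1 ?_
    rw [h1, mul_pow]
    exact le_add_of_nonneg_right (sq_nonneg _)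
  have h3 : |(scaleLink r v).2| ≤ D := by
    refine (pow_le_pow_iff_left₀ (by positivity) hD two_ne_zero).1 ?_
    rw [h1, sq_abs]
    exact le_add_of_nonneg_left (by positivity)
  have h4 : ‖partialS f z‖⁻¹ ≤ M := by simpa using hM z hz
  rw [Prod.norm_def]
  refine max_le ?_ (h3.trans (le_mul_of_one_le_left hD (le_max_right _ _)))
  calc ‖(scaleLink r v).1‖ = ‖partialS f z‖⁻¹ * (‖partialS f z‖ * ‖(scaleLink r v).1‖) := by
        rw [inv_mul_cancel_left₀ (hne z)]
    _ ≤ max M 1 * D := mul_le_mul (h4.trans (le_max_left _ _)) h2 (by positivity)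
        (le_max_of_le_right zero_le_one)

theorem exists_covDerivBound {G : Type*} [NormedAddCommGroup G] [NormedSpace ℝ G]
    {Q : ℂ × ℝ → G} (hQ : ContDiff ℝ ∞ Q) {h : ℂ × ℝ → G}
    (hh : ∀ y : ℂ × ℝ, y.2 ≠ 0 → h y = y.2⁻¹ • Q (y.1, y.2⁻¹)) (k : ℕ) :
    ∃ C : ℝ, ∀ z ∈ K, ∀ r : ℝ, 1 < |r| →
      CovDerivBound (coneMap f) h k (z, r) (C * |r| ^ ((-1 : ℝ) - k)) := by
  obtain ⟨C, hC⟩ := hf.exists_scaledDeriv_bound hK hQ k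
  obtain ⟨M, hM0, hM⟩ := hf.exists_norm_scaleLink_le hK
  refine ⟨max C 0 * M ^ k, fun z hz r hr v => ?_⟩
  have hr0 : r ≠ 0 := by rintro rfl; simp at hr; linarith
  have hrp : 0 < |r| := abs_pos.2 hr0
  have hpow : |r| ^ ((-1 : ℝ) - k) = |r|⁻¹ ^ (k + 1) := by
    rw [inv_pow, ← Real.rpow_natCast, ← Real.rpow_neg hrp.le]
    congr 1
    push_cast
    ring
  rw [hf.covDeriv_coneMap hQ hh k (x := (z, r)) hr0, norm_smul, norm_pow, norm_inv,
    Real.norm_eq_abs, hpow, mul_comm]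
  have h1 := hC z hz r⁻¹ (by rw [abs_inv]; exact inv_le_one_of_one_le₀ hr.le)
    (fun i => scaleLink r (v i))
  have h2 : ∏ i, ‖scaleLink r (v i)‖ ≤ M ^ k * ∏ i, ‖fderiv ℝ (coneMap f) (z, r) (v i)‖ := by
    calc ∏ i, ‖scaleLink r (v i)‖ ≤ ∏ i, (M * ‖fderiv ℝ (coneMap f) (z, r) (v i)‖) :=
          Finset.prod_le_prod (fun i _ => norm_nonneg _) fun i _ => hM z hz r (v i)
      _ = _ := by rw [Finset.prod_mul_distrib]; simp
  calc ‖scaledDeriv f Q k (z, r⁻¹) fun i => scaleLink r (v i)‖ * |r|⁻¹ ^ (k + 1)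
      ≤ (max C 0 * (M ^ k * ∏ i, ‖fderiv ℝ (coneMap f) (z, r) (v i)‖)) * |r|⁻¹ ^ (k + 1) := by
        refine mul_le_mul_of_nonneg_right (h1.trans ?_) (by positivity)
        exact mul_le_mul (le_max_left _ _) h2 (Finset.prod_nonneg fun i _ => norm_nonneg _)
          (le_max_right _ _)
    _ = _ := by ring

theorem exists_injective_radius (w : ℂ) : ∃ R : ℝ, ∀ z ∈ K, ∀ r : ℝ, R < |r| →
    Function.Injective (fderiv ℝ (ruledMap f w) (z, r)) := by
  have hne (z) : ‖partialT f z‖ ≠ 0 := norm_ne_zero_iff.2 fun h0 =>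
    Complex.I_ne_zero (hf.injective z (Set.mem_univ z) (a₁ := Complex.I) (a₂ := 0)
      (h0.trans (map_zero _).symm))
  have hslice : ContDiff ℝ ∞ fun z => ruledMap f w (z, 0) :=
    (hf.contDiff_ruledMap w).comp (contDiff_prodMk_left 0)
  have hc : Continuous fun z =>
      ‖crossC3 (f z) (partialS (fun z => ruledMap f w (z, 0)) z)‖ * ‖partialT f z‖⁻¹ :=
    (hf.contDiff.crossC3 (hslice.fderiv_apply_const 1)).continuous.norm.mul
      ((hf.contDiff.fderiv_apply_const Complex.I).continuous.norm.inv₀ hne)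
  obtain ⟨R, hR⟩ := hK.exists_bound_of_continuousOn hc.continuousOn
  refine ⟨R, fun z hz r hr => hf.injective_fderiv_ruledMap w z r fun h0 => ?_⟩
  rw [hf.cross_partialS_ruledMap, add_eq_zero_iff_neg_eq] at h0
  have h1 := hR z hz
  rw [← h0, norm_neg, norm_smul, mul_inv_cancel_right₀ (hne z), norm_norm, Real.norm_eq_abs] at h1
  exact absurd h1 (not_le.2 hr)

end IsSLMap

/-- Orthogonality of `φ` and `ψ` gives `|r| ≤ ‖point‖`, so over a compact base only a compact part
of the 3-fold meets a given ball. -/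
theorem RuledFold.isClosed_carrier {S : Type*} [TopologicalSpace S] [ChartedSpace ℂ S]
    [CompactSpace S] (N : RuledFold S) : IsClosed N.carrier := by
  have hc : Continuous N.point :=
    (continuous_snd.smul (N.smooth_φ.continuous.comp continuous_fst)).add
      (N.smooth_ψ.continuous.comp continuous_fst)
  have hle (q : S × ℝ) : |q.2| ≤ ‖N.point q‖ := by
    refine (pow_le_pow_iff_left₀ (abs_nonneg _) (norm_nonneg _) two_ne_zero).1 ?_
    rw [RuledFold.point, norm_add_sq_real, inner_smul_left, N.orthogonal, norm_smul, N.norm_φ]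
    simp
  refine isClosed_of_closure_subset fun x hx => ?_
  have h1 : x ∈ closure (Metric.ball x 1 ∩ N.carrier) :=
    Metric.isOpen_ball.inter_closure ⟨Metric.mem_ball_self one_pos, hx⟩
  have h2 : IsCompact (N.point '' (Set.univ ×ˢ Set.Icc (-(‖x‖ + 1)) (‖x‖ + 1))) :=
    (isCompact_univ.prod isCompact_Icc).image hc
  have h3 : Metric.ball x 1 ∩ N.carrier ⊆
      N.point '' (Set.univ ×ˢ Set.Icc (-(‖x‖ + 1)) (‖x‖ + 1)) := by
    rintro _ ⟨hb, q, rfl⟩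
    refine ⟨q, ⟨Set.mem_univ _, abs_le.1 ((hle q).trans ?_)⟩, rfl⟩
    have := norm_le_norm_add_norm_sub' (N.point q) x
    rw [mem_ball_iff_norm] at hb
    linarith
  obtain ⟨q, -, hq⟩ := h2.isClosed.closure_subset_iff.2 h3 h1
  exact ⟨q, hq⟩

/-! ### The end of the deformation and its diffeomorphism with the end of the cone -/

namespace IsSLUniformization

variable {S : Type*} [TopologicalSpace S] [ChartedSpace ℂ S]
  {φ : S → C3} {a b : ℂ} {p : ℂ → S} (h : IsSLUniformization φ a b p)
include h

/-- The automorphism of the surface induced by a translation of the plane. -/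
noncomputable def translate (c : ℂ) (σ : S) : S :=
  p (Function.surjInv h.isLattice.surjective σ + c)

theorem translate_apply (c z : ℂ) : h.translate c (p z) = p (z + c) := by
  obtain ⟨m, n, hmn⟩ := (h.isLattice.eq_iff _ _).1
    (Function.surjInv_eq h.isLattice.surjective (p z))
  exact (h.isLattice.eq_iff _ _).2 ⟨m, n, by rw [← hmn]; ring⟩

theorem translate_neg_translate (c : ℂ) (σ : S) : h.translate (-c) (h.translate c σ) = σ := by
  obtain ⟨z, rfl⟩ := h.isLattice.surjective σ
  rw [h.translate_apply, h.translate_apply, add_neg_cancel_right]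

variable [IsManifold 𝓘(ℂ) ω S]

theorem contMDiffOn_translate (w : ℂ) :
    ContMDiffOn (𝓘(ℝ, ℂ).prod 𝓘(ℝ, ℝ)) (𝓘(ℝ, ℂ).prod 𝓘(ℝ, ℝ)) ∞
      (fun q : S × ℝ => (h.translate (q.2⁻¹ • w) q.1, q.2)) {q | q.2 ≠ 0} := by
  rintro ⟨σ, r⟩ hr
  obtain ⟨z, rfl⟩ := h.isLattice.surjective σ
  obtain ⟨e, he, hz, hep⟩ := h.isHolImmersion.exists_chart z
  have hσ : p z ∈ e.source := by rw [← hep]; exact e.map_target hz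
  refine (ContMDiffAt.prodMk ?_ contMDiffAt_snd).contMDiffWithinAt
  have hinv : ContMDiffAt (𝓘(ℝ, ℂ).prod 𝓘(ℝ, ℝ)) 𝓘(ℝ, ℂ) ∞
      (fun q : S × ℝ => q.2⁻¹ • w) (p z, r) :=
    ContMDiffAt.comp (I' := 𝓘(ℝ, ℝ)) (g := fun t : ℝ => t⁻¹ • w) (p z, r)
      ((contDiffAt_inv ℝ hr).smul contDiffAt_const).contMDiffAt contMDiffAt_snd
  have hcoord : ContMDiffAt (𝓘(ℝ, ℂ).prod 𝓘(ℝ, ℝ)) 𝓘(ℝ, ℂ) ∞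
      (fun q : S × ℝ => e q.1) (p z, r) :=
    ContMDiffAt.comp (I' := 𝓘(ℝ, ℂ)) (p z, r)
      ((contMDiffOn_holCoords ∞ he).contMDiffAt (e.open_source.mem_nhds hσ)) contMDiffAt_fst
  have hmain : ContMDiffAt (𝓘(ℝ, ℂ).prod 𝓘(ℝ, ℝ)) 𝓘(ℝ, ℂ) ∞
      (fun q : S × ℝ => p (e q.1 + q.2⁻¹ • w)) (p z, r) :=
    ContMDiffAt.comp (I' := 𝓘(ℝ, ℂ)) (p z, r) (h.isHolImmersion.contMDiff_real ∞).contMDiffAt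
      (hcoord.add hinv)
  refine hmain.congr_of_eventuallyEq ?_
  have hc : ContinuousAt (fun q : S × ℝ => q.1) (p z, r) := continuousAt_fst
  filter_upwards [hc.preimage_mem_nhds (e.open_source.mem_nhds hσ)] with q hq
  have : p (e q.1) = q.1 := by rw [← hep]; exact e.left_inv hq
  rw [← h.translate_apply, this]

/-- The diffeomorphism of the ends of the cone and of its deformation in the direction `w`. -/
noncomputable def endDiffeo (w : ℂ) {R : ℝ} (hR : 0 ≤ R) :
    OpenPartialHomeomorph (S × ℝ) (S × ℝ) where
  -- The shift by `-w/r` changes `r φ` by `-ψ` to leading order, which compensates the added `ψ`.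
  toFun q := (h.translate (q.2⁻¹ • -w) q.1, q.2)
  invFun q := (h.translate (q.2⁻¹ • w) q.1, q.2)
  source := {q | R < |q.2|}
  target := {q | R < |q.2|}
  map_source' _ hq := hq
  map_target' _ hq := hq
  left_inv' q _ := Prod.ext (by
    have := h.translate_neg_translate (q.2⁻¹ • -w) q.1
    rwa [smul_neg, neg_neg, ← smul_neg] at this) rfl
  right_inv' q _ := Prod.ext (by
    have := h.translate_neg_translate (q.2⁻¹ • w) q.1
    rwa [← smul_neg] at this) rfl
  open_source := isOpen_lt continuous_const continuous_snd.abs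
  open_target := isOpen_lt continuous_const continuous_snd.abs
  continuousOn_toFun := (h.contMDiffOn_translate (-w)).continuousOn.mono fun _ hq =>
    abs_pos.1 (hR.trans_lt hq)
  continuousOn_invFun := (h.contMDiffOn_translate w).continuousOn.mono fun _ hq =>
    abs_pos.1 (hR.trans_lt hq)

theorem asymptoticToCone (hS : IsTorus S) (w : ℂ) :
    AsymptoticToCone (h.ruledFold w) φ (-1) := by
  have := hS.compactSpace
  obtain ⟨K₀, hK₀, hK₀p⟩ := h.exists_compact hS
  obtain ⟨R₀, hR₀⟩ := h.isSLMap.exists_injective_radius hK₀ w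
  obtain ⟨Q, hQ, hQeq⟩ := exists_taylor_remainder h.smooth w
  -- Beyond `R₀` the map is an immersion; beyond `1` the variable `r⁻¹` stays in the range of the
  -- compactness bounds.
  set R := max R₀ 1
  have hR : 0 < R := lt_max_of_lt_right one_pos
  have hne : {q : S × ℝ | R < |q.2|} ⊆ {q | q.2 ≠ 0} := fun q hq => abs_pos.1 (hR.trans hq)
  refine ⟨by norm_num, RuledFold.isClosed_carrier _, R, Set.univ ×ˢ Set.Icc (-R) R,
    h.endDiffeo w hR.le, hR, isCompact_univ.prod isCompact_Icc, ?_, rfl, ?_,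
    (h.contMDiffOn_translate (-w)).mono hne, (h.contMDiffOn_translate w).mono hne, fun k => ?_⟩
  · rintro ⟨σ, r⟩ hq
    obtain ⟨z, hz, rfl⟩ : σ ∈ p '' K₀ := hK₀p ▸ Set.mem_univ σ
    refine h.nonsingularAt_of_injective w (hR₀ z hz r ?_)
    have hr : ¬ |r| ≤ R := fun hr => hq ⟨Set.mem_univ _, abs_le.1 hr⟩
    exact (le_max_left _ _).trans_lt (not_le.1 hr)
  · ext q
    simp only [Set.mem_compl_iff, Set.mem_prod, Set.mem_univ, true_and, Set.mem_Icc, ← abs_le,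
      not_le]
    rfl
  · have hh : ∀ y : ℂ × ℝ, y.2 ≠ 0 →
        (h.ruledFold w).point (h.endDiffeo w hR.le (p y.1, y.2)) - conePoint φ (p y.1, y.2) =
          y.2⁻¹ • Q (y.1, y.2⁻¹) := by
      intro y hy
      have h1 : h.endDiffeo w hR.le (p y.1, y.2) = (p (y.1 - y.2⁻¹ • w), y.2) := by
        change (h.translate (y.2⁻¹ • -w) (p y.1), y.2) = _
        rw [h.translate_apply, smul_neg, sub_eq_add_neg]
      have h2 := congrArg (fun X => y.2 • X) (hQeq (y.1, y.2⁻¹))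
      beta_reduce at h2
      rw [smul_sub, smul_add, smul_smul, smul_smul, mul_inv_cancel₀ hy, one_smul] at h2
      rw [h1, h.ruledFold_point w (y.1 - y.2⁻¹ • w, y.2)]
      refine Eq.trans h2 ?_
      congr 1
      field_simp
    obtain ⟨C, hC⟩ := h.isSLMap.exists_covDerivBound hK₀ hQ hh k
    refine ⟨C, R, le_rfl, fun σ => ?_⟩
    obtain ⟨z, hz, rfl⟩ : σ ∈ p '' K₀ := hK₀p ▸ Set.mem_univ σ
    -- In a chart inverse to `p` the cone is `coneMap`. Choosing the representative `z` in the fixed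
    -- compact set `K₀` makes `C` independent of `σ`.
    obtain ⟨e, he, hzt, hep⟩ := h.isHolImmersion.exists_chart z
    have hez : e (p z) = z := by rw [← hep]; exact e.right_inv hzt
    refine ⟨e, he, by rw [← hep]; exact e.map_target hzt, fun r hr => ?_⟩
    rw [hez, hep]
    exact hC z hz r ((le_max_right _ _).trans_lt hr)

end IsSLUniformization

/-! ### The deformation theorem -/

theorem theorem6p3 {S : Type*} [TopologicalSpace S] [ChartedSpace ℂ S] [IsManifold 𝓘(ℂ) ω S]
    (hS : IsTorus S) (φ : S → C3) (hφ : IsSLCone φ) :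
    ∃ (a b : ℂ) (p : ℂ → S) (N : ℝ → ℝ → RuledFold S),
      IsLatticeUniformization a b p ∧
      (∀ u v : ℝ, (N u v).φ = φ ∧
        ∀ z : ℂ, (N u v).ψ (p z) = u • partialS (φ ∘ p) z + v • partialT (φ ∘ p) z) ∧
      (∀ u v : ℝ, (N u v).IsSpecialLagrangian ∧
        (N u v).asymptoticCone = coneSet φ ∧
        AsymptoticToCone (N u v) φ (-1)) ∧
      (∀ u v u' v' : ℝ, (N u v).orientedLines = (N u' v').orientedLines → u = u' ∧ v = v') := by
  obtain ⟨a, b, p, h⟩ := exists_isSLUniformization hS hφ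
  refine ⟨a, b, p, fun u v => h.ruledFold ⟨u, v⟩, h.isLattice, fun u v => ⟨rfl, fun z => ?_⟩,
    fun u v => ⟨h.isSpecialLagrangian _, h.asymptoticCone_eq _, h.asymptoticToCone hS _⟩,
    fun u v u' v' huv => ?_⟩
  · exact (h.extend_apply _ z).trans (fderiv_complex_apply _ _)
  · have := h.eq_of_orientedLines_eq hφ huv
    exact ⟨congrArg Complex.re this, congrArg Complex.im this⟩
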